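/- Let $d\ge 1$, let $X_1,X_2,\dots$ be i.i.d. $\mathbb R^d$-valued random vectors with bounded density $f$, let $\alpha\in\mathbb N^d$, $|\alpha|=\alpha_1+\cdots+\alpha_d$, let $\partial^{[\alpha]}=\partial^{|\alpha|}/\partial x_1^{\alpha_1}\cdots\partial x_d^{\alpha_d}$ ($\partial^{[0]}g=g$), let $D^{j}$ denote the $j$-th differential, let $(h_n)_{n\ge1}$ and $(v_n)_{n\ge1}$ be positive sequences, and let $$\partial^{[\alpha]}f_n(x)=\frac1n\sum_{i=1}^n\frac1{h_i^{d+|\alpha|}}\,\partial^{[\alpha]}K\Big(\frac{x-X_i}{h_i}\Big),\qquad a_n=\sum_{i=1}^n h_i^{d+2|\alpha|}.$$ Assume: 1. $K:\mathbb R^d\to\mathbb R$ is bounded and integrable, $\int K=1$, and $K(z)\to0$ as $\|z\|\to\infty$. 2. There is an integer $q\ge2$ such that: for all $1\le s\le q-1$ and $1\le j\le d$, $\int_{\mathbb R}y_j^sK(y)\,dy_j=0$ (integration over the $j$-th coordinate only, for almost all values of the other coordinates); $\int_{\mathbb R^d}|y_j^qK(y)|\,dy<\infty$ for all $j$; $\frac{v_n}{n}\sum_{i=1}^nh_i^q\to0$;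 $\partial^{[\alpha]}f$ is $q$-times differentiable on $\mathbb R^d$ and $\sup_x\|D^q\partial^{[\alpha]}f(x)\|<\infty$. 3. $\xi>0$ and $\int\|x\|^\xi f(x)\,dx<\infty$; $f$ is uniformly continuous. 4. $\partial^{[\alpha]}K$ is Hölder continuous, and $z\mapsto\|z\|^\gamma\partial^{[\alpha]}K(z)$ is bounded for some $\gamma>0$. 5. $v_n^2\log(1/h_n)/a_n\to0$ and $v_n^2\log v_n/a_n\to0$. 6. $\int\|z\|^\zeta|K(z)|\,dz<\infty$ for some $\zeta>0$, and $z\mapsto\|z\|^\eta\partial^{[\alpha]}f(z)$ is bounded for some $\eta>0$. Assume moreover that one of the following two cases holds. (A) $|\alpha|=0$, $v_n\equiv1$, and $h_n=cn^{-a}$ with $c>0$ and $0<a<1/d$. (B) Either $|\alpha|\ge1$ and $v_n\equiv1$, or $|\alpha|\ge0$, $v_n\to\infty$ and $v_n^2/a_n\to0$; and moreover: $h_n=h(n)$ where $h$ is a positive, measurable, locally bounded function on $]0,\infty[$ that varies regularly with exponent $-a$, $0<a<1/(d+2|\alpha|)$ (that is, $h(t)=t^{-a}L(t)$ with $L(tx)/L(t)\to1$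 as $t\to\infty$ for every $x>0$); $K$ is $|\alpha|$-times differentiable, $\|D^{j}K(x)\|\to0$ as $\|x\|\to\infty$ for $0\le j<|\alpha|$, $\partial^{[\alpha]}K$ is bounded and integrable and $\int[\partial^{[\alpha]}K]^2\ne0$; $f$ is $|\alpha|$-times differentiable and $D^{j}f$ is bounded for $0\le j<|\alpha|$. For $U\subseteq\mathbb R^d$ put $\|f\|_{U,\infty}=\sup_{x\in U}|f(x)|$ ($=0$ if $U=\emptyset$) and $$\psi(u)=\int_{[0,1]\times\mathbb R^d}s^{-ad}\Big(e^{s^{ad}\frac{u}{1-ad}K(z)}-1\Big)ds\,dz,\qquad I(t)=\sup_{u\in\mathbb R}\{ut-\psi(u)\}\in{]{-\infty},\infty]}.$$ If $\|f\|_{U,\infty}>0$ let $$g_U(\delta)=\|f\|_{U,\infty}(1-ad)\,I\Big(\frac1{1-ad}+\frac{\delta}{\|f\|_{U,\infty}(1-ad)}\Big)\ \text{ in case (A)},\qquad g_U(\delta)=\frac{\delta^2\big(1-a^2(d+2|\alpha|)^2\big)}{2\|f\|_{U,\infty}\int[\partial^{[\alpha]}K(z)]^2dz}\ \text{ in case (B)};$$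 if $\|f\|_{U,\infty}=0$ let $g_U(0)=0$ and $g_U(\delta)=\infty$ for $\delta\ne0$. Let $\tilde g_U(\delta)=\min\{g_U(\delta),g_U(-\delta)\}$. Then for every $U\subseteq\mathbb R^d$ and every $\delta>0$, with $\log0=-\infty$, $$-\tilde g_U(\delta)\le\liminf_{n\to\infty}\frac{v_n^2}{a_n}\log\mathbb P\Big[\sup_{x\in U}v_n\big|\partial^{[\alpha]}f_n(x)-\partial^{[\alpha]}f(x)\big|\ge\delta\Big]\le\limsup_{n\to\infty}\frac{v_n^2}{a_n}\log\mathbb P\Big[\sup_{x\in U}v_n\big|\partial^{[\alpha]}f_n(x)-\partial^{[\alpha]}f(x)\big|\ge\delta\Big]\le-\frac{\xi}{\xi+d}\,\tilde g_U(\delta).$$ -/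

import Mathlib

open MeasureTheory ProbabilityTheory Filter Topology
open scoped ENNReal NNReal

/-! ## Partial derivatives -/

/-- `ℝ^d` with its Euclidean norm. -/
abbrev Rd (d : ℕ) : Type := EuclideanSpace ℝ (Fin d)

/-- The length `|α| = α₁ + ⋯ + α_d` of a multi-index. -/
def multiLen {d : ℕ} (α : Fin d → ℕ) : ℕ := ∑ j, α j

/-- The first-order partial derivative `∂g/∂x_j`. -/
noncomputable def partialD {d : ℕ} (j : Fin d) (g : Rd d → ℝ) : Rd d → ℝ :=
  fun x => lineDeriv ℝ g x (EuclideanSpace.single j 1)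

/-- The partial derivative `∂^{|α|} g / ∂x₁^{α₁} ⋯ ∂x_d^{α_d}`. -/
noncomputable def multiD {d : ℕ} (α : Fin d → ℕ) (g : Rd d → ℝ) : Rd d → ℝ :=
  (List.finRange d).foldr (fun j u => (partialD j)^[α j] u) g

/-- `g` is `m`-times (Fréchet) differentiable on `ℝ^d`; the `m`-th differential need not be
continuous. -/
def TimesDifferentiable {d : ℕ} (m : ℕ) (g : Rd d → ℝ) : Prop :=
  ∀ j < m, Differentiable ℝ (iteratedFDeriv ℝ j g)

/-! ## The sample, the estimators and the rate functions -/

/-- `f` is a bounded probability density on `ℝ^d`. -/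
structure IsBoundedDensity {d : ℕ} (f : Rd d → ℝ) : Prop where
  nonneg : ∀ x, 0 ≤ f x
  integrable : Integrable f
  integral_eq_one : ∫ x, f x = 1
  bounded : ∃ C, ∀ x, f x ≤ C

/-- `X 1, X 2, …` are independent random vectors with common density `f` (the value `X 0` is not
used). -/
structure IsIIDSample {d : ℕ} {Ω : Type*} [MeasurableSpace Ω] (P : Measure Ω)
    (X : ℕ → Ω → Rd d) (f : Rd d → ℝ) : Prop where
  measurable : ∀ i, 1 ≤ i → Measurable (X i)
  law : ∀ i, 1 ≤ i → P.map (X i) = volume.withDensity (fun x => ENNReal.ofReal (f x))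
  indep : iIndepFun (fun i : ℕ => X (i + 1)) P

/-- The recursive kernel estimator of the `α`-th partial derivative at `x` computed from the points
`y 1, …, y n`:
`n⁻¹ ∑_{i=1}^n h_i^{-(d+|α|)} (∂^α K)((x - y_i)/h_i)`. -/
noncomputable def recEstimator {d : ℕ} (α : Fin d → ℕ) (K : Rd d → ℝ) (h : ℕ → ℝ)
    (y : ℕ → Rd d) (n : ℕ) (x : Rd d) : ℝ :=
  (1 / (n : ℝ)) * ∑ i ∈ Finset.Icc 1 n,
    (1 / h i ^ (d + multiLen α)) * multiD α K ((h i)⁻¹ • (x - y i))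

/-- `∑_{i=1}^n h_i^{d+2|α|}`. -/
noncomputable def bandSum {d : ℕ} (α : Fin d → ℕ) (h : ℕ → ℝ) (n : ℕ) : ℝ :=
  ∑ i ∈ Finset.Icc 1 n, h i ^ (d + 2 * multiLen α)

/-- `sup_{x ∈ U} v_n |∂^α f_n(x) - ∂^α f(x)|`, with values in `[0, ∞]`. -/
noncomputable def supDeviation {d : ℕ} (α : Fin d → ℕ) (K f : Rd d → ℝ) (h v : ℕ → ℝ)
    (U : Set (Rd d)) (y : ℕ → Rd d) (n : ℕ) : ℝ≥0∞ :=
  ⨆ x ∈ U, ENNReal.ofReal (v n * |recEstimator α K h y n x - multiD α f x|)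

/-- The normalized log-probability
`(v_n² / ∑_{i≤n} h_i^{d+2|α|}) log P[sup_U v_n |∂^α f_n - ∂^α f| ≥ δ]`, with `log 0 = -∞`. -/
noncomputable def normLogProb {d : ℕ} {Ω : Type*} [MeasurableSpace Ω] (P : Measure Ω)
    (X : ℕ → Ω → Rd d) (α : Fin d → ℕ) (K f : Rd d → ℝ) (h v : ℕ → ℝ)
    (U : Set (Rd d)) (δ : ℝ) (n : ℕ) : EReal :=
  ((v n ^ 2 / bandSum α h n : ℝ) : EReal) *
    ENNReal.log (P {ω | ENNReal.ofReal δ ≤ supDeviation α K f h v U (fun i => X i ω) n})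

/-- `ψ(u) = ∫_{[0,1] × ℝ^d} s^{-ad} (exp(s^{ad} u K(z) / (1 - ad)) - 1) ds dz`. -/
noncomputable def psiFun {d : ℕ} (a : ℝ) (K : Rd d → ℝ) (u : ℝ) : ℝ :=
  ∫ p in (Set.Icc (0 : ℝ) 1) ×ˢ (Set.univ : Set (Rd d)),
    p.1 ^ (-(a * d)) * (Real.exp (p.1 ^ (a * d) * (u / (1 - a * d)) * K p.2) - 1)

/-- The Fenchel-Legendre transform `I(t) = sup_u (u t - ψ(u))`, with values in `]-∞, ∞]`. -/
noncomputable def rateI {d : ℕ} (a : ℝ) (K : Rd d → ℝ) (t : ℝ) : EReal :=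
  ⨆ u : ℝ, ((u * t - psiFun a K u : ℝ) : EReal)

/-- `‖f‖_{U,∞} = sup_{x ∈ U} |f(x)|`, equal to `0` if `U` is empty. -/
noncomputable def supNormOn {d : ℕ} (f : Rd d → ℝ) (U : Set (Rd d)) : ℝ := ⨆ x : U, |f x|

/-- `(v_n)_{n ≥ 1} ≡ 1`. -/
def IsUnitSeq (v : ℕ → ℝ) : Prop := ∀ n, 1 ≤ n → v n = 1

open Classical in
/-- The rate `g_U`. When `‖f‖_{U,∞} = 0` it is the degenerate rate function
(`0` at `0`, and `∞` elsewhere). -/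
noncomputable def gRate {d : ℕ} (α : Fin d → ℕ) (a : ℝ) (K f : Rd d → ℝ) (v : ℕ → ℝ)
    (U : Set (Rd d)) (δ : ℝ) : EReal :=
  if supNormOn f U = 0 then (if δ = 0 then 0 else ⊤)
  else if multiLen α = 0 ∧ IsUnitSeq v then
    ((supNormOn f U * (1 - a * d) : ℝ) : EReal) *
      rateI a K (1 / (1 - a * d) + δ / (supNormOn f U * (1 - a * d)))
  else
    ((δ ^ 2 * (1 - a ^ 2 * ((d : ℝ) + 2 * multiLen α) ^ 2) /
      (2 * supNormOn f U * ∫ z, (multiD α K z) ^ 2) : ℝ) : EReal)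

/-- `g̃_U(δ) = min (g_U(δ)) (g_U(-δ))`. -/
noncomputable def gTilde {d : ℕ} (α : Fin d → ℕ) (a : ℝ) (K f : Rd d → ℝ) (v : ℕ → ℝ)
    (U : Set (Rd d)) (δ : ℝ) : EReal :=
  min (gRate α a K f v U δ) (gRate α a K f v U (-δ))

/-! ## Assumptions on the kernel, the bandwidth, the scale and the density -/

/-- `K` is bounded, integrable, of integral one, and vanishes at infinity. -/
structure IsKernel {d : ℕ} (K : Rd d → ℝ) : Prop where
  bounded : ∃ C, ∀ z, |K z| ≤ C
  integrable : Integrable K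
  integral_eq_one : ∫ z, K z = 1
  tendsto_zero : Tendsto K (cocompact (Rd d)) (𝓝 0)

/-- `h_n = c n^{-a}` for some `c > 0`, with `0 < a < 1/d`. -/
def IsPowerBandwidth (d : ℕ) (a : ℝ) (h : ℕ → ℝ) : Prop :=
  0 < a ∧ a < 1 / (d : ℝ) ∧ ∃ c : ℝ, 0 < c ∧ ∀ n : ℕ, 1 ≤ n → h n = c * (n : ℝ) ^ (-a)

/-- A positive measurable function on `]0,∞[` with `L(tx)/L(t) → 1` as `t → ∞`, for every
`x > 0`. -/
structure IsSlowlyVarying (L : ℝ → ℝ) : Prop where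
  pos : ∀ t, 0 < t → 0 < L t
  measurable : Measurable (fun t : Set.Ioi (0 : ℝ) => L t)
  tendsto : ∀ x, 0 < x → Tendsto (fun t => L (t * x) / L t) atTop (𝓝 1)

/-- `G(x) = x^ρ L(x)` on `]0,∞[` with `L` slowly varying. -/
def IsRegularlyVarying (ρ : ℝ) (G : ℝ → ℝ) : Prop :=
  ∃ L : ℝ → ℝ, IsSlowlyVarying L ∧ ∀ x, 0 < x → G x = x ^ ρ * L x

/-- `h_n = G(n)` with `G` locally bounded on `]0,∞[` and regularly varying of exponent `-a`, where
`0 < a < 1/(d + 2|α|)`. -/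
def IsRegVarBandwidth {d : ℕ} (α : Fin d → ℕ) (a : ℝ) (h : ℕ → ℝ) : Prop :=
  0 < a ∧ a < 1 / ((d : ℝ) + 2 * multiLen α) ∧
    ∃ G : ℝ → ℝ, (∀ s t : ℝ, 0 < s → ∃ C, ∀ x ∈ Set.Icc s t, |G x| ≤ C) ∧
      IsRegularlyVarying (-a) G ∧ ∀ n : ℕ, 1 ≤ n → h n = G n

/-- Differentiability of the kernel: `K` is `|α|`-times differentiable, its differentials of order
less than `|α|` vanish at infinity, `∂^α K` is bounded and integrable and `∫ (∂^α K)² ≠ 0`. -/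
structure IsSmoothKernel {d : ℕ} (α : Fin d → ℕ) (K : Rd d → ℝ) : Prop where
  differentiable : TimesDifferentiable (multiLen α) K
  tendsto_zero : ∀ j < multiLen α,
    Tendsto (fun x => ‖iteratedFDeriv ℝ j K x‖) (cocompact (Rd d)) (𝓝 0)
  bounded : ∃ C, ∀ z, |multiD α K z| ≤ C
  integrable : Integrable (multiD α K)
  integral_sq_ne_zero : ∫ z, (multiD α K z) ^ 2 ≠ 0

/-- `f` is `|α|`-times differentiable with bounded differentials of order less than `|α|`. -/
structure IsSmoothDensity {d : ℕ} (α : Fin d → ℕ) (f : Rd d → ℝ) : Prop where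
  differentiable : TimesDifferentiable (multiLen α) f
  bounded : ∀ j < multiLen α, ∃ C, ∀ x, ‖iteratedFDeriv ℝ j f x‖ ≤ C

/-- `v_n → ∞` and `v_n² / ∑_{i≤n} h_i^{d+2|α|} → 0`. -/
def IsModerateScale {d : ℕ} (α : Fin d → ℕ) (h v : ℕ → ℝ) : Prop :=
  Tendsto v atTop atTop ∧ Tendsto (fun n => v n ^ 2 / bandSum α h n) atTop (𝓝 0)

/-- The point `y` with its `j`-th coordinate replaced by `t`. -/
def replaceCoord {d : ℕ} (y : Rd d) (j : Fin d) (t : ℝ) : Rd d :=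
  WithLp.toLp 2 (Function.update (WithLp.ofLp y) j t)

/-- The bias condition of order `q ≥ 2`: the partial moments `∫_ℝ y_j^s K(y) dy_j`
(the integral is over the `j`-th coordinate alone, for almost all values of the other coordinates)
vanish for `1 ≤ s < q`, `∫ |y_j^q K(y)| dy < ∞`, `(v_n / n) ∑_{i≤n} h_i^q → 0`, and `∂^α f` is
`q`-times differentiable with bounded `q`-th differential. -/
def BiasCondition {d : ℕ} (α : Fin d → ℕ) (K f : Rd d → ℝ) (h v : ℕ → ℝ) : Prop :=
  ∃ q : ℕ, 2 ≤ q ∧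
    (∀ s : ℕ, 1 ≤ s → s < q → ∀ j : Fin d,
      ∀ᵐ y : Rd d, ∫ t : ℝ, t ^ s * K (replaceCoord y j t) = 0) ∧
    (∀ j : Fin d, Integrable (fun y : Rd d => |(y j) ^ q * K y|)) ∧
    Tendsto (fun n : ℕ => v n / (n : ℝ) * ∑ i ∈ Finset.Icc 1 n, h i ^ q) atTop (𝓝 0) ∧
    TimesDifferentiable q (multiD α f) ∧
    (∃ M, ∀ x, ‖iteratedFDeriv ℝ q (multiD α f) x‖ ≤ M)

/-- `∂^α K` is Hölder continuous, and `‖z‖^γ ∂^α K(z)` is bounded for some `γ > 0`. -/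
structure KernelRegularity {d : ℕ} (α : Fin d → ℕ) (K : Rd d → ℝ) : Prop where
  holder : ∃ C r : ℝ≥0, 0 < r ∧ r ≤ 1 ∧ HolderWith C r (multiD α K)
  decay : ∃ γ : ℝ, 0 < γ ∧ ∃ C, ∀ z, |‖z‖ ^ γ * multiD α K z| ≤ C

/-- `v_n² log(1/h_n) / ∑_{i≤n} h_i^{d+2|α|} → 0` and
`v_n² log v_n / ∑_{i≤n} h_i^{d+2|α|} → 0`. -/
def ScaleLogCondition {d : ℕ} (α : Fin d → ℕ) (h v : ℕ → ℝ) : Prop :=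
  Tendsto (fun n => v n ^ 2 * Real.log (1 / h n) / bandSum α h n) atTop (𝓝 0) ∧
    Tendsto (fun n => v n ^ 2 * Real.log (v n) / bandSum α h n) atTop (𝓝 0)

/-- `∫ ‖z‖^ζ |K(z)| dz < ∞` for some `ζ > 0`, and `‖z‖^η ∂^α f(z)` is bounded for some
`η > 0`. -/
structure TailCondition {d : ℕ} (α : Fin d → ℕ) (K f : Rd d → ℝ) : Prop where
  kernel_moment : ∃ ζ : ℝ, 0 < ζ ∧ Integrable (fun z : Rd d => ‖z‖ ^ ζ * |K z|)
  density_decay : ∃ η : ℝ, 0 < η ∧ ∃ C, ∀ z, |‖z‖ ^ η * multiD α f z| ≤ C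

/-! Multiplied by the speed `a_n / v_n²`, the normalized deviation at a point `x` is a deterministic
constant plus a sum of independent kernel terms with weights `kernelWeight`. Its moment generating
function is a product, and each factor is expanded as `1 + t`, where `t` is a linear part plus
`h_i^d ∫ (e^{wk} - 1 - wk) f(x - h_i z) dz`. The linear parts add up to the mean of the estimator,
which the moment conditions on `K` make negligible after centering. In the remainders uniform
continuity replaces `f(x - h_i z)` by `f(x)`. Hence the normalized log-moment generating function at
`u` tends to `f(x) Λ(u)`, uniformly in `x` (`tendstoUniformly_log_mgf`).

The limit `Λ` comes from regular variation. In case (A) the weights, indexed by `⌈n s⌉`, converge to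
`s^{ad}/(1 - ad)`, and `Λ` is `jumpCumulant`. In case (B) the weights tend to zero uniformly, so
only the quadratic part of the exponential survives; its variance is a product of two Karamata
limits. Either way `g_U` is the Legendre transform of `‖f‖_{U,∞} Λ`.

For the lower bound the supremum is at least the deviation at one point of `U` where `f` is close to
`‖f‖_{U,∞}`, and a Gärtner–Ellis type estimate (`exp_neg_le_measureReal_of_log_mgf`) is applied
there, for overestimation or for underestimation.

For the upper bound (`eventually_measureReal_supDeviation_le`) a ball of radius `e^{b s_n}`, `s_n`
the speed, is covered by about `e^{bd s_n}` points up to subexponential factors, and Chernoff's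
bound costs `e^{-J s_n}` at each. Outside the ball the deviation is small unless some observation is
large, which by the moment of order `ξ` has probability about `e^{-ξ b s_n}`. The balance `J - bd =
ξ b` gives the factor `ξ/(ξ+d)`. -/

/-! ## Slowly varying functions and averages of regularly varying sequences -/

/-- The uniform convergence theorem for additive slowly varying functions. -/
theorem uniform_convergence_of_slowly_varying {ℓ : ℝ → ℝ} (hm : Measurable ℓ)
    (hl : ∀ u, Tendsto (fun y => ℓ (y + u) - ℓ y) atTop (𝓝 0)) {ε : ℝ} (hε : 0 < ε) :
    ∃ Y, ∀ y, Y ≤ y → ∀ u ∈ Set.Icc (0 : ℝ) 1, |ℓ (y + u) - ℓ y| ≤ ε := by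
  -- Truncation at `1` makes the increments bounded, so that dominated convergence applies to their
  -- integrals.
  set m : ℝ → ℝ → ℝ := fun y u => min 1 |ℓ (y + u) - ℓ y| with hmdef
  have hmm : ∀ y, Measurable (m y) := fun y => by
    have : Measurable fun u : ℝ => ℓ (y + u) := hm.comp (measurable_const_add y)
    exact measurable_const.min ((this.sub_const _).abs)
  have hm0 : ∀ y u, 0 ≤ m y u := fun y u => le_min zero_le_one (abs_nonneg _)
  have hm1 : ∀ y u, m y u ≤ 1 := fun y u => min_le_left _ _
  have hmi : ∀ y (a b : ℝ), IntegrableOn (m y) (Set.Icc a b) := fun y a b =>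
    Measure.integrableOn_of_bounded (M := 1) (by simp) (hmm y).aestronglyMeasurable
      (Eventually.of_forall fun u => by
        rw [Real.norm_eq_abs, abs_of_nonneg (hm0 y u)]; exact hm1 y u)
  have hJ : Tendsto (fun y => ∫ u in Set.Icc (0 : ℝ) 2, m y u) atTop (𝓝 0) := by
    have := tendsto_integral_filter_of_dominated_convergence (μ := volume.restrict (Set.Icc (0:ℝ) 2))
      (l := atTop) (F := m) (f := fun _ => (0 : ℝ)) (fun _ => (1 : ℝ))
      (Eventually.of_forall fun y => (hmm y).aestronglyMeasurable)
      (Eventually.of_forall fun y => Eventually.of_forall fun u => by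
        rw [Real.norm_eq_abs, abs_of_nonneg (hm0 y u)]; exact hm1 y u)
      (integrable_const _)
      (Eventually.of_forall fun u => by
        have h1 := ((hl u).abs)
        have h2 : Tendsto (fun y => min (1 : ℝ) |ℓ (y + u) - ℓ y|) atTop (𝓝 (min 1 |0|)) :=
          tendsto_const_nhds.min h1
        simpa using h2)
    simpa using this
  -- Two integrals below this threshold bound `m y u` below `1/2`. The truncation is then inactive
  -- and `m y u` is the true increment.
  have hδ : 0 < min ε (1 / 2) / 3 := by positivity
  obtain ⟨Y, hY⟩ := (hJ.eventually (gt_mem_nhds hδ)).exists_forall_of_atTop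
  refine ⟨Y, fun y hy u hu => ?_⟩
  -- The triangle inequality through `y + u + w`, averaged over `w ∈ [0,1]`. Both resulting windows
  -- lie in `[0,2]`, which explains the interval used for `hJ`.
  have key : m y u ≤ (∫ w in Set.Icc (0 : ℝ) 1, m (y + u) w) + ∫ w in Set.Icc (0 : ℝ) 1, m y (u + w) := by
    have hint2 : IntegrableOn (fun w => m y (u + w)) (Set.Icc (0 : ℝ) 1) :=
      Measure.integrableOn_of_bounded (M := 1) (by simp)
        ((hmm y).comp (measurable_const_add u)).aestronglyMeasurable
        (Eventually.of_forall fun w => by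
          rw [Real.norm_eq_abs, abs_of_nonneg (hm0 y _)]; exact hm1 y _)
    rw [← integral_add (hmi _ _ _) hint2]
    have : m y u = ∫ w in Set.Icc (0 : ℝ) 1, m y u := by simp
    rw [this]
    refine integral_mono (integrable_const _) ((hmi _ _ _).add hint2) fun w => ?_
    simp only [hmdef]
    have tri : |ℓ (y + u) - ℓ y| ≤ |ℓ (y + u + w) - ℓ (y + u)| + |ℓ (y + (u + w)) - ℓ y| := by
      rw [← add_assoc y u w]
      have := abs_sub_le (ℓ (y + u)) (ℓ (y + u + w)) (ℓ y)
      rwa [abs_sub_comm (ℓ (y + u)) (ℓ (y + u + w))] at this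
    rcases min_cases (1 : ℝ) |ℓ (y + u + w) - ℓ (y + u)| with h1 | h1 <;>
    rcases min_cases (1 : ℝ) |ℓ (y + (u + w)) - ℓ y| with h2 | h2 <;>
    rcases min_cases (1 : ℝ) |ℓ (y + u) - ℓ y| with h3 | h3 <;>
    rw [h1.1, h2.1, h3.1] <;>
    linarith [abs_nonneg (ℓ (y + u + w) - ℓ (y + u)), abs_nonneg (ℓ (y + (u + w)) - ℓ y),
      abs_nonneg (ℓ (y + u) - ℓ y)]
  have b1 : (∫ w in Set.Icc (0 : ℝ) 1, m (y + u) w) ≤ ∫ w in Set.Icc (0 : ℝ) 2, m (y + u) w :=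
    setIntegral_mono_set (hmi _ _ _) (Eventually.of_forall fun w => hm0 _ _)
      (Set.Icc_subset_Icc_right (by norm_num)).eventuallyLE
  have b2 : (∫ w in Set.Icc (0 : ℝ) 1, m y (u + w)) ≤ ∫ w in Set.Icc (0 : ℝ) 2, m y w := by
    have e : (∫ w in Set.Icc (0 : ℝ) 1, m y (u + w)) = ∫ w in Set.Icc u (u + 1), m y w := by
      rw [integral_Icc_eq_integral_Ioc, integral_Icc_eq_integral_Ioc,
        ← intervalIntegral.integral_of_le (by norm_num),
        ← intervalIntegral.integral_of_le (by linarith),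
        intervalIntegral.integral_comp_add_left (fun w => m y w) u]
      simp
    rw [e]
    exact setIntegral_mono_set (hmi _ _ _) (Eventually.of_forall fun w => hm0 _ _)
      (Set.Icc_subset_Icc hu.1 (by linarith [hu.2])).eventuallyLE
  have c1 := hY (y + u) (by linarith [hu.1])
  have c2 := hY y hy
  have : m y u < min ε (1 / 2) := by linarith
  simp only [hmdef] at this
  have h4 : min (1 : ℝ) |ℓ (y + u) - ℓ y| < 1 / 2 := this.trans_le (min_le_right _ _)
  have h5 : min (1 : ℝ) |ℓ (y + u) - ℓ y| < ε := this.trans_le (min_le_left _ _)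
  rcases min_lt_iff.1 h5 with h6 | h6
  · rcases min_lt_iff.1 h4 with h7 | h7
    · norm_num at h7
    · rw [min_eq_right (by linarith)] at h5; exact h5.le
  · exact h6.le

/-- Chaining: one fractional step and `⌊w⌋` unit steps, each costing at most `ε`. This is the Potter
bound in additive form. -/
theorem potter_bound_of_uniform {ℓ : ℝ → ℝ} {ε Y : ℝ} (hε : 0 < ε)
    (h : ∀ y, Y ≤ y → ∀ u ∈ Set.Icc (0 : ℝ) 1, |ℓ (y + u) - ℓ y| ≤ ε) {y w : ℝ} (hy : Y ≤ y)
    (hw : 0 ≤ w) : |ℓ (y + w) - ℓ y| ≤ ε * (w + 1) := by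
  have key : ∀ n : ℕ, ∀ u ∈ Set.Icc (0 : ℝ) 1, |ℓ (y + (n + u)) - ℓ y| ≤ ε * (n + 1) := by
    intro n
    induction n with
    | zero => intro u hu; simpa using h y hy u hu
    | succ n ih =>
      intro u hu
      have h1 := h (y + (n + u)) (by have := hu.1; have : (0:ℝ) ≤ n := n.cast_nonneg; linarith [hu.1]) 1 ⟨by norm_num, le_rfl⟩
      have h2 := ih u hu
      have e : y + (((n + 1 : ℕ) : ℝ) + u) = y + (n + u) + 1 := by push_cast; ring
      rw [e]
      have := abs_sub_le (ℓ (y + (n + u) + 1)) (ℓ (y + (n + u))) (ℓ y)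
      push_cast
      linarith
  have h1 := key ⌊w⌋₊ (w - ⌊w⌋₊) ⟨by linarith [Nat.floor_le hw], by linarith [Nat.lt_floor_add_one w]⟩
  rw [add_sub_cancel] at h1
  refine h1.trans (mul_le_mul_of_nonneg_left (by linarith [Nat.floor_le hw]) hε.le)

/-- A positive sequence that varies regularly with exponent `-a`, in the form given by the uniform
convergence theorem and the Potter bounds. -/
structure IsRegVarSeq (a : ℝ) (h : ℕ → ℝ) : Prop where
  pos : ∀ n, 1 ≤ n → 0 < h n
  potter : ∀ ε : ℝ, 0 < ε → ∃ C, 0 ≤ C ∧ ∀ i n : ℕ, 1 ≤ i → i ≤ n →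
    |(Real.log (h i) + a * Real.log i) - (Real.log (h n) + a * Real.log n)|
      ≤ ε * Real.log ((n : ℝ) / i) + C
  tendsto : ∀ s : ℝ, 0 < s → s ≤ 1 → Tendsto (fun n : ℕ =>
    (Real.log (h ⌈n * s⌉₊) + a * Real.log (⌈n * s⌉₊ : ℕ)) - (Real.log (h n) + a * Real.log n))
    atTop (𝓝 0)

/-- In the variable `log n` the slowly varying part of the sequence is a sampled additive function,
so uniform convergence and chaining apply beyond some index; the finitely many smaller indices are
absorbed by a constant. -/
theorem IsRegVarSeq.of_log {a : ℝ} {h : ℕ → ℝ} (hpos : ∀ n, 1 ≤ n → 0 < h n) {ℓ : ℝ → ℝ}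
    (hm : Measurable ℓ) (hl : ∀ u, Tendsto (fun y => ℓ (y + u) - ℓ y) atTop (𝓝 0))
    (hh : ∀ n : ℕ, 1 ≤ n → Real.log (h n) + a * Real.log n = ℓ (Real.log n)) :
    IsRegVarSeq a h := by
  have pot : ∀ ε : ℝ, 0 < ε → ∃ N : ℕ, 1 ≤ N ∧ ∀ i n : ℕ, N ≤ i → i ≤ n →
      |ℓ (Real.log i) - ℓ (Real.log n)| ≤ ε * (Real.log ((n : ℝ) / i) + 1) := by
    intro ε hε
    obtain ⟨Y, hY⟩ := uniform_convergence_of_slowly_varying hm hl hε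
    refine ⟨max 1 ⌈Real.exp Y⌉₊, le_max_left _ _, fun i n hi hin => ?_⟩
    have hi1 : 1 ≤ i := (le_max_left _ _).trans hi
    have hi0 : (0 : ℝ) < i := by exact_mod_cast hi1
    have hn0 : (0 : ℝ) < n := by exact_mod_cast hi1.trans hin
    have hlog : Y ≤ Real.log i := by
      rw [Real.le_log_iff_exp_le hi0]
      exact (Nat.le_ceil _).trans (by exact_mod_cast (le_max_right _ _).trans hi)
    have hw : 0 ≤ Real.log ((n : ℝ) / i) :=
      Real.log_nonneg ((one_le_div hi0).2 (by exact_mod_cast hin))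
    have := potter_bound_of_uniform hε hY hlog hw
    rw [Real.log_div hn0.ne' hi0.ne', add_sub_cancel, abs_sub_comm] at this
    rwa [Real.log_div hn0.ne' hi0.ne']
  refine ⟨hpos, fun ε hε => ?_, fun s hs hs1 => ?_⟩
  · obtain ⟨N, hN1, hN⟩ := pot ε hε
    -- `B` dominates all values at indices up to `N`; a pair with `i < N ≤ n` is compared through
    -- `N` at the extra cost `2 * B`.
    set B : ℝ := ∑ j ∈ Finset.range (N + 1), |ℓ (Real.log j)| with hB
    have hB0 : ∀ j, j ≤ N → |ℓ (Real.log j)| ≤ B := fun j hj =>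
      Finset.single_le_sum (f := fun j : ℕ => |ℓ (Real.log j)|) (fun _ _ => abs_nonneg _)
        (Finset.mem_range.2 (by omega))
    have hBn : 0 ≤ B := Finset.sum_nonneg fun _ _ => abs_nonneg _
    refine ⟨ε + 2 * B, by positivity, fun i n hi hin => ?_⟩
    rw [hh i hi, hh n (hi.trans hin)]
    have hi0 : (0 : ℝ) < i := by exact_mod_cast hi
    have hn0 : (0 : ℝ) < n := by exact_mod_cast hi.trans hin
    have hw : 0 ≤ Real.log ((n : ℝ) / i) :=
      Real.log_nonneg ((one_le_div hi0).2 (by exact_mod_cast hin))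
    rcases le_or_gt N i with h1 | h1
    · have := hN i n h1 hin
      nlinarith
    · rcases le_or_gt N n with h2 | h2
      · have h3 := hN N n le_rfl h2
        have h4 := hB0 i h1.le
        have h5 := hB0 N le_rfl
        have h6 := abs_sub_le (ℓ (Real.log i)) (ℓ (Real.log N)) (ℓ (Real.log n))
        have h7 := abs_sub (ℓ (Real.log i)) (ℓ (Real.log N))
        have hN0 : (0 : ℝ) < N := by exact_mod_cast hN1
        have h8 : Real.log ((n : ℝ) / N) ≤ Real.log ((n : ℝ) / i) := by
          apply Real.log_le_log (by positivity)
          exact div_le_div_of_nonneg_left hn0.le hi0 (by exact_mod_cast h1.le)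
        nlinarith
      · have h4 := hB0 i h1.le
        have h5 := hB0 n h2.le
        have h7 := abs_sub (ℓ (Real.log i)) (ℓ (Real.log n))
        nlinarith
  · rw [Metric.tendsto_atTop]
    intro ε hε
    -- Since `n / ⌈n s⌉ ≤ 1 / s`, the Potter factor for the pair `(⌈n s⌉, n)` is at most `log (1/s)
    -- + 1 < M`.
    set M : ℝ := Real.log (1 / s) + 2 with hM
    have hls : 0 ≤ Real.log (1 / s) := Real.log_nonneg (by rw [le_div_iff₀ hs]; linarith)
    obtain ⟨N, hN1, hN⟩ := pot (ε / M) (by positivity)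
    refine ⟨⌈(N : ℝ) / s⌉₊, fun n hn => ?_⟩
    have hns : (N : ℝ) ≤ n * s := by
      have : (N : ℝ) / s ≤ n := (Nat.le_ceil _).trans (by exact_mod_cast hn)
      rwa [div_le_iff₀ hs] at this
    have hN0 : (1 : ℝ) ≤ N := by exact_mod_cast hN1
    have hn0 : (0 : ℝ) < n := by
      by_contra hcon
      nlinarith
    have hce : N ≤ ⌈(n : ℝ) * s⌉₊ := by
      have : (N : ℝ) ≤ (⌈(n : ℝ) * s⌉₊ : ℕ) := hns.trans (Nat.le_ceil _)
      exact_mod_cast this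
    have hle : ⌈(n : ℝ) * s⌉₊ ≤ n := by
      apply Nat.ceil_le.2
      nlinarith
    have hc1 : 1 ≤ ⌈(n : ℝ) * s⌉₊ := hN1.trans hce
    rw [hh _ hc1, hh n (hc1.trans hle), dist_zero_right, Real.norm_eq_abs]
    have h1 := hN _ n hce hle
    have h2 : Real.log ((n : ℝ) / (⌈(n : ℝ) * s⌉₊ : ℕ)) ≤ Real.log (1 / s) := by
      have hc0 : (0 : ℝ) < (⌈(n : ℝ) * s⌉₊ : ℕ) := by exact_mod_cast hc1
      apply Real.log_le_log (by positivity)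
      rw [div_le_div_iff₀ hc0 hs, one_mul]
      exact Nat.le_ceil _
    have hMp : 0 < M := by positivity
    calc _ ≤ ε / M * (Real.log (1 / s) + 1) :=
          h1.trans (mul_le_mul_of_nonneg_left (by linarith) (by positivity))
      _ < ε / M * M := mul_lt_mul_of_pos_left (by linarith) (by positivity)
      _ = ε := by field_simp

theorem IsPowerBandwidth.isRegVarSeq {d : ℕ} {a : ℝ} {h : ℕ → ℝ} (hh : IsPowerBandwidth d a h) :
    IsRegVarSeq a h := by
  obtain ⟨-, -, c, hc, hn⟩ := hh
  have hp : ∀ n : ℕ, 1 ≤ n → (0 : ℝ) < n := fun n h => by exact_mod_cast h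
  refine IsRegVarSeq.of_log (ℓ := fun _ => Real.log c) (fun n h1 => ?_) measurable_const ?_
    (fun n h1 => ?_)
  · rw [hn n h1]; have := hp n h1; positivity
  · intro u; simp
  · have := hp n h1
    rw [hn n h1, Real.log_mul hc.ne' (by positivity), Real.log_rpow this]; ring

theorem IsRegVarBandwidth.isRegVarSeq {d : ℕ} {α : Fin d → ℕ} {a : ℝ} {h : ℕ → ℝ}
    (hh : IsRegVarBandwidth α a h) : IsRegVarSeq a h := by
  obtain ⟨-, -, G, -, ⟨L, hL, hGL⟩, hn⟩ := hh
  have hp : ∀ n : ℕ, 1 ≤ n → (0 : ℝ) < n := fun n h => by exact_mod_cast h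
  have hval : ∀ n : ℕ, 1 ≤ n → h n = (n : ℝ) ^ (-a) * L n := fun n h1 => by
    rw [hn n h1, hGL _ (hp n h1)]
  refine IsRegVarSeq.of_log (ℓ := fun y => Real.log (L (Real.exp y))) (fun n h1 => ?_) ?_ ?_
    (fun n h1 => ?_)
  · rw [hval n h1]; have := hp n h1; have := hL.pos n this; positivity
  · have : Measurable fun y : ℝ => L (Real.exp y) :=
      hL.measurable.comp (Real.measurable_exp.subtype_mk (h := fun y => Real.exp_pos y))
    exact Real.measurable_log.comp this
  · intro u
    have h1 := (hL.tendsto (Real.exp u) (Real.exp_pos u)).comp Real.tendsto_exp_atTop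
    have h2 := (Real.continuousAt_log one_ne_zero).tendsto.comp h1
    rw [Real.log_one] at h2
    refine h2.congr fun y => ?_
    simp only [Function.comp_apply]
    rw [← Real.exp_add, Real.log_div (hL.pos _ (Real.exp_pos _)).ne' (hL.pos _ (Real.exp_pos _)).ne']
  · have := hp n h1
    have h2 := hL.pos n this
    rw [hval n h1, Real.log_mul (by positivity) h2.ne', Real.log_rpow this, Real.exp_log this]; ring

/-- Averages of a triangular array that converges pointwise under an integrable power bound. -/
theorem tendsto_average_of_dominated {x : ℕ → ℕ → ℝ} {φ : ℝ → ℝ} {C θ : ℝ} (hθ0 : 0 ≤ θ)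
    (hθ : θ < 1) (hC : 0 ≤ C)
    (hb : ∀ᶠ n : ℕ in atTop, ∀ i : ℕ, 1 ≤ i → i ≤ n → |x n i| ≤ C * ((n : ℝ) / i) ^ θ)
    (hx : ∀ s : ℝ, 0 < s → s ≤ 1 → Tendsto (fun n : ℕ => x n ⌈n * s⌉₊) atTop (𝓝 (φ s))) :
    Tendsto (fun n : ℕ => (1 / (n : ℝ)) * ∑ i ∈ Finset.Icc 1 n, x n i) atTop
      (𝓝 (∫ s in Set.Ioc (0 : ℝ) 1, φ s)) := by
  -- The average is the integral over `(0,1]` of the step function `s ↦ x n ⌈n s⌉`, which equals `x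
  -- n (k+1)` on `(k/n, (k+1)/n]`. It is dominated by a multiple of `s^{-θ}`, integrable because `θ
  -- < 1`.
  have hmeas : ∀ n : ℕ, Measurable fun s : ℝ => x n ⌈n * s⌉₊ := fun n =>
    (measurable_from_top (f := x n)).comp (Nat.measurable_ceil.comp (measurable_const_mul _))
  have hbound : ∀ᶠ n : ℕ in atTop, ∀ s ∈ Set.Ioc (0 : ℝ) 1, |x n ⌈n * s⌉₊| ≤ C * s ^ (-θ) := by
    filter_upwards [hb, eventually_ge_atTop 1] with n hn hn1 s hs
    have hn0 : (0 : ℝ) < n := by exact_mod_cast hn1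
    have hns : 0 < (n : ℝ) * s := mul_pos hn0 hs.1
    have hc1 : 1 ≤ ⌈(n : ℝ) * s⌉₊ := Nat.ceil_pos.2 hns
    have hcn : ⌈(n : ℝ) * s⌉₊ ≤ n := Nat.ceil_le.2 (by nlinarith [hs.2])
    refine (hn _ hc1 hcn).trans (mul_le_mul_of_nonneg_left ?_ hC)
    have hc0 : (0 : ℝ) < (⌈(n : ℝ) * s⌉₊ : ℕ) := by exact_mod_cast hc1
    rw [Real.rpow_neg hs.1.le, ← Real.inv_rpow hs.1.le]
    apply Real.rpow_le_rpow (by positivity) _ hθ0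
    rw [div_le_iff₀ hc0, inv_mul_eq_div, le_div_iff₀ hs.1]
    exact Nat.le_ceil _
  have hint : IntegrableOn (fun s : ℝ => C * s ^ (-θ)) (Set.Ioc 0 1) := by
    have := (intervalIntegral.intervalIntegrable_rpow' (a := 0) (b := 1) (r := -θ) (by linarith))
    rw [intervalIntegrable_iff_integrableOn_Ioc_of_le zero_le_one] at this
    exact this.const_mul C
  have hlim := tendsto_integral_filter_of_dominated_convergence
    (μ := volume.restrict (Set.Ioc (0:ℝ) 1)) (l := atTop) (F := fun (n : ℕ) s => x n ⌈n * s⌉₊)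
    (f := φ) (fun s => C * s ^ (-θ)) (Eventually.of_forall fun n => (hmeas n).aestronglyMeasurable)
    (by
      filter_upwards [hbound] with n hn
      filter_upwards [ae_restrict_mem measurableSet_Ioc] with s hs
      exact hn s hs) hint
    (by
      filter_upwards [ae_restrict_mem measurableSet_Ioc] with s hs
      exact hx s hs.1 hs.2)
  refine hlim.congr' ?_
  filter_upwards [hbound, eventually_ge_atTop 1] with n hn hn1
  have hn0 : (0 : ℝ) < n := by exact_mod_cast hn1
  have hint1 : IntegrableOn (fun s : ℝ => x n ⌈n * s⌉₊) (Set.Ioc 0 1) := by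
    refine Integrable.mono' hint (hmeas n).aestronglyMeasurable ?_
    filter_upwards [ae_restrict_mem measurableSet_Ioc] with s hs
    exact hn s hs
  have hii : ∀ k < n, IntervalIntegrable (fun s : ℝ => x n ⌈n * s⌉₊) volume
      ((k : ℝ) / n) (((k + 1 : ℕ) : ℝ) / n) := by
    intro k hk
    rw [intervalIntegrable_iff_integrableOn_Ioc_of_le (by gcongr; norm_num)]
    refine hint1.mono_set (Set.Ioc_subset_Ioc (by positivity) ?_)
    rw [div_le_one hn0]; exact_mod_cast hk
  have hsum := intervalIntegral.sum_integral_adjacent_intervals (a := fun k : ℕ => (k : ℝ) / n) hii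
  simp only [Nat.cast_zero, zero_div] at hsum
  rw [div_self hn0.ne', intervalIntegral.integral_of_le zero_le_one] at hsum
  rw [← hsum, Finset.mul_sum, Finset.range_eq_Ico, Finset.sum_Ico_eq_sum_range, ]
  rw [show Finset.Icc 1 n = Finset.Ico 1 (n + 1) by ext; simp, Finset.sum_Ico_eq_sum_range]
  simp only [Nat.add_sub_cancel, Nat.sub_zero, zero_add]
  refine Finset.sum_congr rfl fun k hk => ?_
  have : ∀ s ∈ Set.Ioc ((k : ℝ) / n) (((k + 1 : ℕ) : ℝ) / n), x n ⌈n * s⌉₊ = x n (1 + k) := by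
    intro s hs
    congr 1
    rw [Nat.ceil_eq_iff (by omega)]
    have h1 := hs.1
    have h2 := hs.2
    rw [div_lt_iff₀ hn0] at h1
    rw [le_div_iff₀ hn0] at h2
    push_cast at h2 ⊢
    rw [Nat.add_sub_cancel_left]
    constructor <;> nlinarith
  rw [intervalIntegral.integral_of_le (by gcongr; norm_num),
    setIntegral_congr_fun measurableSet_Ioc this]
  simp only [integral_const, MeasurableSet.univ, measureReal_restrict_apply, Set.univ_inter,
    Real.volume_real_Ioc, smul_eq_mul]
  rw [max_eq_left (by push_cast; rw [← sub_div]; simp)]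
  push_cast
  field_simp
  ring

namespace IsRegVarSeq

variable {a : ℝ} {h : ℕ → ℝ}

/-- Separates the exact power of `n / i` from the slowly varying factor, the only part that the
Potter bounds have to control. -/
theorem rpow_ratio (hh : IsRegVarSeq a h) (q : ℝ) {i n : ℕ} (hi : 1 ≤ i) (hn : 1 ≤ n) :
    (h i / h n) ^ q = Real.exp (q * ((Real.log (h i) + a * Real.log i) -
      (Real.log (h n) + a * Real.log n))) * ((n : ℝ) / i) ^ (a * q) := by
  have h1 := hh.pos i hi
  have h2 := hh.pos n hn
  have h3 : (0 : ℝ) < i := by exact_mod_cast hi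
  have h4 : (0 : ℝ) < n := by exact_mod_cast hn
  rw [Real.rpow_def_of_pos (div_pos h1 h2), Real.rpow_def_of_pos (div_pos h4 h3), ← Real.exp_add,
    Real.log_div h1.ne' h2.ne', Real.log_div h4.ne' h3.ne']
  congr 1; ring

theorem tendsto_rpow_ratio (hh : IsRegVarSeq a h) (q : ℝ) {s : ℝ} (hs : 0 < s) (hs1 : s ≤ 1) :
    Tendsto (fun n : ℕ => (h ⌈n * s⌉₊ / h n) ^ q) atTop (𝓝 (s ^ (-(a * q)))) := by
  have h1 := (((hh.tendsto s hs hs1).const_mul q).rexp)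
  rw [mul_zero, Real.exp_zero] at h1
  have h2 : Tendsto (fun n : ℕ => (n : ℝ) / (⌈n * s⌉₊ : ℕ)) atTop (𝓝 s⁻¹) := by
    have := ((tendsto_nat_ceil_mul_div_atTop hs.le).comp
      (tendsto_natCast_atTop_atTop (R := ℝ))).inv₀ hs.ne'
    refine this.congr fun n => ?_
    simp [mul_comm]
  have h3 := (Real.continuousAt_rpow_const (s⁻¹) (a * q) (Or.inl (inv_pos.2 hs).ne')).tendsto.comp h2
  have h4 := h1.mul h3
  rw [one_mul, Real.inv_rpow hs.le, ← Real.rpow_neg hs.le] at h4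
  refine h4.congr' ?_
  filter_upwards [eventually_ge_atTop 1] with n hn
  have hn0 : (0 : ℝ) < n := by exact_mod_cast hn
  rw [hh.rpow_ratio q (Nat.ceil_pos.2 (mul_pos hn0 hs)) hn]
  rfl

theorem rpow_ratio_le (hh : IsRegVarSeq a h) (q : ℝ) {ε : ℝ} (hε : 0 < ε) :
    ∃ C, 0 ≤ C ∧ ∀ i n : ℕ, 1 ≤ i → i ≤ n →
      (h i / h n) ^ q ≤ C * ((n : ℝ) / i) ^ (a * q + ε) := by
  -- Raising to the power `q` multiplies the Potter loss by `|q|`; this accuracy keeps it below `ε`.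
  obtain ⟨C, -, hb⟩ := hh.potter (ε / (|q| + 1)) (by positivity)
  refine ⟨Real.exp (|q| * C), (Real.exp_pos _).le, fun i n hi hin => ?_⟩
  rw [hh.rpow_ratio q hi (hi.trans hin)]
  have h3 : (0 : ℝ) < i := by exact_mod_cast hi
  have h4 : (0 : ℝ) < n := by exact_mod_cast hi.trans hin
  have h5 := hb i n hi hin
  have hw : 0 ≤ Real.log ((n : ℝ) / i) :=
    Real.log_nonneg ((one_le_div h3).2 (by exact_mod_cast hin))
  rw [Real.rpow_add (by positivity), mul_comm (_ ^ (a * q)), ← mul_assoc]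
  refine mul_le_mul_of_nonneg_right ?_ (by positivity)
  rw [Real.rpow_def_of_pos (by positivity) ε, ← Real.exp_add]
  apply Real.exp_le_exp.2
  refine (le_abs_self _).trans ?_
  rw [abs_mul]
  refine (mul_le_mul_of_nonneg_left h5 (abs_nonneg q)).trans ?_
  have h6 : |q| * (ε / (|q| + 1)) ≤ ε := by
    rw [mul_div_assoc', div_le_iff₀ (by positivity)]
    nlinarith [abs_nonneg q]
  nlinarith

/-- Karamata's theorem for sums. -/
theorem tendsto_average_rpow_ratio (hh : IsRegVarSeq a h) {q : ℝ} (hq : a * q < 1) :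
    Tendsto (fun n : ℕ => (1 / (n : ℝ)) * ∑ i ∈ Finset.Icc 1 n, (h i / h n) ^ q) atTop
      (𝓝 (1 / (1 - a * q))) := by
  -- Halfway between `max (a q) 0` and `1`: room for the Potter loss while `s^{-θ}` stays
  -- integrable.
  set θ : ℝ := (max (a * q) 0 + 1) / 2 with hθ
  have hm : max (a * q) 0 < 1 := max_lt hq one_pos
  obtain ⟨C, hC, hb⟩ := hh.rpow_ratio_le q (ε := θ - max (a * q) 0) (by rw [hθ]; linarith)
  have key := tendsto_average_of_dominated (x := fun n i => (h i / h n) ^ q)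
    (φ := fun s => s ^ (-(a * q))) (C := C) (θ := θ)
    (by rw [hθ]; have := le_max_right (a * q) 0; linarith) (by rw [hθ]; linarith) hC
    (Eventually.of_forall fun n i hi hin => by
      have h1 := hh.pos i hi
      have h2 := hh.pos n (hi.trans hin)
      have h3 : (0 : ℝ) < i := by exact_mod_cast hi
      rw [abs_of_nonneg (by positivity)]
      refine (hb i n hi hin).trans (mul_le_mul_of_nonneg_left ?_ hC)
      apply Real.rpow_le_rpow_of_exponent_le
      · rw [one_le_div h3]; exact_mod_cast hin
      · have := le_max_left (a * q) 0; linarith)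
    (fun s hs hs1 => hh.tendsto_rpow_ratio q hs hs1)
  have e : ∫ s in Set.Ioc (0 : ℝ) 1, s ^ (-(a * q)) = 1 / (1 - a * q) := by
    rw [← intervalIntegral.integral_of_le zero_le_one, integral_rpow (Or.inl (by linarith)),
      Real.one_rpow, Real.zero_rpow (by linarith), sub_zero]
    congr 1; ring
  rwa [e] at key

theorem log_bound (hh : IsRegVarSeq a h) {ε : ℝ} (hε : 0 < ε) :
    ∃ C, 0 ≤ C ∧ ∀ n : ℕ, 1 ≤ n → |Real.log (h n) + a * Real.log n| ≤ ε * Real.log n + C := by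
  obtain ⟨C, hC, hb⟩ := hh.potter ε hε
  refine ⟨C + |Real.log (h 1)|, by positivity, fun n hn => ?_⟩
  have h1 := hb 1 n le_rfl hn
  simp only [Nat.cast_one, Real.log_one, mul_zero, add_zero, div_one] at h1
  have h2 := abs_sub_abs_le_abs_sub (Real.log (h n) + a * Real.log n) (Real.log (h 1))
  rw [abs_sub_comm] at h2
  linarith

theorem tendsto_zero (hh : IsRegVarSeq a h) (ha : 0 < a) : Tendsto h atTop (𝓝 0) := by
  obtain ⟨C, hC, hb⟩ := hh.log_bound (ε := a / 2) (by positivity)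
  have h1 : Tendsto (fun n : ℕ => C - a / 2 * Real.log n) atTop atBot := by
    have := ((Real.tendsto_log_atTop.comp (tendsto_natCast_atTop_atTop (R := ℝ))).const_mul_atTop
      (show 0 < a / 2 by positivity))
    exact (tendsto_atBot_add_const_left _ C (tendsto_neg_atTop_atBot.comp this)).congr fun n => by
      simp [sub_eq_add_neg]
  have h2 := Real.tendsto_exp_atBot.comp h1
  refine squeeze_zero' ?_ ?_ h2
  · filter_upwards [eventually_ge_atTop 1] with n hn using (hh.pos n hn).le
  · filter_upwards [eventually_ge_atTop 1] with n hn
    have := hb n hn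
    rw [← Real.exp_log (hh.pos n hn)]
    apply Real.exp_le_exp.2
    have := le_abs_self (Real.log (h n) + a * Real.log n)
    linarith

/-- Polynomial growth of `1 / h_n` makes every power of it subexponential with respect to the speed,
as the discretization requires. -/
theorem inv_le_pow (hh : IsRegVarSeq a h) :
    ∃ C : ℝ, ∃ A : ℕ, 1 ≤ C ∧ ∀ n : ℕ, 1 ≤ n → (h n)⁻¹ ≤ C * (n : ℝ) ^ A := by
  obtain ⟨C, hC, hb⟩ := hh.log_bound (ε := 1) one_pos
  refine ⟨Real.exp C, ⌈a + 1⌉₊, Real.one_le_exp hC, fun n hn => ?_⟩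
  have hn0 : (1 : ℝ) ≤ n := by exact_mod_cast hn
  have h1 := (abs_le.1 (hb n hn)).1
  rw [← Real.exp_log (inv_pos.2 (hh.pos n hn)), Real.log_inv, ← Real.rpow_natCast]
  have h2 : (n : ℝ) ^ (a + 1) ≤ (n : ℝ) ^ ((⌈a + 1⌉₊ : ℕ) : ℝ) :=
    Real.rpow_le_rpow_of_exponent_le hn0 (Nat.le_ceil _)
  refine le_trans ?_ (mul_le_mul_of_nonneg_left h2 (Real.exp_pos _).le)
  rw [Real.rpow_def_of_pos (by linarith), ← Real.exp_add]
  apply Real.exp_le_exp.2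
  linarith

theorem tendsto_mul_pow_atTop (hh : IsRegVarSeq a h) {p : ℕ} (hp : a * p < 1) :
    Tendsto (fun n : ℕ => n * h n ^ p) atTop atTop := by
  have he : 0 < (1 - a * p) / (2 * (p + 1)) := div_pos (by linarith) (by positivity)
  obtain ⟨C, hC, hb⟩ := hh.log_bound he
  have h1 : Tendsto (fun n : ℕ => -(p * C) + (1 - a * p) / 2 * Real.log n) atTop atTop :=
    tendsto_atTop_add_const_left _ _
      ((Real.tendsto_log_atTop.comp (tendsto_natCast_atTop_atTop (R := ℝ))).const_mul_atTop
        (show 0 < (1 - a * p) / 2 by linarith))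
  refine tendsto_atTop_mono' _ ?_ (Real.tendsto_exp_atTop.comp h1)
  filter_upwards [eventually_ge_atTop 1] with n hn
  have hn0 : (0 : ℝ) < n := by exact_mod_cast hn
  have h0 := hh.pos n hn
  rw [← Real.exp_log (show 0 < (n : ℝ) * h n ^ p by positivity), Real.log_mul hn0.ne' (by positivity),
    Real.log_pow]
  apply Real.exp_le_exp.2
  have h2 := (abs_le.1 (hb n hn)).1
  have h3 : 0 ≤ Real.log n := Real.log_nonneg (by exact_mod_cast hn)
  have h4 : (p : ℝ) * ((1 - a * p) / (2 * (p + 1))) ≤ (1 - a * p) / 2 := by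
    rw [mul_div_assoc', div_le_div_iff₀ (by positivity) (by norm_num)]
    nlinarith
  have h5 := mul_le_mul_of_nonneg_left h2 (Nat.cast_nonneg (α := ℝ) p)
  nlinarith

end IsRegVarSeq

/-! ### The speed, the kernel weights and their asymptotics. -/

/-- The speed `a_n / v_n²`. -/
noncomputable def speed {d : ℕ} (α : Fin d → ℕ) (h v : ℕ → ℝ) (n : ℕ) : ℝ :=
  bandSum α h n / v n ^ 2

/-- The coefficient of the `i`-th kernel term in `(a_n / v_n) ∂^α f_n`. -/
noncomputable def kernelWeight {d : ℕ} (α : Fin d → ℕ) (h v : ℕ → ℝ) (n i : ℕ) : ℝ :=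
  bandSum α h n / (n * v n * h i ^ (d + multiLen α))

/-- The properties of bandwidth and scale on which the large deviations estimates rest. -/
structure IsAdmissibleArray {d : ℕ} (α : Fin d → ℕ) (h v : ℕ → ℝ) : Prop where
  h_pos : ∀ n, 1 ≤ n → 0 < h n
  v_pos : ∀ n, 1 ≤ n → 0 < v n
  h_tendsto : Tendsto h atTop (𝓝 0)
  speed_tendsto : Tendsto (speed α h v) atTop atTop
  weight_le : ∃ C, 0 ≤ C ∧ ∀ᶠ n in atTop, ∀ i, 1 ≤ i → i ≤ n → kernelWeight α h v n i ≤ C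
  sum_sq_le : ∃ C, 0 ≤ C ∧ ∀ᶠ n in atTop,
    ∑ i ∈ Finset.Icc 1 n, kernelWeight α h v n i ^ 2 * h i ^ d ≤ C * speed α h v n
  log_n : Tendsto (fun n : ℕ => Real.log n / speed α h v n) atTop (𝓝 0)
  log_v : Tendsto (fun n : ℕ => Real.log (v n) / speed α h v n) atTop (𝓝 0)
  inv_le_pow : ∃ C : ℝ, ∃ A : ℕ, 1 ≤ C ∧ ∀ n : ℕ, 1 ≤ n → (h n)⁻¹ ≤ C * (n : ℝ) ^ A

section

variable {d : ℕ} {α : Fin d → ℕ} {h v : ℕ → ℝ} {a : ℝ}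

theorem bandSum_pos (hpos : ∀ n, 1 ≤ n → 0 < h n) {n : ℕ} (hn : 1 ≤ n) : 0 < bandSum α h n :=
  Finset.sum_pos (fun i hi => pow_pos (hpos i (Finset.mem_Icc.1 hi).1) _) ⟨1, by simp [hn]⟩

theorem IsRegVarSeq.tendsto_bandSum_div (hh : IsRegVarSeq a h)
    (ha : a * (d + 2 * multiLen α : ℕ) < 1) :
    Tendsto (fun n : ℕ => bandSum α h n / (n * h n ^ (d + 2 * multiLen α))) atTop
      (𝓝 (1 / (1 - a * (d + 2 * multiLen α : ℕ)))) := by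
  refine (hh.tendsto_average_rpow_ratio ha).congr' ?_
  filter_upwards [eventually_ge_atTop 1] with n hn
  simp only [Real.rpow_natCast, div_pow, bandSum, ← Finset.sum_div]
  field_simp

/-- With `p = d + 2|α|` each term is a common factor times `(h_i/h_n)^{-p}`. Karamata's theorem with
the exponents `p` and `-p` gives `1/((1 - ap)(1 + ap))`, the variance constant of case (B). -/
theorem IsRegVarSeq.tendsto_sum_sq (hh : IsRegVarSeq a h) (hv : ∀ n, 1 ≤ n → 0 < v n) (ha0 : 0 < a)
    (ha : a * (d + 2 * multiLen α : ℕ) < 1) :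
    Tendsto (fun n : ℕ => (∑ i ∈ Finset.Icc 1 n, kernelWeight α h v n i ^ 2 * h i ^ d) /
      speed α h v n) atTop
      (𝓝 (1 / (1 - a ^ 2 * ((d + 2 * multiLen α : ℕ) : ℝ) ^ 2))) := by
  set p := d + 2 * multiLen α with hp
  have hap : 0 ≤ a * p := by positivity
  have h1 := (hh.tendsto_bandSum_div ha).mul (hh.tendsto_average_rpow_ratio (q := -p) (by linarith))
  rw [show 1 / (1 - a * (p : ℝ)) * (1 / (1 - a * -(p : ℝ))) = 1 / (1 - a ^ 2 * (p : ℝ) ^ 2) by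
    rw [div_mul_div_comm]; congr 1 <;> ring] at h1
  refine h1.congr' ?_
  filter_upwards [eventually_ge_atTop 1] with n hn
  have hn0 : (0 : ℝ) < n := by exact_mod_cast hn
  have hb := bandSum_pos (α := α) hh.pos hn
  have hvn := hv n hn
  have hhn := hh.pos n hn
  have e : ∀ i ∈ Finset.Icc 1 n, kernelWeight α h v n i ^ 2 * h i ^ d =
      bandSum α h n ^ 2 / (n ^ 2 * v n ^ 2 * h n ^ p) * (h i / h n) ^ (-(p : ℝ)) := by
    intro i hi
    have hhi := hh.pos i (Finset.mem_Icc.1 hi).1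
    rw [Real.rpow_neg (by positivity), Real.rpow_natCast, kernelWeight]
    have : h i ^ p = h i ^ d * h i ^ multiLen α * h i ^ multiLen α := by
      rw [hp, ← pow_add, ← pow_add]; congr 1; ring
    rw [div_pow (h i), this, div_pow, mul_pow, mul_pow, pow_add]
    field_simp
  rw [Finset.sum_congr rfl e, ← Finset.mul_sum, speed, ← hp]
  field_simp

/-- The first factor converges and the second is a power ratio. The last one, `h_n^{|α|}/v_n`,
separates the two regimes: it is `1` in case (A) and tends to `0` in case (B). -/
theorem IsRegVarSeq.kernelWeight_eq (hh : IsRegVarSeq a h) (hv : ∀ n, 1 ≤ n → 0 < v n) {n i : ℕ}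
    (hi : 1 ≤ i) (hn : 1 ≤ n) :
    kernelWeight α h v n i = bandSum α h n / (n * h n ^ (d + 2 * multiLen α)) *
      (h i / h n) ^ (-((d + multiLen α : ℕ) : ℝ)) * (h n ^ multiLen α / v n) := by
  have hn0 : (0 : ℝ) < n := by exact_mod_cast hn
  have hvn := hv n hn
  have hhn := hh.pos n hn
  have hhi := hh.pos i hi
  rw [Real.rpow_neg (by positivity), Real.rpow_natCast, kernelWeight, div_pow, two_mul, ← add_assoc,
    pow_add (h n) (d + multiLen α)]
  field_simp

/-- For `i ≤ n` the power ratio behaves like `(i/n)^{a(d+|α|)}`. The Potter loss is chosen equal to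
this exponent, so the power of `n/i` disappears and a uniform bound is left. -/
theorem IsRegVarSeq.kernelWeight_le (hh : IsRegVarSeq a h) (hv : ∀ n, 1 ≤ n → 0 < v n) (ha0 : 0 < a)
    (ha : a * (d + 2 * multiLen α : ℕ) < 1) (hd : 1 ≤ d) :
    ∃ C, 0 ≤ C ∧ ∀ᶠ n in atTop, ∀ i, 1 ≤ i → i ≤ n →
      kernelWeight α h v n i ≤ C * (h n ^ multiLen α / v n) := by
  have hd0 : (0 : ℝ) < (d + multiLen α : ℕ) := by exact_mod_cast (by omega : 0 < d + multiLen α)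
  obtain ⟨C, hC, hb⟩ := hh.rpow_ratio_le (-((d + multiLen α : ℕ) : ℝ))
    (ε := a * (d + multiLen α : ℕ)) (by positivity)
  have hR := hh.tendsto_bandSum_div ha
  set R := 1 / (1 - a * (d + 2 * multiLen α : ℕ)) with hRdef
  have hR0 : 0 < R := one_div_pos.2 (by linarith)
  refine ⟨(R + 1) * C, by positivity, ?_⟩
  filter_upwards [hR.eventually (gt_mem_nhds (lt_add_one R)), eventually_ge_atTop 1] with n h1 hn i hi hin
  rw [hh.kernelWeight_eq hv hi hn]
  have hvn := hv n hn
  have hhn := hh.pos n hn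
  have hhi := hh.pos i hi
  refine mul_le_mul_of_nonneg_right ?_ (by positivity)
  refine mul_le_mul h1.le ?_ (by positivity) (by positivity)
  have := hb i n hi hin
  rwa [mul_neg, neg_add_cancel, Real.rpow_zero, mul_one] at this

theorem IsRegVarSeq.isAdmissibleArray (hh : IsRegVarSeq a h) (hv : ∀ n, 1 ≤ n → 0 < v n)
    (ha0 : 0 < a) (ha : a * (d + 2 * multiLen α : ℕ) < 1) (hd : 1 ≤ d)
    (hscale : IsUnitSeq v ∨ IsModerateScale α h v) (hlog : ScaleLogCondition α h v) :
    IsAdmissibleArray α h v := by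
  have hh0 := hh.tendsto_zero ha0
  have hband : Tendsto (bandSum α h) atTop atTop := by
    have h1 := (hh.tendsto_bandSum_div ha)
    have h2 := hh.tendsto_mul_pow_atTop ha
    refine (h1.pos_mul_atTop (one_div_pos.2 (by linarith)) h2).congr' ?_
    filter_upwards [eventually_ge_atTop 1] with n hn
    have hn0 : (0 : ℝ) < n := by exact_mod_cast hn
    have := hh.pos n hn
    field_simp
  have hspeed : Tendsto (speed α h v) atTop atTop := by
    rcases hscale with h1 | h1
    · refine hband.congr' ?_
      filter_upwards [eventually_ge_atTop 1] with n hn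
      simp [speed, h1 n hn]
    · have h3 : Tendsto (fun n => v n ^ 2 / bandSum α h n) atTop (𝓝[>] 0) := by
        refine tendsto_nhdsWithin_iff.2 ⟨h1.2, ?_⟩
        filter_upwards [eventually_ge_atTop 1] with n hn
        exact div_pos (pow_pos (hv n hn) 2) (bandSum_pos hh.pos hn)
      refine h3.inv_tendsto_nhdsGT_zero.congr fun n => ?_
      simp [speed]
  have hbd : ∃ B, 0 ≤ B ∧ ∀ᶠ n in atTop, h n ^ multiLen α / v n ≤ B := by
    refine ⟨1, zero_le_one, ?_⟩
    filter_upwards [hh0.eventually (gt_mem_nhds one_pos), eventually_ge_atTop 1,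
      (show ∀ᶠ n in atTop, 1 ≤ v n by
        rcases hscale with h1 | h1
        · filter_upwards [eventually_ge_atTop 1] with n hn using (h1 n hn).ge
        · exact h1.1.eventually_ge_atTop 1)] with n h1 hn h2
    rw [div_le_one (hv n hn)]
    exact (pow_le_one₀ (hh.pos n hn).le h1.le).trans h2
  refine ⟨hh.pos, hv, hh0, hspeed, ?_, ?_, ?_, ?_, hh.inv_le_pow⟩
  · obtain ⟨C, hC, h1⟩ := hh.kernelWeight_le (α := α) hv ha0 ha hd
    obtain ⟨B, hB, h2⟩ := hbd
    refine ⟨C * B, by positivity, ?_⟩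
    filter_upwards [h1, h2] with n h1 h2 i hi hin
    exact (h1 i hi hin).trans (mul_le_mul_of_nonneg_left h2 hC)
  · have h1 := hh.tendsto_sum_sq (α := α) hv ha0 ha
    set R := 1 / (1 - a ^ 2 * ((d + 2 * multiLen α : ℕ) : ℝ) ^ 2) with hR
    have hR0 : 0 ≤ R := by
      rw [hR, ← mul_pow]
      have : 0 ≤ a * (d + 2 * multiLen α : ℕ) := by positivity
      exact one_div_nonneg.2 (by nlinarith)
    refine ⟨R + 1, by positivity, ?_⟩
    filter_upwards [h1.eventually (gt_mem_nhds (lt_add_one R)), hspeed.eventually_gt_atTop 0]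
      with n h2 h3
    rw [div_lt_iff₀ h3] at h2
    exact h2.le
  -- Half of `a log n` survives the slowly varying error, whence `log n ≤ (2/a) (log (1/h_n) + C)`.
  -- The hypothesis on `log (1/h_n)` thus controls `log n`.
  · obtain ⟨C, hC, hb⟩ := hh.log_bound (ε := a / 2) (by positivity)
    have h1 : Tendsto (fun n => (2 / a) * (v n ^ 2 * Real.log (1 / h n) / bandSum α h n) +
        (2 / a * C) * (speed α h v n)⁻¹) atTop (𝓝 0) := by
      have := (hlog.1.const_mul (2 / a)).add (hspeed.inv_tendsto_atTop.const_mul (2 / a * C))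
      simpa using this
    refine squeeze_zero' ?_ ?_ h1
    · filter_upwards [eventually_ge_atTop 1, hspeed.eventually_gt_atTop 0] with n hn h3
      exact div_nonneg (Real.log_nonneg (by exact_mod_cast hn)) h3.le
    · filter_upwards [eventually_ge_atTop 1, hspeed.eventually_gt_atTop 0] with n hn h3
      have hvn := hv n hn
      have hbn := bandSum_pos (α := α) hh.pos hn
      have h4 := (abs_le.1 (hb n hn)).2
      have e : (2 / a) * (v n ^ 2 * Real.log (1 / h n) / bandSum α h n) +
        (2 / a * C) * (speed α h v n)⁻¹ = (2 / a * (Real.log (1 / h n) + C)) / speed α h v n := by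
        rw [speed]; field_simp
      rw [e]
      refine div_le_div_of_nonneg_right ?_ h3.le
      rw [one_div, Real.log_inv]
      have : Real.log n = 2 / a * (a / 2 * Real.log n) := by field_simp
      rw [this]
      refine mul_le_mul_of_nonneg_left (by linarith) (by positivity)
  · refine hlog.2.congr fun n => ?_
    rw [speed, div_div_eq_mul_div]; ring

theorem IsAdmissibleArray.speed_pos (H : IsAdmissibleArray α h v) {n : ℕ} (hn : 1 ≤ n) :
    0 < speed α h v n :=
  div_pos (bandSum_pos H.h_pos hn) (pow_pos (H.v_pos n hn) 2)

theorem IsAdmissibleArray.kernelWeight_pos (H : IsAdmissibleArray α h v) {n i : ℕ} (hi : 1 ≤ i)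
    (hn : 1 ≤ n) : 0 < kernelWeight α h v n i := by
  have hn0 : (0 : ℝ) < n := by exact_mod_cast hn
  exact div_pos (bandSum_pos H.h_pos hn)
    (mul_pos (mul_pos hn0 (H.v_pos n hn)) (pow_pos (H.h_pos i hi) _))

/-- Weighted averages of a null sequence tend to zero. -/
theorem tendsto_weighted_sum_zero {w : ℕ → ℕ → ℝ} {e : ℕ → ℝ} {M : ℝ} (hM : 0 ≤ M)
    (hw0 : ∀ᶠ n in atTop, ∀ i, 1 ≤ i → i ≤ n → 0 ≤ w n i)
    (hwM : ∀ᶠ n in atTop, ∑ i ∈ Finset.Icc 1 n, w n i ≤ M)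
    (hwi : ∀ i, 1 ≤ i → Tendsto (fun n => w n i) atTop (𝓝 0)) (he : Tendsto e atTop (𝓝 0)) :
    Tendsto (fun n => ∑ i ∈ Finset.Icc 1 n, w n i * e i) atTop (𝓝 0) := by
  rw [Metric.tendsto_atTop]
  intro ε hε
  have hη : 0 < ε / (2 * (M + 1)) := by positivity
  obtain ⟨N, hN⟩ := (Metric.tendsto_atTop.1 he) _ hη
  have hfin : Tendsto (fun n => ∑ i ∈ Finset.Icc 1 N, w n i * |e i|) atTop (𝓝 0) := by
    have : Tendsto (fun n => ∑ i ∈ Finset.Icc 1 N, w n i * |e i|) atTop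
        (𝓝 (∑ i ∈ Finset.Icc 1 N, 0 * |e i|)) :=
      tendsto_finsetSum _ fun i hi => (hwi i (Finset.mem_Icc.1 hi).1).mul_const _
    simpa using this
  obtain ⟨N', hN'⟩ := (((hfin.eventually (gt_mem_nhds (half_pos hε))).and (hw0.and hwM)).and
    (eventually_ge_atTop N)).exists_forall_of_atTop
  refine ⟨N', fun n hn => ?_⟩
  obtain ⟨⟨h1, h2, h3⟩, h4⟩ := hN' n hn
  rw [dist_zero_right, Real.norm_eq_abs]
  have hterm : ∀ i ∈ Finset.Icc 1 n, |w n i * e i| ≤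
      (if i ≤ N then w n i * |e i| else 0) + w n i * (ε / (2 * (M + 1))) := by
    intro i hi
    obtain ⟨hi1, hin⟩ := Finset.mem_Icc.1 hi
    have hwn := h2 i hi1 hin
    rw [abs_mul, abs_of_nonneg hwn]
    split_ifs with hiN
    · have : 0 ≤ w n i * (ε / (2 * (M + 1))) := by positivity
      linarith
    · have := hN i (by omega)
      rw [dist_zero_right, Real.norm_eq_abs] at this
      rw [zero_add]
      exact mul_le_mul_of_nonneg_left this.le hwn
  calc _ ≤ ∑ i ∈ Finset.Icc 1 n, |w n i * e i| := Finset.abs_sum_le_sum_abs _ _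
    _ ≤ _ := Finset.sum_le_sum hterm
    _ = ∑ i ∈ Finset.Icc 1 N, w n i * |e i| + (∑ i ∈ Finset.Icc 1 n, w n i) * (ε / (2 * (M + 1))) := by
        rw [Finset.sum_add_distrib, ← Finset.sum_mul, ← Finset.sum_filter]
        congr 2
        ext i; simp only [Finset.mem_filter, Finset.mem_Icc]; omega
    _ ≤ ∑ i ∈ Finset.Icc 1 N, w n i * |e i| + M * (ε / (2 * (M + 1))) := by gcongr
    _ < ε / 2 + ε / 2 := by
        refine add_lt_add h1 ?_
        rw [mul_div_assoc', div_lt_div_iff₀ (by positivity) (by norm_num)]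
        nlinarith
    _ = ε := by ring

/-- After division by the speed the weights have bounded sums, and each of them vanishes in the
limit because the speed diverges. The local errors `e i` are small only for large `i`, so such a
Toeplitz argument is needed. -/
theorem IsAdmissibleArray.tendsto_weighted (H : IsAdmissibleArray α h v) {e : ℕ → ℝ}
    (he : Tendsto e atTop (𝓝 0)) :
    Tendsto (fun n => (∑ i ∈ Finset.Icc 1 n, kernelWeight α h v n i ^ 2 * h i ^ d * e i) /
      speed α h v n) atTop (𝓝 0) := by
  obtain ⟨C, hC, hb⟩ := H.sum_sq_le
  obtain ⟨B, hB, hw⟩ := H.weight_le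
  have hsp := H.speed_tendsto
  have := tendsto_weighted_sum_zero (w := fun n i => kernelWeight α h v n i ^ 2 * h i ^ d /
    speed α h v n) (e := e) hC ?_ ?_ ?_ he
  · refine this.congr fun n => ?_
    rw [Finset.sum_div]
    exact Finset.sum_congr rfl fun i _ => by ring
  · filter_upwards [eventually_ge_atTop 1] with n hn i hi hin
    have h1 := H.speed_pos hn
    have h2 := H.h_pos i hi
    positivity
  · filter_upwards [eventually_ge_atTop 1, hb] with n hn hb
    rw [← Finset.sum_div, div_le_iff₀ (H.speed_pos hn)]
    exact hb
  · intro i hi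
    have h2 := H.h_pos i hi
    have h1 : Tendsto (fun n => B ^ 2 * h i ^ d * (speed α h v n)⁻¹) atTop (𝓝 0) := by
      simpa using hsp.inv_tendsto_atTop.const_mul (B ^ 2 * h i ^ d)
    refine squeeze_zero' ?_ ?_ h1
    · filter_upwards [eventually_ge_atTop 1] with n hn
      have h1 := H.speed_pos hn
      positivity
    · filter_upwards [eventually_ge_atTop 1, hw, eventually_ge_atTop i] with n hn hw hin
      have h1 := H.speed_pos hn
      have h3 := hw i hi hin
      have h4 := H.kernelWeight_pos hi hn
      rw [← div_eq_mul_inv]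
      gcongr

end

/-! ## The compensated exponential and the limiting cumulant functions -/

/-- `e^t - 1 - t`. -/
noncomputable def expRem (t : ℝ) : ℝ := Real.exp t - 1 - t

theorem continuous_expRem : Continuous expRem := by unfold expRem; fun_prop

theorem expRem_zero : expRem 0 = 0 := by simp [expRem]

theorem expRem_nonneg (t : ℝ) : 0 ≤ expRem t := by
  unfold expRem; linarith [Real.add_one_le_exp t]

theorem abs_exp_sub_one_le_mul_exp (t : ℝ) : |Real.exp t - 1| ≤ |t| * Real.exp |t| := by
  rcases le_total 0 t with h | h
  · have h1 : 1 ≤ Real.exp t := Real.one_le_exp h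
    rw [abs_of_nonneg (by linarith), abs_of_nonneg h]
    have h2 := Real.add_one_le_exp (-t)
    have h3 : Real.exp (-t) * Real.exp t = 1 := by rw [← Real.exp_add]; simp
    nlinarith [Real.exp_pos t]
  · have h1 : Real.exp t ≤ 1 := Real.exp_le_one_iff.2 h
    rw [abs_of_nonpos (by linarith), abs_of_nonpos h]
    have h2 := Real.add_one_le_exp t
    have h3 : 1 ≤ Real.exp (-t) := Real.one_le_exp (by linarith)
    nlinarith

theorem expRem_le (t : ℝ) : expRem t ≤ t ^ 2 * Real.exp |t| := by
  have h1 : expRem t ≤ |t| * |Real.exp t - 1| := by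
    rw [← abs_mul]
    refine le_trans ?_ (le_abs_self _)
    have h2 := Real.add_one_le_exp (-t)
    have h3 : Real.exp (-t) * Real.exp t = 1 := by rw [← Real.exp_add]; simp
    unfold expRem
    nlinarith [Real.exp_pos t]
  refine h1.trans ?_
  rw [← sq_abs t, sq, mul_assoc]
  exact mul_le_mul_of_nonneg_left (abs_exp_sub_one_le_mul_exp t) (abs_nonneg t)

theorem abs_expRem_sub_sq_le {t : ℝ} (ht : |t| ≤ 1) : |expRem t - t ^ 2 / 2| ≤ |t| ^ 3 := by
  have h := Real.exp_bound ht (n := 3) (by norm_num)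
  simp only [Finset.sum_range_succ, Finset.sum_range_zero] at h
  norm_num [Nat.factorial] at h
  have e : expRem t - t ^ 2 / 2 = Real.exp t - (1 + t + t ^ 2 / 2) := by unfold expRem; ring
  rw [e]
  refine h.trans ?_
  have : 0 ≤ |t| ^ 3 := by positivity
  linarith

/-- The two sides differ by `2 (sinh t - t)`. For a nonnegative kernel this makes overestimation the
cheaper deviation. -/
theorem expRem_neg_le {t : ℝ} (ht : 0 ≤ t) : expRem (-t) ≤ expRem t := by
  have := Real.self_le_sinh_iff.2 ht
  rw [Real.sinh_eq] at this
  unfold expRem; linarith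

theorem hasDerivAt_expRem (t : ℝ) : HasDerivAt expRem (Real.exp t - 1) t := by
  have := ((Real.hasDerivAt_exp t).sub_const 1).sub (hasDerivAt_id t)
  exact this

/-! ### Cumulant integrals of a bounded integrable kernel. -/

/-- A measurable, bounded and integrable function, with an explicit bound. -/
structure IsBddIntegrable {E : Type*} [MeasureSpace E] (k : E → ℝ) (B : ℝ) : Prop where
  measurable : Measurable k
  integrable : Integrable k
  bound_nonneg : 0 ≤ B
  bound : ∀ z, |k z| ≤ B

namespace IsBddIntegrable

variable {E : Type*} [MeasureSpace E] {k : E → ℝ} {B : ℝ}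

theorem neg (H : IsBddIntegrable k B) : IsBddIntegrable (fun z => -k z) B :=
  ⟨H.measurable.neg, H.integrable.neg, H.bound_nonneg, fun z => by rw [abs_neg]; exact H.bound z⟩

theorem integrable_sq (H : IsBddIntegrable k B) : Integrable fun z => k z ^ 2 := by
  refine (H.integrable.norm.const_mul B).mono' (H.measurable.pow_const 2).aestronglyMeasurable
    (Eventually.of_forall fun z => ?_)
  rw [Real.norm_eq_abs, abs_pow, sq]
  exact mul_le_mul_of_nonneg_right (H.bound z) (abs_nonneg _)

theorem expRem_mul_le (H : IsBddIntegrable k B) (c : ℝ) (z : E) :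
    expRem (c * k z) ≤ c ^ 2 * Real.exp (|c| * B) * k z ^ 2 := by
  refine (expRem_le _).trans ?_
  have : Real.exp |c * k z| ≤ Real.exp (|c| * B) := by
    rw [abs_mul]; gcongr; exact H.bound z
  calc _ ≤ (c * k z) ^ 2 * Real.exp (|c| * B) := by gcongr
    _ = _ := by ring

theorem integrable_expRem (H : IsBddIntegrable k B) (c : ℝ) :
    Integrable fun z => expRem (c * k z) := by
  refine (H.integrable_sq.const_mul (c ^ 2 * Real.exp (|c| * B))).mono'
    (continuous_expRem.measurable.comp (H.measurable.const_mul c)).aestronglyMeasurable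
    (Eventually.of_forall fun z => ?_)
  rw [Real.norm_eq_abs, abs_of_nonneg (expRem_nonneg _)]
  exact H.expRem_mul_le c z

end IsBddIntegrable

/-- `∫ (e^{c k(z)} - 1 - c k(z)) dz`. -/
noncomputable def kerPhi {E : Type*} [MeasureSpace E] (k : E → ℝ) (c : ℝ) : ℝ :=
  ∫ z, expRem (c * k z)

namespace IsBddIntegrable

variable {E : Type*} [MeasureSpace E] {k : E → ℝ} {B : ℝ}

theorem kerPhi_nonneg (k : E → ℝ) (c : ℝ) : 0 ≤ kerPhi k c :=
  integral_nonneg fun _ => expRem_nonneg _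

theorem kerPhi_le (H : IsBddIntegrable k B) (c : ℝ) :
    kerPhi k c ≤ c ^ 2 * Real.exp (|c| * B) * ∫ z, k z ^ 2 := by
  rw [← integral_const_mul]
  exact integral_mono (H.integrable_expRem c) (H.integrable_sq.const_mul _) (H.expRem_mul_le c)

/-- The cubic remainder has the factor `|k|³ ≤ B k²`, so square integrability is enough. It serves
the regime in which the weights tend to zero. -/
theorem abs_kerPhi_sub_le (H : IsBddIntegrable k B) {c : ℝ} (hc : |c| * B ≤ 1) :
    |kerPhi k c - c ^ 2 / 2 * ∫ z, k z ^ 2| ≤ |c| ^ 3 * B * ∫ z, k z ^ 2 := by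
  rw [← integral_const_mul, ← integral_const_mul, kerPhi,
    ← integral_sub (H.integrable_expRem c) (H.integrable_sq.const_mul _)]
  refine (abs_integral_le_integral_abs).trans ?_
  refine integral_mono ((H.integrable_expRem c).sub (H.integrable_sq.const_mul _)).abs
    (H.integrable_sq.const_mul _) fun z => ?_
  have h1 : |c * k z| ≤ 1 := by
    rw [abs_mul]; exact (mul_le_mul_of_nonneg_left (H.bound z) (abs_nonneg c)).trans hc
  have h2 := abs_expRem_sub_sq_le h1
  have e : expRem (c * k z) - c ^ 2 / 2 * k z ^ 2 = expRem (c * k z) - (c * k z) ^ 2 / 2 := by ring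
  simp only [e]
  refine h2.trans ?_
  rw [abs_mul, mul_pow, mul_assoc]
  refine mul_le_mul_of_nonneg_left ?_ (by positivity)
  rw [pow_succ, sq_abs, mul_comm]
  exact mul_le_mul_of_nonneg_right (H.bound z) (sq_nonneg _)

theorem continuous_kerPhi (H : IsBddIntegrable k B) : Continuous (kerPhi k) := by
  rw [continuous_iff_continuousAt]
  intro c
  refine continuousAt_of_dominated
    (bound := fun z => (|c| + 1) ^ 2 * Real.exp ((|c| + 1) * B) * k z ^ 2) ?_ ?_ ?_ ?_
  · exact Eventually.of_forall fun x => (H.integrable_expRem x).aestronglyMeasurable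
  · filter_upwards [Metric.ball_mem_nhds c one_pos] with x hx
    refine Eventually.of_forall fun z => ?_
    rw [Real.norm_eq_abs, abs_of_nonneg (expRem_nonneg _)]
    refine (H.expRem_mul_le x z).trans ?_
    have : |x| ≤ |c| + 1 := by
      rw [Metric.mem_ball, Real.dist_eq] at hx
      have := abs_sub_abs_le_abs_sub x c
      linarith
    have hB := H.bound_nonneg
    rw [← sq_abs x]
    gcongr
  · exact H.integrable_sq.const_mul _
  · refine Eventually.of_forall fun z => ?_
    exact (continuous_expRem.comp (continuous_id.mul continuous_const)).continuousAt

end IsBddIntegrable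

/-! ### The quadratic and the jump cumulants. -/

/-- A cumulant-type function: continuously differentiable, nonnegative, vanishing to first order at
`0`, with derivative unbounded above on the right, and on the left either with derivative unbounded
below or dominated by its values on the right. -/
structure IsRateCumulant (Λ Λ' : ℝ → ℝ) : Prop where
  zero : Λ 0 = 0
  nonneg : ∀ u, 0 ≤ Λ u
  deriv : ∀ u, HasDerivAt Λ (Λ' u) u
  continuous : Continuous Λ'
  deriv_zero : Λ' 0 = 0
  unbounded : ∀ M, ∃ u, 0 < u ∧ M < Λ' u
  left : (∀ u, 0 ≤ u → Λ (-u) ≤ Λ u) ∨ ∀ M, ∃ u, 0 < u ∧ Λ' (-u) < -M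

theorem isRateCumulant_quadratic {σ : ℝ} (hσ : 0 < σ) :
    IsRateCumulant (fun u => u ^ 2 * σ / 2) (fun u => u * σ) where
  zero := by simp
  nonneg u := by positivity
  deriv u := by
    have := (((hasDerivAt_id u).pow 2).mul_const σ).div_const 2
    refine this.congr_deriv ?_
    simp; ring
  continuous := by fun_prop
  deriv_zero := by simp
  unbounded M := by
    refine ⟨(|M| + 1) / σ, by positivity, ?_⟩
    rw [div_mul_cancel₀ _ hσ.ne']
    linarith [le_abs_self M]
  left := Or.inl fun u _ => by simp

/-- `(1 - ρ)⁻¹ s^ρ`. -/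
noncomputable def jumpScale (ρ s : ℝ) : ℝ := s ^ ρ / (1 - ρ)

/-- `∫_0^1 ∫ (1 - ρ) s^{-ρ} (e^{t} - 1 - t) dz ds` at `t = u s^ρ K(z) / (1 - ρ)`. -/
noncomputable def jumpCumulant {E : Type*} [MeasureSpace E] (ρ : ℝ) (K : E → ℝ) (u : ℝ) : ℝ :=
  ∫ p, (jumpScale ρ p.1)⁻¹ * expRem (u * jumpScale ρ p.1 * K p.2)
    ∂((volume.restrict (Set.Ioc (0 : ℝ) 1)).prod (volume : Measure E))

/-- The derivative of `jumpCumulant`. -/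
noncomputable def jumpCumulantDeriv {E : Type*} [MeasureSpace E] (ρ : ℝ) (K : E → ℝ) (u : ℝ) : ℝ :=
  ∫ p, K p.2 * (Real.exp (u * jumpScale ρ p.1 * K p.2) - 1)
    ∂((volume.restrict (Set.Ioc (0 : ℝ) 1)).prod (volume : Measure E))

section jump

variable {E : Type*} [MeasureSpace E] {K : E → ℝ} {B ρ : ℝ}

theorem measurable_jumpScale (ρ : ℝ) : Measurable (jumpScale ρ) := by
  unfold jumpScale; fun_prop

theorem jumpScale_pos (hρ1 : ρ < 1) {s : ℝ} (hs : 0 < s) : 0 < jumpScale ρ s :=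
  div_pos (Real.rpow_pos_of_pos hs _) (by linarith)

theorem jumpScale_le (hρ : 0 ≤ ρ) (hρ1 : ρ < 1) {s : ℝ} (hs : 0 < s) (hs1 : s ≤ 1) :
    jumpScale ρ s ≤ 1 / (1 - ρ) :=
  div_le_div_of_nonneg_right (Real.rpow_le_one hs.le hs1 hρ) (by linarith)

theorem ae_prod_Ioc : ∀ᵐ p ∂((volume.restrict (Set.Ioc (0 : ℝ) 1)).prod (volume : Measure E)),
    p.1 ∈ Set.Ioc (0 : ℝ) 1 :=
  Measure.quasiMeasurePreserving_fst.ae (ae_restrict_mem measurableSet_Ioc)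

theorem IsBddIntegrable.integrable_prod_sq (H : IsBddIntegrable K B) (C : ℝ) :
    Integrable (fun p : ℝ × E => C * K p.2 ^ 2)
      ((volume.restrict (Set.Ioc (0 : ℝ) 1)).prod (volume : Measure E)) :=
  (integrable_const (μ := volume.restrict (Set.Ioc (0 : ℝ) 1)) C).mul_prod H.integrable_sq

/-- A dominating function uniform over `|u| ≤ R` and `s ∈ (0,1]`, for continuity and differentiation
under the integral sign. -/
theorem IsBddIntegrable.jump_bound (H : IsBddIntegrable K B) (hρ : 0 ≤ ρ) (hρ1 : ρ < 1) {u R : ℝ}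
    (hu : |u| ≤ R) {s : ℝ} (hs : s ∈ Set.Ioc (0 : ℝ) 1) (z : E) :
    |K z * (Real.exp (u * jumpScale ρ s * K z) - 1)| ≤
      R * (1 / (1 - ρ)) * Real.exp (R * (1 / (1 - ρ)) * B) * K z ^ 2 := by
  have h1 := jumpScale_pos hρ1 hs.1
  have h2 := jumpScale_le hρ hρ1 hs.1 hs.2
  have hR : 0 ≤ R := (abs_nonneg u).trans hu
  have h3 : |u * jumpScale ρ s * K z| ≤ R * (1 / (1 - ρ)) * |K z| := by
    rw [abs_mul, abs_mul, abs_of_pos h1]; gcongr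
  have h4 : R * (1 / (1 - ρ)) * |K z| ≤ R * (1 / (1 - ρ)) * B := by
    have := H.bound z
    have : 0 ≤ 1 / (1 - ρ) := h1.le.trans h2
    gcongr
  rw [abs_mul]
  calc _ ≤ |K z| * ((R * (1 / (1 - ρ)) * |K z|) * Real.exp (R * (1 / (1 - ρ)) * B)) := by
        gcongr
        refine (abs_exp_sub_one_le_mul_exp _).trans ?_
        have : 0 ≤ R * (1 / (1 - ρ)) * |K z| := (abs_nonneg _).trans h3
        gcongr
        exact h3.trans h4
    _ = _ := by rw [← sq_abs (K z)]; ring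

/-- The factor `(jumpScale ρ s)⁻¹` may be singular at `s = 0`; the quadratic vanishing of `expRem`
at `0` compensates it. -/
theorem IsBddIntegrable.jump_value_bound (H : IsBddIntegrable K B) (hρ : 0 ≤ ρ) (hρ1 : ρ < 1)
    (u : ℝ) {s : ℝ} (hs : s ∈ Set.Ioc (0 : ℝ) 1) (z : E) :
    (jumpScale ρ s)⁻¹ * expRem (u * jumpScale ρ s * K z) ≤
      u ^ 2 * (1 / (1 - ρ)) * Real.exp (|u| * (1 / (1 - ρ)) * B) * K z ^ 2 := by
  have h1 := jumpScale_pos hρ1 hs.1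
  have h2 := jumpScale_le hρ hρ1 hs.1 hs.2
  have hB := H.bound_nonneg
  have h3 := H.expRem_mul_le (u * jumpScale ρ s) z
  rw [abs_mul, abs_of_pos h1] at h3
  calc _ ≤ (jumpScale ρ s)⁻¹ * ((u * jumpScale ρ s) ^ 2 * Real.exp (|u| * jumpScale ρ s * B) * K z ^ 2) := by
        gcongr
    _ = u ^ 2 * jumpScale ρ s * Real.exp (|u| * jumpScale ρ s * B) * K z ^ 2 := by
        field_simp
    _ ≤ _ := by gcongr

theorem IsBddIntegrable.measurable_jump (H : IsBddIntegrable K B) (u : ℝ) :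
    Measurable fun p : ℝ × E => (jumpScale ρ p.1)⁻¹ * expRem (u * jumpScale ρ p.1 * K p.2) := by
  have h1 : Measurable fun p : ℝ × E => jumpScale ρ p.1 := (measurable_jumpScale ρ).comp measurable_fst
  have h2 : Measurable fun p : ℝ × E => K p.2 := H.measurable.comp measurable_snd
  exact h1.inv.mul (continuous_expRem.measurable.comp ((h1.const_mul u).mul h2))

theorem IsBddIntegrable.measurable_jumpDeriv (H : IsBddIntegrable K B) (u : ℝ) :
    Measurable fun p : ℝ × E => K p.2 * (Real.exp (u * jumpScale ρ p.1 * K p.2) - 1) := by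
  have h1 : Measurable fun p : ℝ × E => jumpScale ρ p.1 := (measurable_jumpScale ρ).comp measurable_fst
  have h2 : Measurable fun p : ℝ × E => K p.2 := H.measurable.comp measurable_snd
  exact h2.mul (((h1.const_mul u).mul h2).exp.sub_const 1)

theorem IsBddIntegrable.integrable_jump (H : IsBddIntegrable K B) (hρ : 0 ≤ ρ) (hρ1 : ρ < 1)
    (u : ℝ) : Integrable (fun p : ℝ × E =>
      (jumpScale ρ p.1)⁻¹ * expRem (u * jumpScale ρ p.1 * K p.2))
      ((volume.restrict (Set.Ioc (0 : ℝ) 1)).prod (volume : Measure E)) := by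
  refine (H.integrable_prod_sq (u ^ 2 * (1 / (1 - ρ)) * Real.exp (|u| * (1 / (1 - ρ)) * B))).mono'
    (H.measurable_jump u).aestronglyMeasurable ?_
  filter_upwards [ae_prod_Ioc] with p hp
  have h1 := jumpScale_pos hρ1 hp.1
  rw [Real.norm_eq_abs, abs_of_nonneg (mul_nonneg (inv_nonneg.2 h1.le) (expRem_nonneg _))]
  exact H.jump_value_bound hρ hρ1 u hp p.2

theorem IsBddIntegrable.integrable_jumpDeriv (H : IsBddIntegrable K B) (hρ : 0 ≤ ρ) (hρ1 : ρ < 1)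
    (u : ℝ) : Integrable (fun p : ℝ × E =>
      K p.2 * (Real.exp (u * jumpScale ρ p.1 * K p.2) - 1))
      ((volume.restrict (Set.Ioc (0 : ℝ) 1)).prod (volume : Measure E)) := by
  refine (H.integrable_prod_sq (|u| * (1 / (1 - ρ)) * Real.exp (|u| * (1 / (1 - ρ)) * B))).mono'
    (H.measurable_jumpDeriv u).aestronglyMeasurable ?_
  filter_upwards [ae_prod_Ioc] with p hp
  exact H.jump_bound hρ hρ1 le_rfl hp p.2

theorem jumpCumulant_nonneg (hρ1 : ρ < 1) (u : ℝ) : 0 ≤ jumpCumulant ρ K u := by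
  refine integral_nonneg_of_ae ?_
  filter_upwards [ae_prod_Ioc] with p hp
  exact mul_nonneg (inv_nonneg.2 (jumpScale_pos hρ1 hp.1).le) (expRem_nonneg _)

theorem jumpCumulantDeriv_neg (u : ℝ) :
    jumpCumulantDeriv ρ (fun z => -K z) u = -jumpCumulantDeriv ρ K (-u) := by
  unfold jumpCumulantDeriv; rw [← integral_neg]; simp

theorem hasDerivAt_jumpCumulant (H : IsBddIntegrable K B) (hρ : 0 ≤ ρ) (hρ1 : ρ < 1) (u : ℝ) :
    HasDerivAt (jumpCumulant ρ K) (jumpCumulantDeriv ρ K u) u := by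
  refine (hasDerivAt_integral_of_dominated_loc_of_deriv_le (Metric.ball_mem_nhds u one_pos)
    (F := fun u (p : ℝ × E) => (jumpScale ρ p.1)⁻¹ * expRem (u * jumpScale ρ p.1 * K p.2))
    (F' := fun u (p : ℝ × E) => K p.2 * (Real.exp (u * jumpScale ρ p.1 * K p.2) - 1))
    (Eventually.of_forall fun u => (H.measurable_jump u).aestronglyMeasurable)
    (H.integrable_jump hρ hρ1 u) (H.measurable_jumpDeriv u).aestronglyMeasurable ?_
    (H.integrable_prod_sq ((|u| + 1) * (1 / (1 - ρ)) * Real.exp ((|u| + 1) * (1 / (1 - ρ)) * B)))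
    ?_).2
  · filter_upwards [ae_prod_Ioc] with p hp x hx
    refine H.jump_bound hρ hρ1 ?_ hp p.2
    rw [Metric.mem_ball, Real.dist_eq] at hx
    have := abs_sub_abs_le_abs_sub x u
    linarith
  · filter_upwards [ae_prod_Ioc] with p hp x hx
    have h1 := jumpScale_pos hρ1 hp.1
    have h2 : HasDerivAt (fun x => x * jumpScale ρ p.1 * K p.2) (jumpScale ρ p.1 * K p.2) x := by
      simpa using ((hasDerivAt_id x).mul_const (jumpScale ρ p.1)).mul_const (K p.2)
    refine (((hasDerivAt_expRem _).comp x h2).const_mul _).congr_deriv ?_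
    field_simp

theorem continuous_jumpCumulantDeriv (H : IsBddIntegrable K B) (hρ : 0 ≤ ρ) (hρ1 : ρ < 1) :
    Continuous (jumpCumulantDeriv ρ K) := by
  rw [continuous_iff_continuousAt]
  intro u
  refine continuousAt_of_dominated
    (Eventually.of_forall fun u => (H.measurable_jumpDeriv u).aestronglyMeasurable) ?_
    (H.integrable_prod_sq ((|u| + 1) * (1 / (1 - ρ)) * Real.exp ((|u| + 1) * (1 / (1 - ρ)) * B))) ?_
  · filter_upwards [Metric.ball_mem_nhds u one_pos] with x hx
    filter_upwards [ae_prod_Ioc] with p hp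
    refine H.jump_bound hρ hρ1 ?_ hp p.2
    rw [Metric.mem_ball, Real.dist_eq] at hx
    have := abs_sub_abs_le_abs_sub x u
    linarith
  · refine Eventually.of_forall fun p => ?_
    fun_prop

variable [SigmaFinite (volume : Measure E)]

theorem jumpCumulant_eq (H : IsBddIntegrable K B) (hρ : 0 ≤ ρ) (hρ1 : ρ < 1) (u : ℝ) :
    jumpCumulant ρ K u =
      ∫ s in Set.Ioc (0 : ℝ) 1, (jumpScale ρ s)⁻¹ * kerPhi K (u * jumpScale ρ s) := by
  rw [jumpCumulant, integral_prod _ (H.integrable_jump hρ hρ1 u)]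
  refine integral_congr_ae (Eventually.of_forall fun s => ?_)
  simp only [kerPhi, integral_const_mul]

/-- The derivative of the jump cumulant is unbounded above if `K` charges the positive numbers. -/
theorem jumpCumulantDeriv_unbounded (H : IsBddIntegrable K B) (hρ : 0 ≤ ρ) (hρ1 : ρ < 1)
    (hK : ¬ ∀ᵐ z, K z ≤ 0) (M : ℝ) : ∃ u, 0 < u ∧ M < jumpCumulantDeriv ρ K u := by
  have Hm : Integrable fun z => (max (K z) 0) ^ 2 := by
    refine H.integrable_sq.mono' ((H.measurable.max measurable_const).pow_const 2).aestronglyMeasurable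
      (Eventually.of_forall fun z => ?_)
    rw [Real.norm_eq_abs, abs_of_nonneg (sq_nonneg _)]
    rcases max_cases (K z) 0 with h | h
    · rw [h.1]
    · rw [h.1]; simpa using sq_nonneg (K z)
  have hpos1 : 0 < ∫ z, (max (K z) 0) ^ 2 := by
    refine lt_of_le_of_ne (integral_nonneg fun z => sq_nonneg _) fun h0 => hK ?_
    have := (integral_eq_zero_iff_of_nonneg (fun z => sq_nonneg _) Hm).1 h0.symm
    filter_upwards [this] with z hz
    have : max (K z) 0 = 0 := pow_eq_zero_iff (two_ne_zero) |>.1 hz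
    exact max_eq_right_iff.1 this
  have hint : IntegrableOn (jumpScale ρ) (Set.Ioc 0 1) := by
    refine Measure.integrableOn_of_bounded (M := 1 / (1 - ρ)) (by simp)
      (measurable_jumpScale ρ).aestronglyMeasurable ?_
    filter_upwards [ae_restrict_mem measurableSet_Ioc] with s hs
    rw [Real.norm_eq_abs, abs_of_pos (jumpScale_pos hρ1 hs.1)]
    exact jumpScale_le hρ hρ1 hs.1 hs.2
  have hpos2 : 0 < ∫ s in Set.Ioc (0 : ℝ) 1, jumpScale ρ s := by
    rw [setIntegral_pos_iff_support_of_nonneg_ae]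
    · have : Function.support (jumpScale ρ) ∩ Set.Ioc 0 1 = Set.Ioc 0 1 :=
        Set.inter_eq_right.2 fun s hs => (jumpScale_pos hρ1 hs.1).ne'
      rw [this]; simp
    · filter_upwards [ae_restrict_mem measurableSet_Ioc] with s hs
      exact (jumpScale_pos hρ1 hs.1).le
    · exact hint
  set κ := (∫ s in Set.Ioc (0 : ℝ) 1, jumpScale ρ s) * ∫ z, (max (K z) 0) ^ 2 with hκ
  have hκ0 : 0 < κ := mul_pos hpos2 hpos1
  refine ⟨(|M| + 1) / κ, by positivity, ?_⟩
  set u := (|M| + 1) / κ with hu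
  have hu0 : 0 < u := by positivity
  -- The bound `e^t - 1 ≥ t` is used where `K` is positive; elsewhere the integrand is nonnegative.
  -- The derivative therefore grows at least linearly, with slope `κ`.
  have hle : u * κ ≤ jumpCumulantDeriv ρ K u := by
    rw [hκ, ← integral_prod_mul, ← integral_const_mul]
    refine integral_mono_ae ((Integrable.mul_prod hint Hm).const_mul u)
      (H.integrable_jumpDeriv hρ hρ1 u) ?_
    filter_upwards [ae_prod_Ioc] with p hp
    have h1 := jumpScale_pos hρ1 hp.1
    rcases le_total (K p.2) 0 with h | h
    · rw [max_eq_right h]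
      have h2 : Real.exp (u * jumpScale ρ p.1 * K p.2) ≤ 1 :=
        Real.exp_le_one_iff.2 (mul_nonpos_of_nonneg_of_nonpos (by positivity) h)
      simp only [ne_eq, OfNat.ofNat_ne_zero, not_false_eq_true, zero_pow, mul_zero]
      exact mul_nonneg_of_nonpos_of_nonpos h (by linarith)
    · rw [max_eq_left h]
      have h2 := Real.add_one_le_exp (u * jumpScale ρ p.1 * K p.2)
      calc _ = K p.2 * (u * jumpScale ρ p.1 * K p.2) := by ring
        _ ≤ _ := mul_le_mul_of_nonneg_left (by linarith) h
  refine lt_of_lt_of_le ?_ hle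
  rw [hu, div_mul_cancel₀ _ hκ0.ne']
  linarith [le_abs_self M]

/-- Integral one prevents `K ≤ 0` almost everywhere, which settles the right side. On the left,
either `K ≥ 0` almost everywhere and `expRem_neg_le` compares the two sides, or `-K` charges the
positive numbers and the unboundedness result applies to it. -/
theorem isRateCumulant_jump (H : IsBddIntegrable K B) (hρ : 0 ≤ ρ) (hρ1 : ρ < 1)
    (hK : ∫ z, K z = 1) : IsRateCumulant (jumpCumulant ρ K) (jumpCumulantDeriv ρ K) where
  zero := by simp [jumpCumulant, expRem_zero]
  nonneg := jumpCumulant_nonneg hρ1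
  deriv := hasDerivAt_jumpCumulant H hρ hρ1
  continuous := continuous_jumpCumulantDeriv H hρ hρ1
  deriv_zero := by simp [jumpCumulantDeriv]
  unbounded := jumpCumulantDeriv_unbounded H hρ hρ1 fun h => by
    have := integral_nonpos_of_ae h
    linarith
  left := by
    by_cases h : ∀ᵐ z, -K z ≤ 0
    · left
      intro u hu
      refine integral_mono_ae (H.integrable_jump hρ hρ1 _) (H.integrable_jump hρ hρ1 _) ?_
      filter_upwards [ae_prod_Ioc, (Measure.quasiMeasurePreserving_snd (μ :=
        volume.restrict (Set.Ioc (0 : ℝ) 1))).ae h] with p hp hp2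
      have h1 := jumpScale_pos hρ1 hp.1
      refine mul_le_mul_of_nonneg_left ?_ (inv_nonneg.2 h1.le)
      rw [neg_mul, neg_mul]
      exact expRem_neg_le (mul_nonneg (by positivity) (by linarith))
    · right
      intro M
      obtain ⟨u, hu, hM⟩ := jumpCumulantDeriv_unbounded H.neg hρ hρ1 h M
      rw [jumpCumulantDeriv_neg] at hM
      exact ⟨u, hu, by linarith⟩

end jump

/-- Since `e^t - 1 = expRem t + t` and `∫ K = 1`, the linear part of `ψ` is `u/(1 - ad)`. Removing
it accounts for the shift by `1/(1 - ad)` in the argument of `I`. -/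
theorem psiFun_eq {d : ℕ} {K : Rd d → ℝ} {B a : ℝ} (H : IsBddIntegrable K B) (ha : 0 ≤ a * d)
    (ha1 : a * d < 1) (hK : ∫ z, K z = 1) (u : ℝ) :
    (1 - a * d) * psiFun a K u - u = jumpCumulant (a * d) K u := by
  set ρ := a * d with hρ
  have e1 : psiFun a K u = ∫ p, ((1 - ρ)⁻¹ * ((jumpScale ρ p.1)⁻¹ * expRem (u * jumpScale ρ p.1 * K p.2))
      + u / (1 - ρ) * K p.2)
      ∂((volume.restrict (Set.Ioc (0 : ℝ) 1)).prod (volume : Measure (Rd d))) := by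
    rw [psiFun, Measure.volume_eq_prod, ← Measure.prod_restrict, Measure.restrict_univ,
        Measure.restrict_congr_set Ioc_ae_eq_Icc.symm]
    refine integral_congr_ae ?_
    filter_upwards [ae_prod_Ioc] with p hp
    have hr : 0 < p.1 ^ ρ := Real.rpow_pos_of_pos hp.1 _
    have h1 : 0 < 1 - ρ := by linarith
    rw [Real.rpow_neg hp.1.le, ← hρ]
    simp only [jumpScale, expRem]
    rw [show p.1 ^ ρ * (u / (1 - ρ)) * K p.2 = u * (p.1 ^ ρ / (1 - ρ)) * K p.2 by ring]
    field_simp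
    ring
  have hi : Integrable (fun p : ℝ × Rd d => u / (1 - ρ) * K p.2)
      ((volume.restrict (Set.Ioc (0 : ℝ) 1)).prod volume) :=
    (integrable_const (μ := volume.restrict (Set.Ioc (0 : ℝ) 1)) (u / (1 - ρ))).mul_prod H.integrable
  have h1 : 0 < 1 - ρ := by linarith
  rw [e1, integral_add ((H.integrable_jump ha ha1 u).const_mul _) hi, integral_const_mul,
    integral_prod_mul (fun _ : ℝ => u / (1 - ρ)) K, hK, ← jumpCumulant]
  simp
  field_simp
  ring

/-! ## Convergence of the normalized cumulant sums -/

section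

variable {d : ℕ} {α : Fin d → ℕ} {h v : ℕ → ℝ} {a B : ℝ}

/-- Here `h_i^d` divided by the speed is `1/(n w_i)`, with `w_i` the kernel weight, so the sum is an
average of `w⁻¹ * kerPhi K (u * w)`. These terms are bounded, and the weight of index `⌈n s⌉` tends
to `jumpScale (a * d) s`. -/
theorem IsRegVarSeq.tendsto_sum_kerPhi_jump {K : Rd d → ℝ} (H : IsBddIntegrable K B)
    (hh : IsRegVarSeq a h) (hv : IsUnitSeq v) (hα : multiLen α = 0) (ha0 : 0 < a)
    (ha : a * d < 1) (hA : IsAdmissibleArray α h v) (u : ℝ) :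
    Tendsto (fun n => (∑ i ∈ Finset.Icc 1 n, h i ^ d * kerPhi K (u * kernelWeight α h v n i)) /
      speed α h v n) atTop (𝓝 (jumpCumulant (a * d) K u)) := by
  have hρ : 0 ≤ a * d := by positivity
  rw [jumpCumulant_eq H hρ ha]
  obtain ⟨C, hC, hb⟩ := hA.weight_le
  have key := tendsto_average_of_dominated
    (x := fun n i => (kernelWeight α h v n i)⁻¹ * kerPhi K (u * kernelWeight α h v n i))
    (φ := fun s => (jumpScale (a * d) s)⁻¹ * kerPhi K (u * jumpScale (a * d) s))
    (C := u ^ 2 * C * Real.exp (|u| * C * B) * ∫ z, K z ^ 2) (θ := 0) le_rfl one_pos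
    (mul_nonneg (by positivity) (integral_nonneg fun z => sq_nonneg _)) ?_ ?_
  · refine key.congr' ?_
    filter_upwards [eventually_ge_atTop 1] with n hn
    rw [Finset.mul_sum, Finset.sum_div]
    refine Finset.sum_congr rfl fun i hi => ?_
    have hi1 := (Finset.mem_Icc.1 hi).1
    have h1 := bandSum_pos (α := α) hh.pos hn
    have h2 := hh.pos i hi1
    have hn0 : (0 : ℝ) < n := by exact_mod_cast hn
    have e : (kernelWeight α h v n i)⁻¹ = n * h i ^ d / bandSum α h n := by
      simp [kernelWeight, hv n hn, hα]
    rw [e, speed, hv n hn]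
    field_simp
  · filter_upwards [hb, eventually_ge_atTop 1] with n hb hn i hi hin
    have h1 := hb i hi hin
    have h2 := hA.kernelWeight_pos hi hn
    rw [Real.rpow_zero, mul_one, abs_of_nonneg
      (mul_nonneg (inv_nonneg.2 h2.le) (IsBddIntegrable.kerPhi_nonneg _ _))]
    have h3 := H.kerPhi_le (u * kernelWeight α h v n i)
    have h4 : 0 ≤ ∫ z, K z ^ 2 := integral_nonneg fun z => sq_nonneg _
    have hB := H.bound_nonneg
    rw [abs_mul, abs_of_pos h2] at h3
    set w := kernelWeight α h v n i
    calc _ ≤ w⁻¹ * ((u * w) ^ 2 * Real.exp (|u| * w * B) * ∫ z, K z ^ 2) := by gcongr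
      _ = u ^ 2 * w * Real.exp (|u| * w * B) * ∫ z, K z ^ 2 := by field_simp
      _ ≤ _ := by gcongr
  · intro s hs hs1
    have h1 : Tendsto (fun n : ℕ => kernelWeight α h v n ⌈n * s⌉₊) atTop
        (𝓝 (jumpScale (a * d) s)) := by
      have h2 := (hh.tendsto_bandSum_div (α := α) (by simpa [hα] using ha)).mul
        (hh.tendsto_rpow_ratio (-((d + multiLen α : ℕ) : ℝ)) hs hs1)
      have e : 1 / (1 - a * ((d + 2 * multiLen α : ℕ) : ℝ)) *
          s ^ (-(a * -((d + multiLen α : ℕ) : ℝ))) = jumpScale (a * d) s := by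
        simp [hα, jumpScale]; ring
      rw [e] at h2
      refine h2.congr' ?_
      filter_upwards [eventually_ge_atTop 1] with n hn
      have hn0 : (0 : ℝ) < n := by exact_mod_cast hn
      rw [hh.kernelWeight_eq hA.v_pos (Nat.ceil_pos.2 (mul_pos hn0 hs)) hn, hv n hn, hα]
      simp
    refine (h1.inv₀ (jumpScale_pos ha hs).ne').mul ?_
    exact (H.continuous_kerPhi.tendsto _).comp (h1.const_mul u)

/-- The weights vanish uniformly, because `h_n^{|α|}/v_n` tends to `0`. The cubic error is thus a
vanishing factor times the sum of `w² h^d`, negligible against the speed, and the quadratic part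
converges by `tendsto_sum_sq`. -/
theorem IsRegVarSeq.tendsto_sum_kerPhi_quadratic {k : Rd d → ℝ} (H : IsBddIntegrable k B)
    (hh : IsRegVarSeq a h) (ha0 : 0 < a) (ha : a * (d + 2 * multiLen α : ℕ) < 1) (hd : 1 ≤ d)
    (hscale : (1 ≤ multiLen α ∧ IsUnitSeq v) ∨ IsModerateScale α h v)
    (hA : IsAdmissibleArray α h v) (u : ℝ) :
    Tendsto (fun n => (∑ i ∈ Finset.Icc 1 n, h i ^ d * kerPhi k (u * kernelWeight α h v n i)) /
      speed α h v n) atTop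
      (𝓝 (u ^ 2 * ((∫ z, k z ^ 2) / (1 - a ^ 2 * ((d + 2 * multiLen α : ℕ) : ℝ) ^ 2)) / 2)) := by
  set J := ∫ z, k z ^ 2 with hJ
  have hJ0 : 0 ≤ J := integral_nonneg fun z => sq_nonneg _
  have hB := H.bound_nonneg
  have hsmall : Tendsto (fun n => h n ^ multiLen α / v n) atTop (𝓝 0) := by
    rcases hscale with ⟨h1, h2⟩ | h1
    · have h3 := (hA.h_tendsto.pow (multiLen α))
      rw [zero_pow (by omega)] at h3
      refine h3.congr' ?_
      filter_upwards [eventually_ge_atTop 1] with n hn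
      simp [h2 n hn]
    · refine squeeze_zero' ?_ ?_ h1.1.inv_tendsto_atTop
      · filter_upwards [eventually_ge_atTop 1] with n hn
        exact div_nonneg (pow_nonneg (hA.h_pos n hn).le _) (hA.v_pos n hn).le
      · filter_upwards [eventually_ge_atTop 1, hA.h_tendsto.eventually (gt_mem_nhds one_pos)]
          with n hn h2
        rw [div_eq_mul_inv]
        exact mul_le_of_le_one_left (inv_nonneg.2 (hA.v_pos n hn).le)
          (pow_le_one₀ (hA.h_pos n hn).le h2.le)
  obtain ⟨C, hC, hw⟩ := hh.kernelWeight_le (α := α) hA.v_pos ha0 ha hd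
  obtain ⟨C2, hC2, hsq⟩ := hA.sum_sq_le
  have hmain := (hh.tendsto_sum_sq (α := α) hA.v_pos ha0 ha).const_mul (u ^ 2 / 2 * J)
  have herr : Tendsto (fun n => |u| ^ 3 * B * J * C2 * (C * (h n ^ multiLen α / v n))) atTop (𝓝 0) := by
    simpa using (hsmall.const_mul C).const_mul (|u| ^ 3 * B * J * C2)
  rw [show u ^ 2 * (J / (1 - a ^ 2 * ((d + 2 * multiLen α : ℕ) : ℝ) ^ 2)) / 2 = u ^ 2 / 2 * J *
    (1 / (1 - a ^ 2 * ((d + 2 * multiLen α : ℕ) : ℝ) ^ 2)) by ring]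
  refine hmain.congr_dist (squeeze_zero' (Eventually.of_forall fun _ => dist_nonneg) ?_ herr)
  have hsm2 : ∀ᶠ n in atTop, |u| * (C * (h n ^ multiLen α / v n)) * B ≤ 1 := by
    have h3 : Tendsto (fun n => |u| * (C * (h n ^ multiLen α / v n)) * B) atTop (𝓝 0) := by
      simpa using ((hsmall.const_mul C).const_mul |u|).mul_const B
    filter_upwards [h3.eventually (gt_mem_nhds one_pos)] with n hn using hn.le
  filter_upwards [hw, hsq, hsm2, eventually_ge_atTop 1] with n hw hsq hsm hn
  have hsp := hA.speed_pos hn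
  rw [dist_comm, Real.dist_eq, mul_div_assoc', ← sub_div, abs_div, abs_of_pos hsp, div_le_iff₀ hsp,
    Finset.mul_sum, ← Finset.sum_sub_distrib]
  refine (Finset.abs_sum_le_sum_abs _ _).trans ?_
  set η := C * (h n ^ multiLen α / v n) with hη
  have hη0 : 0 ≤ η := by
    have := hA.h_pos n hn
    have := hA.v_pos n hn
    positivity
  calc _ ≤ ∑ i ∈ Finset.Icc 1 n, |u| ^ 3 * B * J * η * (kernelWeight α h v n i ^ 2 * h i ^ d) := by
        refine Finset.sum_le_sum fun i hi => ?_
        obtain ⟨hi1, hin⟩ := Finset.mem_Icc.1 hi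
        have h1 := hw i hi1 hin
        have h2 := hA.kernelWeight_pos hi1 hn
        have h3 := hA.h_pos i hi1
        set w := kernelWeight α h v n i
        have h4 := H.abs_kerPhi_sub_le (c := u * w) (by
          rw [abs_mul, abs_of_pos h2]
          refine le_trans ?_ hsm
          gcongr)
        rw [show h i ^ d * kerPhi k (u * w) - u ^ 2 / 2 * J * (w ^ 2 * h i ^ d) =
          h i ^ d * (kerPhi k (u * w) - (u * w) ^ 2 / 2 * J) by ring, abs_mul,
          abs_of_nonneg (by positivity)]
        rw [abs_mul, abs_of_pos h2] at h4
        calc _ ≤ h i ^ d * ((|u| * w) ^ 3 * B * J) := by gcongr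
          _ = |u| ^ 3 * B * J * w * (w ^ 2 * h i ^ d) := by ring
          _ ≤ _ := by gcongr
    _ = |u| ^ 3 * B * J * η * ∑ i ∈ Finset.Icc 1 n, kernelWeight α h v n i ^ 2 * h i ^ d := by
        rw [Finset.mul_sum]
    _ ≤ |u| ^ 3 * B * J * η * (C2 * speed α h v n) := by gcongr
    _ = _ := by ring

end

/-! ## Iterated partial derivatives -/

/-- The partial derivatives in the directions listed in `l`, the head being applied last. -/
noncomputable def iterPartial {d : ℕ} (l : List (Fin d)) (g : Rd d → ℝ) : Rd d → ℝ :=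
  l.foldr partialD g

/-- The list of directions of `∂^α`. -/
def multiList {d : ℕ} (α : Fin d → ℕ) : List (Fin d) :=
  (List.finRange d).flatMap fun j => List.replicate (α j) j

section

variable {d : ℕ}

theorem iterPartial_cons (j : Fin d) (l : List (Fin d)) (g : Rd d → ℝ) :
    iterPartial (j :: l) g = partialD j (iterPartial l g) := rfl

theorem multiD_eq_iterPartial (α : Fin d → ℕ) (g : Rd d → ℝ) :
    multiD α g = iterPartial (multiList α) g := by
  rw [multiD, iterPartial, multiList, List.foldr_flatMap]
  congr 1
  funext j u
  induction α j with
  | zero => rfl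
  | succ n ih => rw [Function.iterate_succ_apply', ih, List.replicate_succ, List.foldr_cons]

theorem length_multiList (α : Fin d → ℕ) : (multiList α).length = multiLen α := by
  rw [multiList, List.length_flatMap, multiLen, ← List.sum_ofFn, List.ofFn_eq_map]
  simp only [List.length_replicate]

theorem multiD_of_multiLen_eq_zero {α : Fin d → ℕ} (hα : multiLen α = 0) (g : Rd d → ℝ) :
    multiD α g = g := by
  rw [multiD_eq_iterPartial, List.length_eq_zero_iff.1 ((length_multiList α).trans hα)]
  rfl

/-- Evaluation of a multilinear map at fixed vectors is continuous and linear, hence commutes with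
differentiation. This carries differentiability and norm bounds of Fréchet differentials over to
iterated partial derivatives. -/
theorem iterPartial_eq_iteratedFDeriv {m : ℕ} {g : Rd d → ℝ} (hg : TimesDifferentiable m g) :
    ∀ l : List (Fin d), l.length ≤ m → iterPartial l g = fun x =>
      iteratedFDeriv ℝ l.length g x fun i => EuclideanSpace.single (l.get i) 1
  | [], _ => by funext x; simp [iterPartial]
  | j :: l, hl => by
    have hl' : l.length < m := hl
    rw [iterPartial_cons, iterPartial_eq_iteratedFDeriv hg l hl'.le]
    funext x
    set A := ContinuousMultilinearMap.apply ℝ (fun _ : Fin l.length => Rd d) ℝ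
      (fun i => EuclideanSpace.single (l.get i) (1 : ℝ)) with hA
    have h1 := (A.hasFDerivAt (x := iteratedFDeriv ℝ l.length g x)).comp x (hg _ hl' x).hasFDerivAt
    have h2 := (h1.hasLineDerivAt (EuclideanSpace.single j (1 : ℝ))).lineDeriv
    refine Eq.trans h2 ?_
    simp only [List.length_cons, iteratedFDeriv_succ_apply_left]
    rfl

theorem TimesDifferentiable.differentiable_iterPartial {m : ℕ} {g : Rd d → ℝ}
    (hg : TimesDifferentiable m g) {l : List (Fin d)} (hl : l.length < m) :
    Differentiable ℝ (iterPartial l g) := by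
  rw [iterPartial_eq_iteratedFDeriv hg l hl.le]
  exact (ContinuousMultilinearMap.apply ℝ (fun _ : Fin l.length => Rd d) ℝ
    (fun i => EuclideanSpace.single (l.get i) (1 : ℝ))).differentiable.comp (hg _ hl)

theorem TimesDifferentiable.differentiable {m : ℕ} {g : Rd d → ℝ}
    (hg : TimesDifferentiable m g) (hm : 0 < m) : Differentiable ℝ g :=
  hg.differentiable_iterPartial (l := []) hm

theorem TimesDifferentiable.abs_iterPartial_le {m : ℕ} {g : Rd d → ℝ}
    (hg : TimesDifferentiable m g) {l : List (Fin d)} (hl : l.length ≤ m) (x : Rd d) :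
    |iterPartial l g x| ≤ ‖iteratedFDeriv ℝ l.length g x‖ := by
  rw [iterPartial_eq_iteratedFDeriv hg l hl, ← Real.norm_eq_abs]
  refine (ContinuousMultilinearMap.le_opNorm _ _).trans ?_
  simp

/-- All partial derivatives along the suffixes of `l` exist, are bounded and measurable. -/
structure IsBddIterDiff (l : List (Fin d)) (B : Rd d → ℝ) : Prop where
  diff : ∀ j l', (j :: l') <:+ l → ∀ x,
    LineDifferentiableAt ℝ (iterPartial l' B) x (EuclideanSpace.single j 1)
  bdd : ∀ l', l' <:+ l → ∃ M, ∀ x, |iterPartial l' B x| ≤ M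
  meas : ∀ l', l' <:+ l → Measurable (iterPartial l' B)

/-- Proper suffixes are controlled by the differentials of lower order. The whole list has its own
hypotheses, because the top differential need be neither bounded nor continuous. -/
theorem TimesDifferentiable.isBddIterDiff {l : List (Fin d)} {B : Rd d → ℝ}
    (hB : TimesDifferentiable l.length B)
    (hb : ∀ j < l.length, ∃ C, ∀ x, ‖iteratedFDeriv ℝ j B x‖ ≤ C)
    (hl : ∃ C, ∀ x, |iterPartial l B x| ≤ C) (hm : Measurable (iterPartial l B)) :
    IsBddIterDiff l B where
  diff j l' h x := (hB.differentiable_iterPartial (l := l') h.length_le x).lineDifferentiableAt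
  bdd l' h := by
    rcases h.length_le.lt_or_eq with h1 | h1
    · obtain ⟨C, hC⟩ := hb _ h1
      exact ⟨C, fun x => (hB.abs_iterPartial_le h1.le x).trans (hC x)⟩
    · rw [h.eq_of_length h1]; exact hl
  meas l' h := by
    rcases h.length_le.lt_or_eq with h1 | h1
    · exact (hB.differentiable_iterPartial h1).continuous.measurable
    · rw [h.eq_of_length h1]; exact hm

theorem IsBddIterDiff.of_cons {j : Fin d} {l : List (Fin d)} {B : Rd d → ℝ}
    (H : IsBddIterDiff (j :: l) B) : IsBddIterDiff l B :=
  ⟨fun i l' h => H.diff i l' (h.trans (List.suffix_cons j l)),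
    fun l' h => H.bdd l' (h.trans (List.suffix_cons j l)),
    fun l' h => H.meas l' (h.trans (List.suffix_cons j l))⟩

theorem hasDerivAt_line {B : Rd d → ℝ} {e : Rd d} (hB : ∀ x, LineDifferentiableAt ℝ B x e)
    (c : ℝ) (x θ : Rd d) (t : ℝ) :
    HasDerivAt (fun t : ℝ => B (c • (x + t • e) - θ)) (c * lineDeriv ℝ B (c • (x + t • e) - θ) e) t := by
  have h1 : HasDerivAt (fun s : ℝ => B (c • (x + t • e) - θ + s • e))
      (lineDeriv ℝ B (c • (x + t • e) - θ) e) 0 := (hB _).hasLineDerivAt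
  have h2 : HasDerivAt (fun s : ℝ => c * (s - t)) c t := by
    simpa using ((hasDerivAt_id t).sub_const t).const_mul c
  have h3 : HasDerivAt (fun s : ℝ => B (c • (x + t • e) - θ + s • e))
      (lineDeriv ℝ B (c • (x + t • e) - θ) e) (c * (t - t)) := by simpa using h1
  refine ((h3.comp t h2).congr_deriv (mul_comm _ _)).congr_of_eventuallyEq
    (Eventually.of_forall fun s => ?_)
  simp only [Function.comp_apply]
  congr 1
  module

/-- Differentiation under the integral along a line, dominated by a multiple of `‖k‖`; continuity of
the derivative is not needed. -/
theorem partialD_integral {E : Type*} [MeasurableSpace E] {μ : Measure E} {k : E → ℝ}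
    (hk : Integrable k μ) {θ : E → Rd d} (hθ : Measurable θ) (c : ℝ) {B : Rd d → ℝ} {j : Fin d}
    (hdiff : ∀ x, LineDifferentiableAt ℝ B x (EuclideanSpace.single j 1))
    (hb : ∃ M, ∀ x, |B x| ≤ M) (hb' : ∃ M, ∀ x, |partialD j B x| ≤ M) (hm : Measurable B)
    (hm' : Measurable (partialD j B)) :
    partialD j (fun x => ∫ y, k y * B (c • x - θ y) ∂μ) =
      fun x => c * ∫ y, k y * partialD j B (c • x - θ y) ∂μ := by
  funext x
  obtain ⟨M, hM⟩ := hb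
  obtain ⟨M', hM'⟩ := hb'
  have hmeas : ∀ {A : Rd d → ℝ}, Measurable A → ∀ z : Rd d,
      AEStronglyMeasurable (fun y => k y * A (z - θ y)) μ := fun hA z =>
    hk.aestronglyMeasurable.mul (hA.comp (measurable_const.sub hθ)).aestronglyMeasurable
  set e : Rd d := EuclideanSpace.single j 1 with he
  let F : ℝ → E → ℝ := fun t y => k y * B (c • (x + t • e) - θ y)
  let F' : ℝ → E → ℝ := fun t y => k y * (c * partialD j B (c • (x + t • e) - θ y))
  have hF : ∀ t, AEStronglyMeasurable (F t) μ := fun t => hmeas hm _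
  have hF' : AEStronglyMeasurable (F' 0) μ := hmeas (hm'.const_mul c) _
  have hFi : Integrable (F 0) μ := (hk.norm.mul_const M).mono' (hF 0)
    (Eventually.of_forall fun y => by
      simp only [F, norm_mul]; exact mul_le_mul_of_nonneg_left (hM _) (norm_nonneg _))
  have hb : ∀ y t, ‖F' t y‖ ≤ ‖k y‖ * (|c| * M') := fun y t => by
    simp only [F', norm_mul]
    exact mul_le_mul_of_nonneg_left (mul_le_mul_of_nonneg_left (hM' _) (norm_nonneg _))
      (norm_nonneg _)
  have hd : ∀ y t, HasDerivAt (fun t => F t y) (F' t y) t := fun y t =>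
    (hasDerivAt_line hdiff c x (θ y) t).const_mul (k y)
  have key := (hasDerivAt_integral_of_dominated_loc_of_deriv_le (μ := μ) (𝕜 := ℝ) (x₀ := (0 : ℝ))
    (s := Set.univ) univ_mem (F := F) (F' := F') (bound := fun y => ‖k y‖ * (|c| * M'))
    (Eventually.of_forall hF) hFi hF'
    (Eventually.of_forall fun y t _ => hb y t) (hk.norm.mul_const _)
    (Eventually.of_forall fun y t _ => hd y t)).2
  have h2 : HasLineDerivAt ℝ (fun x => ∫ y, k y * B (c • x - θ y) ∂μ)
      (∫ y, k y * (c * partialD j B (c • (x + (0 : ℝ) • e) - θ y)) ∂μ) x e := key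
  rw [partialD, ← he, h2.lineDeriv, ← integral_const_mul]
  refine integral_congr_ae (Eventually.of_forall fun y => ?_)
  simp only [zero_smul, add_zero]
  ring

theorem partialD_const_mul (j : Fin d) (c : ℝ) (F : Rd d → ℝ) :
    partialD j (fun x => c * F x) = fun x => c * partialD j F x := by
  funext x
  simp only [partialD, lineDeriv]
  exact deriv_const_mul_field c

theorem iterPartial_const_mul (c : ℝ) (F : Rd d → ℝ) : ∀ l : List (Fin d),
    iterPartial l (fun x => c * F x) = fun x => c * iterPartial l F x
  | [] => rfl
  | j :: l => by
    rw [iterPartial_cons, iterPartial_const_mul c F l, partialD_const_mul]; rfl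

theorem iterPartial_integral {E : Type*} [MeasurableSpace E] {μ : Measure E} {k : E → ℝ}
    (hk : Integrable k μ) {θ : E → Rd d} (hθ : Measurable θ) (c : ℝ) {B : Rd d → ℝ} :
    ∀ l : List (Fin d), IsBddIterDiff l B →
    iterPartial l (fun x => ∫ y, k y * B (c • x - θ y) ∂μ) =
      fun x => c ^ l.length * ∫ y, k y * iterPartial l B (c • x - θ y) ∂μ
  | [], _ => by funext x; simp [iterPartial]
  | j :: l, H => by
    rw [iterPartial_cons, iterPartial_integral hk hθ c l H.of_cons, partialD_const_mul,
      partialD_integral hk hθ c (H.diff j l List.suffix_rfl) (H.bdd l (List.suffix_cons j l))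
        (H.bdd _ List.suffix_rfl) (H.meas l (List.suffix_cons j l)) (H.meas _ List.suffix_rfl)]
    funext x
    rw [List.length_cons, pow_succ, mul_assoc]
    rfl

theorem integral_eq_pow_mul_integral_sub_smul (F : Rd d → ℝ) (x : Rd d) {h : ℝ} (hh : 0 < h) :
    ∫ y, F y = h ^ d * ∫ z, F (x - h • z) := by
  have h1 := Measure.integral_comp_smul (volume : Measure (Rd d)) (fun z => F (x - z)) h
  rw [integral_sub_left_eq_self F volume x, finrank_euclideanSpace, Fintype.card_fin, smul_eq_mul,
    abs_of_pos (by positivity)] at h1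
  rw [h1]
  field_simp

/-- The derivatives of a convolution may be put on either factor. -/
theorem integral_multiD_kernel_eq {α : Fin d → ℕ} {K f : Rd d → ℝ}
    (hK : Integrable K) (hf : Integrable f) (dK : IsBddIterDiff (multiList α) K)
    (df : IsBddIterDiff (multiList α) f) {h : ℝ} (hh : 0 < h) (x : Rd d) :
    ∫ y, multiD α K (h⁻¹ • (x - y)) * f y =
      h ^ (d + multiLen α) * ∫ z, K z * multiD α f (x - h • z) := by
  -- No integration by parts: the substitution `y = x - h z` gives two expressions for one
  -- convolution, and differentiating each under the integral puts `∂^α` on the kernel or on the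
  -- density.
  have h1 := iterPartial_integral hf (θ := fun y => h⁻¹ • y) (measurable_const_smul _) h⁻¹
    (multiList α) dK
  have h2 := iterPartial_integral hK (θ := fun z => h • z) (measurable_const_smul _) 1
    (multiList α) df
  have e : (fun x => ∫ y, f y * K (h⁻¹ • x - h⁻¹ • y)) =
      fun x => h ^ d * ∫ z, K z * f ((1 : ℝ) • x - h • z) := by
    funext x
    rw [integral_eq_pow_mul_integral_sub_smul _ x hh]
    congr 1
    refine integral_congr_ae (Eventually.of_forall fun z => ?_)
    simp only [one_smul]
    rw [mul_comm, ← smul_sub, sub_sub_cancel, smul_smul, inv_mul_cancel₀ hh.ne', one_smul]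
  rw [e, iterPartial_const_mul, h2] at h1
  have h3 := congrFun h1 x
  simp only [length_multiList, one_pow, one_mul, one_smul, ← multiD_eq_iterPartial] at h3
  rw [pow_add, mul_comm (h ^ d), mul_assoc, h3, inv_pow, ← mul_assoc,
    mul_inv_cancel₀ (pow_pos hh _).ne', one_mul]
  refine integral_congr_ae (Eventually.of_forall fun y => ?_)
  simp only [smul_sub]
  rw [mul_comm]

/-! ## Integration over one coordinate -/

/-- Isolating one coordinate by a measure-preserving map turns integration over `replaceCoord` into
Fubini's theorem on a product with `ℝ`. -/
theorem exists_coord_splitting (j : Fin d) : ∃ (n : ℕ) (e : Rd d ≃ᵐ ℝ × (Fin n → ℝ)),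
    MeasurePreserving e volume volume ∧
      ∀ y t, replaceCoord y j t = e.symm (t, (e y).2) := by
  obtain ⟨n, rfl⟩ : ∃ n, d = n + 1 := ⟨d - 1, by have := j.pos; omega⟩
  let e1 : Rd (n + 1) ≃ᵐ (Fin (n + 1) → ℝ) := (MeasurableEquiv.toLp 2 (Fin (n + 1) → ℝ)).symm
  let e2 : (Fin (n + 1) → ℝ) ≃ᵐ ℝ × (Fin n → ℝ) :=
    MeasurableEquiv.piFinSuccAbove (fun _ => ℝ) j
  refine ⟨n, e1.trans e2, ?_, fun y t => ?_⟩
  · exact (volume_preserving_piFinSuccAbove (fun _ : Fin (n + 1) => ℝ) j).comp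
      (PiLp.volume_preserving_ofLp (Fin (n + 1)))
  · apply (WithLp.ofLp_injective 2)
    funext i
    change Function.update (WithLp.ofLp y) j t i =
      j.insertNth (α := fun _ => ℝ) t (fun i => y.ofLp (j.succAbove i)) i
    rcases Fin.eq_self_or_eq_succAbove j i with h | ⟨i', rfl⟩
    · subst h; simp
    · simp [Function.update_of_ne]

theorem ae_of_ae_coord {n : ℕ} {e : Rd d ≃ᵐ ℝ × (Fin n → ℝ)} (he : MeasurePreserving e volume volume)
    {p : (Fin n → ℝ) → Prop} : (∀ᵐ y, p (e y).2) ↔ ∀ᵐ w, p w := by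
  constructor
  · intro h
    have h1 : ∀ᵐ q : ℝ × (Fin n → ℝ), p q.2 := by
      have h2 := he.symm.quasiMeasurePreserving.ae h
      simpa using h2
    have h3 := Measure.ae_ae_of_ae_prod (μ := (volume : Measure ℝ))
      (ν := (volume : Measure (Fin n → ℝ))) h1
    -- The inner statement does not involve the isolated coordinate, so a single value of it
    -- suffices.
    exact h3.exists.choose_spec
  · intro h
    exact he.quasiMeasurePreserving.ae
      ((Measure.quasiMeasurePreserving_snd (μ := (volume : Measure ℝ))).ae h)

theorem ae_integrable_replaceCoord {G : Rd d → ℝ} (hG : Integrable G) (j : Fin d) :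
    ∀ᵐ y, Integrable fun t : ℝ => G (replaceCoord y j t) := by
  obtain ⟨n, e, he, hr⟩ := exists_coord_splitting j
  simp only [hr]
  refine (ae_of_ae_coord he (p := fun w => Integrable fun t : ℝ => G (e.symm (t, w)))).2 ?_
  have h1 : Integrable (fun q : ℝ × (Fin n → ℝ) => G (e.symm q)) :=
    he.symm.integrable_comp_of_integrable hG
  exact h1.prod_left_ae

theorem abs_integral_le_of_replaceCoord {F G : Rd d → ℝ} (hF : Integrable F) (hG : Integrable G)
    (j : Fin d) (h : ∀ᵐ y, |∫ t : ℝ, F (replaceCoord y j t)| ≤ ∫ t : ℝ, G (replaceCoord y j t)) :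
    |∫ y, F y| ≤ ∫ y, G y := by
  obtain ⟨n, e, he, hr⟩ := exists_coord_splitting j
  simp only [hr] at h
  replace h := (ae_of_ae_coord he (p := fun w =>
    |∫ t : ℝ, F (e.symm (t, w))| ≤ ∫ t : ℝ, G (e.symm (t, w)))).1 h
  have hi : ∀ {A : Rd d → ℝ}, Integrable A →
      Integrable (fun q : ℝ × (Fin n → ℝ) => A (e.symm q)) (volume.prod volume) := fun hA =>
    he.symm.integrable_comp_of_integrable hA
  have hv : ∀ {A : Rd d → ℝ}, Integrable A →
      ∫ y, A y = ∫ w, ∫ t : ℝ, A (e.symm (t, w)) := fun {A} hA => by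
    rw [← integral_prod_symm (fun q : ℝ × (Fin n → ℝ) => A (e.symm q)) (hi hA)]
    exact (he.symm.integral_comp e.symm.measurableEmbedding A).symm
  rw [hv hF, hv hG]
  refine abs_integral_le_integral_abs.trans ?_
  exact integral_mono_ae (hi hF).integral_prod_right.abs (hi hG).integral_prod_right h

/-! ## The bias -/

/-- Induction on the order through the mean value inequality, so the last derivative need only be
bounded. The coefficients other than `c 0` stay unspecified: they will be multiplied by vanishing
moments. -/
theorem abs_sub_taylor_le {M : ℝ} : ∀ (q : ℕ) (φ : ℕ → ℝ → ℝ),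
    (∀ s < q, ∀ t, HasDerivAt (φ s) (φ (s + 1) t) t) → (∀ t, |φ q t| ≤ M) →
    ∃ c : ℕ → ℝ, (0 < q → c 0 = φ 0 0) ∧
      ∀ t, |φ 0 t - ∑ s ∈ Finset.range q, c s * t ^ s| ≤ M * |t| ^ q
  | 0, φ, _, hM => ⟨0, by simp, fun t => by simpa using hM t⟩
  | q + 1, φ, hφ, hM => by
    obtain ⟨c, -, hc⟩ := abs_sub_taylor_le q (fun s => φ (s + 1))
      (fun s hs t => hφ (s + 1) (by omega) t) hM
    -- The polynomial is the primitive of the one obtained for `φ 1`, with constant term `φ 0 0`.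
    refine ⟨fun s => if s = 0 then φ 0 0 else c (s - 1) / s, by simp, fun t => ?_⟩
    have hM0 : 0 ≤ M := (abs_nonneg _).trans (hM 0)
    set r : ℝ → ℝ := fun t => φ 0 t - (∑ s ∈ Finset.range q, c s / ((s + 1 : ℕ) : ℝ) * t ^ (s + 1) + φ 0 0)
      with hr
    have hd : ∀ t, HasDerivAt r (φ 1 t - ∑ s ∈ Finset.range q, c s * t ^ s) t := by
      intro t
      refine (hφ 0 (by omega) t).sub (HasDerivAt.add_const _ ?_)
      refine HasDerivAt.fun_sum fun s _ => ?_
      refine ((hasDerivAt_pow (s + 1) t).const_mul _).congr_deriv ?_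
      have : ((s + 1 : ℕ) : ℝ) ≠ 0 := by positivity
      simp only [Nat.add_sub_cancel]
      field_simp
    have hr0 : r 0 = 0 := by simp [hr]
    have hseg := Convex.norm_image_sub_le_of_norm_hasDerivWithin_le (s := segment ℝ 0 t)
      (C := M * |t| ^ q) (fun x _ => (hd x).hasDerivWithinAt) (fun x hx => by
        refine (hc x).trans (mul_le_mul_of_nonneg_left ?_ hM0)
        obtain ⟨a, b, ha, hb, hab, rfl⟩ := hx
        refine pow_le_pow_left₀ (abs_nonneg _) ?_ q
        simp only [smul_eq_mul, mul_zero, zero_add, abs_mul, abs_of_nonneg hb]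
        exact mul_le_of_le_one_left (abs_nonneg t) (by linarith)) (convex_segment _ _)
      (left_mem_segment ℝ 0 t) (right_mem_segment ℝ 0 t)
    rw [hr0, sub_zero, sub_zero, Real.norm_eq_abs, Real.norm_eq_abs] at hseg
    rw [Finset.sum_range_succ', pow_succ, ← mul_assoc]
    simpa [hr] using hseg

/-- The one-dimensional integral of `K` against an increment of `g` in direction `j`. -/
theorem abs_integral_kernel_increment_le {q : ℕ} (hq : 1 ≤ q) {g : Rd d → ℝ}
    (hg : TimesDifferentiable q g) {M : ℝ} (hM : ∀ x, ‖iteratedFDeriv ℝ q g x‖ ≤ M) (j : Fin d)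
    {κ : ℝ → ℝ} (hκ : Integrable κ) (hκq : Integrable fun t => |t ^ q * κ t|)
    (hmom : ∀ s, 1 ≤ s → s < q → ∫ t, t ^ s * κ t = 0) {h : ℝ} (hh : 0 < h) (p : Rd d) :
    |∫ t, κ t * (g (p - (h * t) • EuclideanSpace.single j 1) - g p)| ≤
      M * h ^ q * ∫ t, |t ^ q * κ t| := by
  set e : Rd d := EuclideanSpace.single j 1
  obtain ⟨c, hc0, hc⟩ := abs_sub_taylor_le (M := M) q
    (fun s t => iterPartial (List.replicate s j) g (p + t • e))
    (fun s hs t => by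
      have h1 := hg.differentiable_iterPartial (l := List.replicate s j) (by simpa using hs)
      have h2 := hasDerivAt_line (c := 1) (θ := 0) (e := e)
        (fun x => (h1 x).lineDifferentiableAt) p t
      simp only [one_smul, sub_zero, one_mul] at h2
      exact h2)
    (fun t => by
      have h1 := hg.abs_iterPartial_le (l := List.replicate q j) (by simp) (p + t • e)
      rw [List.length_replicate] at h1
      exact h1.trans (hM _))
  -- The intermediate moments exist because `|t|^s ≤ 1 + |t|^q`.
  have hmi : ∀ s, s ≤ q → Integrable fun t : ℝ => t ^ s * κ t := by
    intro s hs
    refine (hκ.norm.add hκq).mono' ((continuous_pow s).aestronglyMeasurable.mul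
      hκ.aestronglyMeasurable) (Eventually.of_forall fun t => ?_)
    simp only [Pi.add_apply, norm_mul, Real.norm_eq_abs, abs_mul, abs_pow]
    rcases le_total |t| 1 with h1 | h1
    · have := pow_le_one₀ (n := s) (abs_nonneg t) h1
      have h3 : 0 ≤ |t| ^ q * |κ t| := by positivity
      nlinarith [abs_nonneg (κ t)]
    · have := pow_le_pow_right₀ h1 hs
      nlinarith [abs_nonneg (κ t)]
  have hc0' : c 0 = g p := by
    rw [hc0 (by omega)]; simp [iterPartial]
  -- The constant term cancels `g p`, and every other monomial is killed by a moment condition.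
  have hpoly : ∫ t, κ t * (∑ s ∈ Finset.range q, c s * (-(h * t)) ^ s - g p) = 0 := by
    obtain ⟨r, rfl⟩ : ∃ r, q = r + 1 := ⟨q - 1, by omega⟩
    have e1 : ∀ t, κ t * (∑ s ∈ Finset.range (r + 1), c s * (-(h * t)) ^ s - g p) =
        ∑ s ∈ Finset.range r, c (s + 1) * (-h) ^ (s + 1) * (t ^ (s + 1) * κ t) := by
      intro t
      rw [Finset.sum_range_succ', hc0', pow_zero, mul_one, add_sub_cancel_right, Finset.mul_sum]
      refine Finset.sum_congr rfl fun s _ => ?_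
      rw [← neg_mul, mul_pow]; ring
    simp only [e1]
    rw [integral_finsetSum _ fun s hs => (hmi (s + 1) (by have := Finset.mem_range.1 hs; omega)).const_mul _]
    refine Finset.sum_eq_zero fun s hs => ?_
    rw [integral_const_mul, hmom (s + 1) (by omega) (by have := Finset.mem_range.1 hs; omega), mul_zero]
  have hpint : Integrable fun t => κ t * (∑ s ∈ Finset.range q, c s * (-(h * t)) ^ s - g p) := by
    have : (fun t => κ t * (∑ s ∈ Finset.range q, c s * (-(h * t)) ^ s - g p)) = fun t =>
        ∑ s ∈ Finset.range q, c s * (-h) ^ s * (t ^ s * κ t) - g p * κ t := by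
      funext t
      rw [mul_sub, Finset.mul_sum, mul_comm (κ t) (g p)]
      congr 1
      refine Finset.sum_congr rfl fun s _ => ?_
      rw [← neg_mul, mul_pow]; ring
    rw [this]
    exact (integrable_finsetSum _ fun s hs =>
      (hmi s (Finset.mem_range.1 hs).le).const_mul _).sub (hκ.const_mul _)
  have hgc : Continuous g := (hg.differentiable (by omega)).continuous
  have hrem : ∀ t, |κ t * (g (p - (h * t) • e) - ∑ s ∈ Finset.range q, c s * (-(h * t)) ^ s)| ≤
      M * h ^ q * |t ^ q * κ t| := by
    intro t
    have h1 := hc (-(h * t))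
    simp only [List.replicate_zero] at h1
    rw [show p + (-(h * t)) • e = p - (h * t) • e by rw [neg_smul, sub_eq_add_neg]] at h1
    have h1' : |g (p - (h * t) • e) - ∑ s ∈ Finset.range q, c s * (-(h * t)) ^ s| ≤
      M * |(-(h * t))| ^ q := h1
    rw [abs_mul]
    refine (mul_le_mul_of_nonneg_left h1' (abs_nonneg _)).trans (le_of_eq ?_)
    rw [abs_neg, abs_mul, abs_of_pos hh, abs_mul, abs_pow]; ring
  have hrint : Integrable fun t =>
      κ t * (g (p - (h * t) • e) - ∑ s ∈ Finset.range q, c s * (-(h * t)) ^ s) :=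
    (hκq.const_mul (M * h ^ q)).mono' (hκ.aestronglyMeasurable.mul
      (Continuous.aestronglyMeasurable (by fun_prop))) (Eventually.of_forall hrem)
  have split : ∀ t, κ t * (g (p - (h * t) • e) - g p) =
      κ t * (g (p - (h * t) • e) - ∑ s ∈ Finset.range q, c s * (-(h * t)) ^ s) +
      κ t * (∑ s ∈ Finset.range q, c s * (-(h * t)) ^ s - g p) := fun t => by ring
  simp only [split]
  rw [integral_add hrint hpint, hpoly, add_zero, ← integral_const_mul]
  exact abs_integral_le_integral_abs.trans (integral_mono hrint.abs (hκq.const_mul _) hrem)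

/-- The first `m` coordinates of `z`, completed by zeros. -/
noncomputable def truncCoord (m : ℕ) (z : Rd d) : Rd d :=
  WithLp.toLp 2 fun i => if i.val < m then z i else 0

theorem continuous_truncCoord (m : ℕ) : Continuous (truncCoord (d := d) m) := by
  unfold truncCoord
  refine (PiLp.continuous_toLp 2 _).comp (continuous_pi fun i => ?_)
  split_ifs
  · exact (continuous_apply i).comp (PiLp.continuous_ofLp 2 _)
  · exact continuous_const

theorem truncCoord_zero (z : Rd d) : truncCoord 0 z = 0 := by
  ext i; simp [truncCoord]

theorem truncCoord_self (z : Rd d) : truncCoord d z = z := by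
  ext i; simp [truncCoord]

theorem truncCoord_replaceCoord (j : Fin d) (z : Rd d) (t : ℝ) :
    truncCoord j (replaceCoord z j t) = truncCoord j z := by
  ext i
  simp only [truncCoord, replaceCoord]
  split_ifs with h
  · rw [Function.update_of_ne (fun e => by rw [e] at h; exact lt_irrefl _ h)]
  · rfl

theorem truncCoord_succ_replaceCoord (j : Fin d) (z : Rd d) (t : ℝ) :
    truncCoord (j + 1) (replaceCoord z j t) = truncCoord j z + t • EuclideanSpace.single j 1 := by
  ext i
  simp only [truncCoord, replaceCoord, PiLp.add_apply, PiLp.smul_apply, smul_eq_mul]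
  rcases lt_trichotomy i j with h | h | h
  · have h' : i.val < j.val := h
    rw [if_pos (by omega), if_pos h', Function.update_of_ne h.ne]
    simp [h.ne]
  · subst h; simp
  · have h' : j.val < i.val := h
    rw [if_neg (by omega), if_neg (by omega)]
    simp [h.ne']

/-- The smoothing bias is of order `h^q`. -/
theorem abs_integral_kernel_sub_le {q : ℕ} (hq : 1 ≤ q) {K g : Rd d → ℝ} (hK : Integrable K)
    (hK1 : ∫ z, K z = 1) (hg : TimesDifferentiable q g) {M : ℝ}
    (hM : ∀ x, ‖iteratedFDeriv ℝ q g x‖ ≤ M) (hgb : ∃ C, ∀ x, |g x| ≤ C)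
    (hmom : ∀ s : ℕ, 1 ≤ s → s < q → ∀ j : Fin d,
      ∀ᵐ y : Rd d, ∫ t : ℝ, t ^ s * K (replaceCoord y j t) = 0)
    (hKq : ∀ j : Fin d, Integrable (fun y : Rd d => |(y j) ^ q * K y|)) :
    ∃ C, 0 ≤ C ∧ ∀ h, 0 < h → ∀ x, |(∫ z, K z * g (x - h • z)) - g x| ≤ C * h ^ q := by
  have hM0 : 0 ≤ M := (norm_nonneg _).trans (hM 0)
  obtain ⟨Cg, hCg⟩ := hgb
  have hgc : Continuous g := (hg.differentiable (by omega)).continuous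
  refine ⟨∑ j : Fin d, M * ∫ y, |(y j) ^ q * K y|, Finset.sum_nonneg fun j _ =>
    mul_nonneg hM0 (integral_nonneg fun _ => abs_nonneg _), fun h hh x => ?_⟩
  have hint : ∀ τ : Rd d → Rd d, Continuous τ → Integrable fun z => K z * g (τ z) := fun τ hτ =>
    (hK.norm.mul_const Cg).mono' (hK.aestronglyMeasurable.mul (hgc.comp hτ).aestronglyMeasurable)
      (Eventually.of_forall fun z => by
        rw [norm_mul]; exact mul_le_mul_of_nonneg_left (hCg _) (norm_nonneg _))
  have hτ : ∀ m, Continuous fun z => x - h • truncCoord (d := d) m z := fun m =>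
    continuous_const.sub ((continuous_truncCoord m).const_smul h)
  -- The moment conditions concern one coordinate at a time, so the coordinates are shifted one by
  -- one. The total increment telescopes into differences `I (j+1) - I j`, each an increment in
  -- direction `j`.
  set I : ℕ → ℝ := fun m => ∫ z, K z * g (x - h • truncCoord m z) with hI
  have hI0 : I 0 = g x := by
    simp only [hI, truncCoord_zero, smul_zero, sub_zero, integral_mul_const, hK1, one_mul]
  have hId : I d = ∫ z, K z * g (x - h • z) := by simp only [hI, truncCoord_self]
  rw [← hI0, ← hId, ← Finset.sum_range_sub, ← Fin.sum_univ_eq_sum_range (fun m => I (m + 1) - I m),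
    Finset.sum_mul]
  refine (Finset.abs_sum_le_sum_abs _ _).trans (Finset.sum_le_sum fun j _ => ?_)
  simp only [hI]
  rw [← integral_sub (hint _ (hτ _)) (hint _ (hτ _))]
  rw [mul_right_comm, ← integral_const_mul]
  refine abs_integral_le_of_replaceCoord ((hint _ (hτ _)).sub (hint _ (hτ _)))
    ((hKq j).const_mul _) j ?_
  have hmom' : ∀ᵐ y : Rd d, ∀ s : ℕ, 1 ≤ s → s < q →
      ∫ t : ℝ, t ^ s * K (replaceCoord y j t) = 0 := by
    rw [ae_all_iff]
    intro s
    by_cases h1 : 1 ≤ s ∧ s < q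
    · filter_upwards [hmom s h1.1 h1.2 j] with y hy _ _ using hy
    · exact Eventually.of_forall fun y h2 h3 => absurd ⟨h2, h3⟩ h1
  filter_upwards [hmom', ae_integrable_replaceCoord hK j, ae_integrable_replaceCoord (hKq j) j]
    with y h1 h2 h3
  have hyj : ∀ t, (replaceCoord y j t) j = t := fun t => by simp [replaceCoord]
  simp only [hyj] at h3 ⊢
  have := abs_integral_kernel_increment_le hq hg hM j h2 h3 h1 hh (x - h • truncCoord j y)
  rw [integral_const_mul]
  convert this using 4 with t
  rw [truncCoord_succ_replaceCoord, truncCoord_replaceCoord, ← mul_sub, smul_add, smul_smul, sub_sub]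

end

/-! ## The cumulant generating function of the estimator -/

theorem Finset.sum_Icc_one_eq_sum_range {M : Type*} [AddCommMonoid M] (F : ℕ → M) (n : ℕ) :
    ∑ i ∈ Finset.Icc 1 n, F i = ∑ j ∈ Finset.range n, F (j + 1) := by
  rw [show Finset.Icc 1 n = Finset.Ico 1 (n + 1) by ext; simp, Finset.sum_Ico_eq_sum_range]
  exact Finset.sum_congr (by simp) fun j _ => by rw [add_comm]

/-- Both sides follow from `log y ≤ y - 1`, applied to `1 + t` and to its inverse. -/
theorem abs_log_sub_le {t c : ℝ} (hc : 0 < c) (ht : c ≤ 1 + t) :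
    |Real.log (1 + t) - t| ≤ c⁻¹ * t ^ 2 := by
  have hp : 0 < 1 + t := hc.trans_le ht
  have h1 := Real.log_le_sub_one_of_pos hp
  have h2 := Real.log_le_sub_one_of_pos (inv_pos.2 hp)
  rw [Real.log_inv] at h2
  rw [abs_of_nonpos (by linarith)]
  have h3 : -(Real.log (1 + t) - t) ≤ (1 + t)⁻¹ * t ^ 2 := by
    have e : (1 + t)⁻¹ * t ^ 2 = t + ((1 + t)⁻¹ - 1) := by field_simp; ring
    rw [e]; linarith
  exact h3.trans (mul_le_mul_of_nonneg_right (inv_anti₀ hc ht) (sq_nonneg t))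

/-- The mean of the recursive estimator. -/
noncomputable def meanEstimator {d : ℕ} (α : Fin d → ℕ) (K f : Rd d → ℝ) (h : ℕ → ℝ) (n : ℕ)
    (x : Rd d) : ℝ :=
  (1 / (n : ℝ)) * ∑ i ∈ Finset.Icc 1 n,
    (1 / h i ^ (d + multiLen α)) * ∫ y, multiD α K ((h i)⁻¹ • (x - y)) * f y

section

variable {d : ℕ}

theorem integrable_mul_of_bounded {f A : Rd d → ℝ} (hf : Integrable f) (hA : Measurable A) {M : ℝ}
    (hM : ∀ y, |A y| ≤ M) : Integrable fun y => A y * f y :=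
  (hf.norm.const_mul M).mono' (hA.aestronglyMeasurable.mul hf.aestronglyMeasurable)
    (Eventually.of_forall fun y => by
      rw [norm_mul]; exact mul_le_mul_of_nonneg_right (hM y) (norm_nonneg _))

theorem integral_comp_sample {Ω : Type*} [MeasurableSpace Ω] {P : Measure Ω}
    {X : ℕ → Ω → Rd d} {f : Rd d → ℝ} (hf : IsBoundedDensity f) (hfm : Measurable f)
    (hX : IsIIDSample P X f) {i : ℕ} (hi : 1 ≤ i) {A : Rd d → ℝ} (hA : Measurable A) :
    ∫ ω, A (X i ω) ∂P = ∫ y, A y * f y := by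
  have h1 : ∫ ω, A (X i ω) ∂P = ∫ y, A y ∂(P.map (X i)) :=
    (integral_map (hX.measurable i hi).aemeasurable hA.aestronglyMeasurable).symm
  rw [h1, hX.law i hi, integral_withDensity_eq_integral_toReal_smul hfm.ennreal_ofReal
    (Eventually.of_forall fun _ => ENNReal.ofReal_lt_top)]
  refine integral_congr_ae (Eventually.of_forall fun y => ?_)
  simp only [ENNReal.toReal_ofReal (hf.nonneg y), smul_eq_mul]
  ring

/-- The uniform smoothing error of a uniformly continuous bounded function against an integrable
weight tends to zero. -/
theorem exists_uniform_smoothing_error {f : Rd d → ℝ} (hfuc : UniformContinuous f) {C : ℝ}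
    (hfC : ∀ x, |f x| ≤ C) {w : Rd d → ℝ} (hw : Integrable w) (hw0 : ∀ z, 0 ≤ w z)
    {h : ℕ → ℝ} (hh : Tendsto h atTop (𝓝 0)) (hpos : ∀ n, 1 ≤ n → 0 < h n) :
    ∃ e : ℕ → ℝ, Tendsto e atTop (𝓝 0) ∧ ∀ n x, ∫ z, w z * |f (x - h n • z) - f x| ≤ e n := by
  have hC0 : 0 ≤ C := (abs_nonneg _).trans (hfC 0)
  have hdiff : ∀ x y, |f x - f y| ≤ 2 * C := fun x y => by
    have := abs_sub (f x) (f y)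
    linarith [hfC x, hfC y]
  have hint : ∀ n x, Integrable fun z => w z * |f (x - h n • z) - f x| := fun n x =>
    (hw.mul_const (2 * C)).mono' (hw.aestronglyMeasurable.mul
      (by have := hfuc.continuous; exact Continuous.aestronglyMeasurable (by fun_prop)))
      (Eventually.of_forall fun z => by
        rw [norm_mul, Real.norm_eq_abs, abs_of_nonneg (hw0 z), Real.norm_eq_abs, abs_abs]
        exact mul_le_mul_of_nonneg_left (hdiff _ _) (hw0 z))
  have hbdd : ∀ n, BddAbove (Set.range fun x => ∫ z, w z * |f (x - h n • z) - f x|) := fun n =>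
    ⟨∫ z, w z * (2 * C), by
      rintro _ ⟨x, rfl⟩
      exact integral_mono (hint n x) (hw.mul_const _) fun z =>
        mul_le_mul_of_nonneg_left (hdiff _ _) (hw0 z)⟩
  refine ⟨fun n => ⨆ x, ∫ z, w z * |f (x - h n • z) - f x|, ?_, fun n x => le_ciSup (hbdd n) x⟩
  -- Outside a large ball the weight is small; inside it `h n • z` is small and uniform continuity
  -- applies. Both estimates are uniform in `x`.
  have htail : Tendsto (fun R : ℕ => ∫ z, {z : Rd d | (R : ℝ) < ‖z‖}.indicator w z) atTop (𝓝 0) := by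
    have hs : ∀ R : ℕ, MeasurableSet {z : Rd d | (R : ℝ) < ‖z‖} := fun R =>
      measurableSet_lt measurable_const measurable_norm
    have := tendsto_integral_of_dominated_convergence (F := fun (R : ℕ) z =>
      {z : Rd d | (R : ℝ) < ‖z‖}.indicator w z) (f := fun _ => (0 : ℝ)) (bound := w)
      (fun R => hw.aestronglyMeasurable.indicator (hs R)) hw
      (fun R => Eventually.of_forall fun z => by
        rw [Real.norm_eq_abs, abs_of_nonneg (Set.indicator_nonneg (fun z _ => hw0 z) z)]
        exact Set.indicator_le_self' (fun z _ => hw0 z) z)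
      (Eventually.of_forall fun z => by
        refine tendsto_const_nhds.congr' ?_
        filter_upwards [eventually_ge_atTop ⌈‖z‖⌉₊] with R hR
        rw [Set.indicator_of_notMem]
        simp only [Set.mem_ofPred_eq, not_lt]
        exact (Nat.le_ceil _).trans (by exact_mod_cast hR))
    simpa using this
  rw [Metric.tendsto_atTop]
  intro ε hε
  have hW0 : 0 ≤ ∫ z, w z := integral_nonneg hw0
  obtain ⟨R, hR⟩ := (htail.eventually (gt_mem_nhds
    (show 0 < ε / (4 * (2 * C + 1)) by positivity))).exists
  obtain ⟨η, hη, hηf⟩ := Metric.uniformContinuous_iff.1 hfuc (ε / (4 * ((∫ z, w z) + 1)))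
    (by positivity)
  obtain ⟨N, hN⟩ := (Metric.tendsto_atTop.1 hh) (η / (R + 1)) (by positivity)
  refine ⟨max N 1, fun n hn => ?_⟩
  have hhn := hpos n ((le_max_right _ _).trans hn)
  have hhn2 := hN n ((le_max_left _ _).trans hn)
  rw [dist_zero_right, Real.norm_eq_abs, abs_of_pos hhn] at hhn2
  have hle : ∀ x, ∫ z, w z * |f (x - h n • z) - f x| ≤ ε / 2 := by
    intro x
    have hind : Integrable ({z : Rd d | (R : ℝ) < ‖z‖}.indicator w) :=
      hw.indicator (measurableSet_lt measurable_const measurable_norm)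
    calc ∫ z, w z * |f (x - h n • z) - f x|
        ≤ ∫ z, (w z * (ε / (4 * ((∫ z, w z) + 1))) +
            {z : Rd d | (R : ℝ) < ‖z‖}.indicator w z * (2 * C)) := by
          refine integral_mono (hint n x) ((hw.mul_const _).add (hind.mul_const _)) fun z => ?_
          by_cases hz : (R : ℝ) < ‖z‖
          · simp only [Set.indicator_of_mem (show z ∈ {z : Rd d | (R : ℝ) < ‖z‖} from hz)]
            have := mul_le_mul_of_nonneg_left (hdiff (x - h n • z) x) (hw0 z)
            have : 0 ≤ w z * (ε / (4 * ((∫ z, w z) + 1))) := mul_nonneg (hw0 z) (by positivity)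
            linarith
          · simp only [Set.indicator_of_notMem (show z ∉ {z : Rd d | (R : ℝ) < ‖z‖} from hz),
              zero_mul, add_zero]
            refine mul_le_mul_of_nonneg_left ?_ (hw0 z)
            have := @hηf (x - h n • z) x (by
              rw [dist_eq_norm, sub_sub_cancel_left, norm_neg, norm_smul, Real.norm_eq_abs,
                abs_of_pos hhn]
              rw [lt_div_iff₀ (by positivity)] at hhn2
              nlinarith [norm_nonneg z])
            exact this.le
      _ = (∫ z, w z) * (ε / (4 * ((∫ z, w z) + 1))) +
            (∫ z, {z : Rd d | (R : ℝ) < ‖z‖}.indicator w z) * (2 * C) := by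
          rw [integral_add (hw.mul_const _) (hind.mul_const _), integral_mul_const,
            integral_mul_const]
      _ ≤ ε / 4 + ε / 4 := by
          refine add_le_add ?_ ?_
          · rw [mul_div_assoc', div_le_div_iff₀ (by positivity) (by norm_num)]
            nlinarith
          · have : 2 * C ≤ 2 * C + 1 := by linarith
            have h3 : ε / (4 * (2 * C + 1)) * (2 * C) ≤ ε / 4 := by
              rw [div_mul_eq_mul_div, div_le_div_iff₀ (by positivity) (by norm_num)]
              nlinarith
            exact (mul_le_mul_of_nonneg_right hR.le (by positivity)).trans h3
      _ = ε / 2 := by ring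
  rw [dist_zero_right, Real.norm_eq_abs, abs_of_nonneg]
  · exact (ciSup_le hle).trans_lt (by linarith)
  · exact Real.iSup_nonneg fun x => integral_nonneg fun z => mul_nonneg (hw0 z) (abs_nonneg _)

/-- One kernel term: its moment generating function is `1 + t` with `t` explicit up to `h^d c²`. -/
theorem abs_log_mgf_term_le {k f : Rd d → ℝ} {B C : ℝ} (Hk : IsBddIntegrable k B)
    (hf : IsBoundedDensity f) (hfm : Measurable f) (hfC : ∀ x, f x ≤ C) {h w W : ℝ} (hh : 0 < h)
    (hwW : |w| ≤ W) (x : Rd d) {e : ℝ} (he : ∫ z, k z ^ 2 * |f (x - h • z) - f x| ≤ e) :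
    |Real.log (∫ y, Real.exp (w * k (h⁻¹ • (x - y))) * f y) -
      (w * ∫ y, k (h⁻¹ • (x - y)) * f y) - h ^ d * (f x * kerPhi k w)| ≤
    w ^ 2 * h ^ d * (Real.exp (W * B) ^ 3 * C ^ 2 * (∫ z, |k z|) ^ 2 * h ^ d +
      Real.exp (W * B) * e) := by
  have hB := Hk.bound_nonneg
  have hC0 : 0 ≤ C := (hf.nonneg 0).trans (hfC 0)
  have hkm : Measurable fun y => k (h⁻¹ • (x - y)) :=
    Hk.measurable.comp (by fun_prop)
  have hwk : ∀ z, |w * k z| ≤ W * B := fun z => by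
    rw [abs_mul]
    exact mul_le_mul hwW (Hk.bound z) (abs_nonneg _) ((abs_nonneg w).trans hwW)
  have hexpm : Measurable fun y => Real.exp (w * k (h⁻¹ • (x - y))) := (hkm.const_mul w).exp
  have hexpb : ∀ y, |Real.exp (w * k (h⁻¹ • (x - y)))| ≤ Real.exp (W * B) := fun y => by
    rw [abs_of_pos (Real.exp_pos _)]
    exact Real.exp_le_exp.2 ((le_abs_self _).trans (hwk _))
  have hexpi := integrable_mul_of_bounded hf.integrable hexpm hexpb
  have hki := integrable_mul_of_bounded hf.integrable hkm (fun y => Hk.bound _)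
  have hcv : ∀ F : Rd d → ℝ, ∫ y, F (h⁻¹ • (x - y)) * f y = h ^ d * ∫ z, F z * f (x - h • z) := by
    intro F
    rw [integral_eq_pow_mul_integral_sub_smul _ x hh]
    congr 1
    refine integral_congr_ae (Eventually.of_forall fun z => ?_)
    simp only
    rw [sub_sub_cancel, smul_smul, inv_mul_cancel₀ hh.ne', one_smul]
  set t : ℝ := ∫ y, (Real.exp (w * k (h⁻¹ • (x - y))) - 1) * f y with ht
  have h1t : ∫ y, Real.exp (w * k (h⁻¹ • (x - y))) * f y = 1 + t := by
    have e1 : t = ∫ y, (Real.exp (w * k (h⁻¹ • (x - y))) * f y - f y) := by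
      rw [ht]; congr 1; funext y; ring
    rw [e1, integral_sub hexpi hf.integrable, hf.integral_eq_one]; ring
  -- Boundedness of the kernel keeps the moment generating function away from zero, hence `log (1 +
  -- t) = t + O(t²)`.
  have hlow : Real.exp (-(W * B)) ≤ 1 + t := by
    rw [← h1t]
    calc Real.exp (-(W * B)) = ∫ y, Real.exp (-(W * B)) * f y := by
          rw [integral_const_mul, hf.integral_eq_one, mul_one]
      _ ≤ _ := integral_mono (hf.integrable.const_mul _) hexpi fun y =>
          mul_le_mul_of_nonneg_right (Real.exp_le_exp.2 (abs_le.1 (hwk _)).1) (hf.nonneg y)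
  have hlog := abs_log_sub_le (Real.exp_pos _) hlow
  rw [← Real.exp_neg, neg_neg] at hlog
  have habsk : Integrable fun z => |k z| := Hk.integrable.abs
  have hmf : Measurable fun z : Rd d => f (x - h • z) := hfm.comp (by fun_prop)
  -- As `|t|` is of order `|w| h^d`, its square contributes `w² h^{2d}`, smaller than the main term
  -- by a factor `h^d`.
  have htb : |t| ≤ |w| * Real.exp (W * B) * (C * (∫ z, |k z|) * h ^ d) := by
    calc |t| ≤ ∫ y, |(Real.exp (w * k (h⁻¹ • (x - y))) - 1) * f y| := abs_integral_le_integral_abs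
      _ ≤ ∫ y, |w| * Real.exp (W * B) * (|k (h⁻¹ • (x - y))| * f y) := by
          refine integral_mono ?_ ?_ fun y => ?_
          · refine (integrable_mul_of_bounded hf.integrable (hexpm.sub_const 1)
              (M := Real.exp (W * B) + 1) fun y => ?_).abs
            refine (abs_sub _ _).trans ?_
            rw [abs_one]
            linarith [hexpb y]
          · refine Integrable.const_mul ?_ _
            exact integrable_mul_of_bounded hf.integrable hkm.abs
              (fun y => (abs_abs _).trans_le (Hk.bound _))
          · simp only [abs_mul, abs_of_nonneg (hf.nonneg y)]
            rw [← mul_assoc]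
            refine mul_le_mul_of_nonneg_right ?_ (hf.nonneg y)
            refine (abs_exp_sub_one_le_mul_exp _).trans ?_
            rw [abs_mul w, mul_right_comm]
            refine mul_le_mul_of_nonneg_right ?_ (abs_nonneg _)
            refine mul_le_mul_of_nonneg_left (Real.exp_le_exp.2 ?_) (abs_nonneg w)
            rw [← abs_mul]; exact hwk _
      _ = |w| * Real.exp (W * B) * (h ^ d * ∫ z, |k z| * f (x - h • z)) := by
          rw [integral_const_mul, hcv fun z => |k z|]
      _ ≤ |w| * Real.exp (W * B) * (h ^ d * ∫ z, |k z| * C) := by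
          refine mul_le_mul_of_nonneg_left (mul_le_mul_of_nonneg_left ?_ (by positivity)) (by positivity)
          refine integral_mono ?_ (habsk.mul_const C) fun z =>
            mul_le_mul_of_nonneg_left (hfC _) (abs_nonneg _)
          exact (habsk.mul_const C).mono' (habsk.aestronglyMeasurable.mul
            hmf.aestronglyMeasurable) (Eventually.of_forall fun z => by
              rw [norm_mul, Real.norm_eq_abs, abs_abs, Real.norm_eq_abs, abs_of_nonneg (hf.nonneg _)]
              exact mul_le_mul_of_nonneg_left (hfC _) (abs_nonneg _))
      _ = _ := by rw [integral_mul_const]; ring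
  have hfb : ∀ z : Rd d, |f (x - h • z)| ≤ C := fun z => by
    rw [abs_of_nonneg (hf.nonneg _)]; exact hfC _
  have hrf : Integrable fun z => expRem (w * k z) * f (x - h • z) := by
    refine ((Hk.integrable_expRem w).norm.mul_const C).mono'
      ((Hk.integrable_expRem w).aestronglyMeasurable.mul hmf.aestronglyMeasurable)
      (Eventually.of_forall fun z => ?_)
    rw [norm_mul]
    exact mul_le_mul_of_nonneg_left (hfb z) (norm_nonneg _)
  -- The linear part is kept exactly: summed over `i` it becomes the mean of the estimator and
  -- cancels against the centering.
  have ht2 : t = w * (∫ y, k (h⁻¹ • (x - y)) * f y) + h ^ d * ∫ z, expRem (w * k z) * f (x - h • z) := by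
    rw [← hcv fun z => expRem (w * k z), ← integral_const_mul, ← integral_add (hki.const_mul w), ht]
    · refine integral_congr_ae (Eventually.of_forall fun y => ?_)
      simp only [expRem]; ring
    · refine integrable_mul_of_bounded hf.integrable (continuous_expRem.measurable.comp
        (hkm.const_mul w)) (M := Real.exp (W * B) + 1 + W * B) fun y => ?_
      simp only [expRem]
      have h1 := abs_sub (Real.exp (w * k (h⁻¹ • (x - y))) - 1) (w * k (h⁻¹ • (x - y)))
      have h2 := abs_sub (Real.exp (w * k (h⁻¹ • (x - y)))) 1
      rw [abs_one] at h2
      linarith [hexpb y, hwk (h⁻¹ • (x - y))]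
  have hk2f : Integrable fun z => k z ^ 2 * |f (x - h • z) - f x| := by
    refine (Hk.integrable_sq.mul_const (C + C)).mono' (Hk.integrable_sq.aestronglyMeasurable.mul
      (hmf.sub_const _).abs.aestronglyMeasurable) (Eventually.of_forall fun z => ?_)
    rw [norm_mul, Real.norm_eq_abs, abs_of_nonneg (sq_nonneg _), Real.norm_eq_abs, abs_abs]
    refine mul_le_mul_of_nonneg_left ((abs_sub _ _).trans (add_le_add (hfb z) ?_)) (sq_nonneg _)
    rw [abs_of_nonneg (hf.nonneg _)]; exact hfC _
  have hrem : |(∫ z, expRem (w * k z) * f (x - h • z)) - f x * kerPhi k w| ≤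
      w ^ 2 * Real.exp (W * B) * e := by
    rw [kerPhi, ← integral_const_mul, ← integral_sub hrf ((Hk.integrable_expRem w).const_mul _)]
    calc _ ≤ ∫ z, |expRem (w * k z) * f (x - h • z) - f x * expRem (w * k z)| :=
          abs_integral_le_integral_abs
      _ ≤ ∫ z, w ^ 2 * Real.exp (W * B) * (k z ^ 2 * |f (x - h • z) - f x|) := by
          refine integral_mono (hrf.sub ((Hk.integrable_expRem w).const_mul _)).abs
            (hk2f.const_mul _) fun z => ?_
          simp only
          rw [show expRem (w * k z) * f (x - h • z) - f x * expRem (w * k z) =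
            expRem (w * k z) * (f (x - h • z) - f x) by ring, abs_mul,
            abs_of_nonneg (expRem_nonneg _), ← mul_assoc]
          refine mul_le_mul_of_nonneg_right ?_ (abs_nonneg _)
          refine (Hk.expRem_mul_le w z).trans ?_
          refine mul_le_mul_of_nonneg_right (mul_le_mul_of_nonneg_left (Real.exp_le_exp.2 ?_)
            (sq_nonneg w)) (sq_nonneg _)
          exact mul_le_mul_of_nonneg_right hwW hB
      _ ≤ _ := by
          rw [integral_const_mul]
          exact mul_le_mul_of_nonneg_left he (by positivity)
  rw [h1t]
  have hsplit : Real.log (1 + t) - (w * ∫ y, k (h⁻¹ • (x - y)) * f y) - h ^ d * (f x * kerPhi k w) =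
      (Real.log (1 + t) - t) +
        h ^ d * ((∫ z, expRem (w * k z) * f (x - h • z)) - f x * kerPhi k w) := by
    rw [ht2]; ring
  rw [hsplit]
  refine (abs_add_le _ _).trans ?_
  rw [abs_mul, abs_of_pos (pow_pos hh d)]
  have htsq : t ^ 2 ≤ (|w| * Real.exp (W * B) * (C * (∫ z, |k z|) * h ^ d)) ^ 2 := by
    rw [← sq_abs t]; gcongr
  calc _ ≤ Real.exp (W * B) * (|w| * Real.exp (W * B) * (C * (∫ z, |k z|) * h ^ d)) ^ 2 +
        h ^ d * (w ^ 2 * Real.exp (W * B) * e) := by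
        refine add_le_add (hlog.trans ?_) ?_
        · gcongr
        · gcongr
    _ = _ := by rw [mul_pow, mul_pow, sq_abs]; ring

/-- The standing data of the large deviations estimates: an admissible array, a regular kernel,
a negligible bias and a limiting cumulant function. -/
structure IsEstimationSetting {Ω : Type*} [MeasurableSpace Ω] (P : Measure Ω)
    (X : ℕ → Ω → Rd d) (α : Fin d → ℕ) (K f : Rd d → ℝ) (h v : ℕ → ℝ) (B : ℝ) (Λ : ℝ → ℝ) :
    Prop where
  dim_pos : 0 < d
  density : IsBoundedDensity f
  uniformContinuous : UniformContinuous f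
  sample : IsIIDSample P X f
  array : IsAdmissibleArray α h v
  kernel : IsBddIntegrable (multiD α K) B
  bias : ∀ ε : ℝ, 0 < ε → ∀ᶠ n in atTop, ∀ x,
    |v n * (meanEstimator α K f h n x - multiD α f x)| ≤ ε
  cumulant : ∀ u, Tendsto (fun n =>
    (∑ i ∈ Finset.Icc 1 n, h i ^ d * kerPhi (multiD α K) (u * kernelWeight α h v n i)) /
      speed α h v n) atTop (𝓝 (Λ u))

/-- The normalized deviation `v_n (∂^α f_n(x) - ∂^α f(x))`. -/
noncomputable def deviation {Ω : Type*} (X : ℕ → Ω → Rd d) (α : Fin d → ℕ) (K f : Rd d → ℝ)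
    (h v : ℕ → ℝ) (n : ℕ) (x : Rd d) (ω : Ω) : ℝ :=
  v n * (recEstimator α K h (fun i => X i ω) n x - multiD α f x)

namespace IsEstimationSetting

variable {Ω : Type*} [MeasurableSpace Ω] {P : Measure Ω} {X : ℕ → Ω → Rd d} {α : Fin d → ℕ}
  {K f : Rd d → ℝ} {h v : ℕ → ℝ} {B : ℝ} {Λ : ℝ → ℝ}

theorem speed_mul_deviation (S : IsEstimationSetting P X α K f h v B Λ) {n : ℕ} (hn : 1 ≤ n)
    (x : Rd d) (ω : Ω) : speed α h v n * deviation X α K f h v n x ω =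
      ∑ i ∈ Finset.Icc 1 n, kernelWeight α h v n i * multiD α K ((h i)⁻¹ • (x - X i ω)) -
        speed α h v n * v n * multiD α f x := by
  have hn0 : (0 : ℝ) < n := by exact_mod_cast hn
  have hvn := S.array.v_pos n hn
  rw [deviation, recEstimator, mul_sub, mul_sub, ← mul_assoc (speed α h v n) (v n), ← mul_assoc,
    Finset.mul_sum, ← mul_assoc]
  congr 1
  refine Finset.sum_congr rfl fun i hi => ?_
  have hhi := S.array.h_pos i (Finset.mem_Icc.1 hi).1
  rw [speed, kernelWeight]
  field_simp

theorem measurable_kernel_term (S : IsEstimationSetting P X α K f h v B Λ) (i : ℕ) (x : Rd d) :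
    Measurable fun y : Rd d => multiD α K ((h i)⁻¹ • (x - y)) :=
  S.kernel.measurable.comp (by fun_prop)

theorem measurable_deviation (S : IsEstimationSetting P X α K f h v B Λ) (n : ℕ) (x : Rd d) :
    Measurable (deviation X α K f h v n x) := by
  unfold deviation recEstimator
  refine Measurable.const_mul (Measurable.sub_const (Measurable.const_mul ?_ _) _) _
  refine Finset.measurable_fun_sum _ fun i hi => Measurable.const_mul ?_ _
  exact (S.measurable_kernel_term i x).comp (S.sample.measurable i (Finset.mem_Icc.1 hi).1)

theorem integral_exp_deviation [IsProbabilityMeasure P] (S : IsEstimationSetting P X α K f h v B Λ) {n : ℕ} (hn : 1 ≤ n)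
    (x : Rd d) (u : ℝ) :
    ∫ ω, Real.exp (u * (speed α h v n * deviation X α K f h v n x ω)) ∂P =
      Real.exp (-(u * (speed α h v n * v n * multiD α f x))) * ∏ i ∈ Finset.Icc 1 n,
        ∫ y, Real.exp (u * kernelWeight α h v n i * multiD α K ((h i)⁻¹ • (x - y))) * f y := by
  -- Independence is indexed from `0` while the sample starts at `X 1`, hence the shift `j + 1` and
  -- the passage from `Finset.Icc 1 n` to `Finset.range n`.
  have hind := (S.sample.indep.comp (fun (j : ℕ) (y : Rd d) => kernelWeight α h v n (j + 1) *
    multiD α K ((h (j + 1))⁻¹ • (x - y))) fun j => (S.measurable_kernel_term (j + 1) x).const_mul _)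
  have hm := hind.mgf_sum (t := u) (fun j => ((S.measurable_kernel_term (j + 1) x).const_mul _).comp
    (S.sample.measurable (j + 1) (by omega))) (Finset.range n)
  have e1 : ∀ ω, Real.exp (u * (speed α h v n * deviation X α K f h v n x ω)) =
      Real.exp (-(u * (speed α h v n * v n * multiD α f x))) * Real.exp (u *
        (∑ j ∈ Finset.range n, (fun (y : Rd d) => kernelWeight α h v n (j + 1) *
    multiD α K ((h (j + 1))⁻¹ • (x - y))) ∘ X (j + 1)) ω) := by
    intro ω
    rw [S.speed_mul_deviation hn, ← Real.exp_add, Finset.sum_Icc_one_eq_sum_range, Finset.sum_apply]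
    congr 1
    simp only [Function.comp_apply]
    ring
  simp only [e1]
  rw [integral_const_mul]
  congr 1
  have hprod : ∀ F : ℕ → ℝ, ∏ i ∈ Finset.Icc 1 n, F i = ∏ j ∈ Finset.range n, F (j + 1) := by
    intro F
    rw [show Finset.Icc 1 n = Finset.Ico 1 (n + 1) by ext; simp, Finset.prod_Ico_eq_prod_range]
    exact Finset.prod_congr (by simp) fun j _ => by rw [add_comm]
  refine Eq.trans hm ?_
  rw [hprod]
  refine Finset.prod_congr rfl fun j _ => ?_
  rw [mgf]
  simp only [Function.comp_apply]
  rw [integral_comp_sample S.density S.uniformContinuous.continuous.measurable S.sample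
    (i := j + 1) (by omega) (A := fun y => Real.exp (u * (kernelWeight α h v n (j + 1) *
    multiD α K ((h (j + 1))⁻¹ • (x - y))))) (((S.measurable_kernel_term (j + 1) x).const_mul _).const_mul u).exp]
  simp only [mul_assoc]

theorem integral_exp_term_pos (S : IsEstimationSetting P X α K f h v B Λ) (i : ℕ) (x : Rd d)
    (w : ℝ) : 0 < ∫ y, Real.exp (w * multiD α K ((h i)⁻¹ • (x - y))) * f y := by
  have hwk : ∀ z, |w * multiD α K z| ≤ |w| * B := fun z => by
    rw [abs_mul]; exact mul_le_mul_of_nonneg_left (S.kernel.bound z) (abs_nonneg _)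
  have hi := integrable_mul_of_bounded S.density.integrable
    ((S.measurable_kernel_term i x).const_mul w).exp (M := Real.exp (|w| * B)) fun y => by
      rw [abs_of_pos (Real.exp_pos _)]
      exact Real.exp_le_exp.2 ((le_abs_self _).trans (hwk _))
  calc 0 < Real.exp (-(|w| * B)) := Real.exp_pos _
    _ = ∫ y, Real.exp (-(|w| * B)) * f y := by
        rw [integral_const_mul, S.density.integral_eq_one, mul_one]
    _ ≤ _ := integral_mono (S.density.integrable.const_mul _) hi fun y =>
        mul_le_mul_of_nonneg_right (Real.exp_le_exp.2 (abs_le.1 (hwk _)).1) (S.density.nonneg y)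

theorem integral_exp_deviation_pos [IsProbabilityMeasure P] (S : IsEstimationSetting P X α K f h v B Λ) {n : ℕ}
    (hn : 1 ≤ n) (x : Rd d) (u : ℝ) :
    0 < ∫ ω, Real.exp (u * (speed α h v n * deviation X α K f h v n x ω)) ∂P := by
  rw [S.integral_exp_deviation hn]
  exact mul_pos (Real.exp_pos _) (Finset.prod_pos fun i _ => S.integral_exp_term_pos i x _)

/-- The integral is nonzero, whereas that of a nonintegrable function is `0` by convention. -/
theorem integrable_exp_deviation [IsProbabilityMeasure P] (S : IsEstimationSetting P X α K f h v B Λ) {n : ℕ}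
    (hn : 1 ≤ n) (x : Rd d) (u : ℝ) :
    Integrable (fun ω => Real.exp (u * (speed α h v n * deviation X α K f h v n x ω))) P :=
  Integrable.of_integral_ne_zero (S.integral_exp_deviation_pos hn x u).ne'

/-- The normalized cumulant generating functions converge uniformly in space. -/
theorem tendstoUniformly_log_mgf [IsProbabilityMeasure P] (S : IsEstimationSetting P X α K f h v B Λ) (u : ℝ) {ε : ℝ}
    (hε : 0 < ε) : ∀ᶠ n in atTop, ∀ x,
      |Real.log (∫ ω, Real.exp (u * (speed α h v n * deviation X α K f h v n x ω)) ∂P) -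
        speed α h v n * (f x * Λ u)| ≤ speed α h v n * ε := by
  obtain ⟨C, hfC⟩ := S.density.bounded
  have hC0 : 0 ≤ C := (S.density.nonneg 0).trans (hfC 0)
  have hfabs : ∀ x, |f x| ≤ C := fun x => by rw [abs_of_nonneg (S.density.nonneg x)]; exact hfC x
  obtain ⟨e, he, hex⟩ := exists_uniform_smoothing_error S.uniformContinuous hfabs
    S.kernel.integrable_sq (fun z => sq_nonneg _) S.array.h_tendsto S.array.h_pos
  obtain ⟨W, hW, hwt⟩ := S.array.weight_le
  set D := Real.exp (|u| * W * B) ^ 3 * C ^ 2 * (∫ z, |multiD α K z|) ^ 2 with hD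
  set D' := Real.exp (|u| * W * B) with hD'
  -- The relative error of the `i`-th term tends to zero with `i`, which is what `tendsto_weighted`
  -- needs to make the total error small against the speed.
  have herr : Tendsto (fun i => u ^ 2 * (D * h i ^ d + D' * e i)) atTop
      (𝓝 (u ^ 2 * (D * 0 ^ d + D' * 0))) :=
    (((S.array.h_tendsto.pow d).const_mul D).add (he.const_mul D')).const_mul _
  rw [zero_pow S.dim_pos.ne', mul_zero, mul_zero, add_zero, mul_zero] at herr
  have hT := S.array.tendsto_weighted herr
  have hcum := S.cumulant u
  filter_upwards [hwt, S.bias (ε / (3 * (|u| + 1))) (by positivity),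
    hT.eventually (gt_mem_nhds (show 0 < ε / 3 by positivity)),
    (Metric.tendsto_nhds.1 hcum) (ε / (3 * (C + 1))) (by positivity), eventually_ge_atTop 1]
    with n hw hbias hT hcum hn x
  have hsp := S.array.speed_pos hn
  have hvn := S.array.v_pos n hn
  have hn0 : (0 : ℝ) < n := by exact_mod_cast hn
  rw [S.integral_exp_deviation hn, Real.log_mul (Real.exp_pos _).ne'
    (Finset.prod_pos fun i _ => S.integral_exp_term_pos i x _).ne', Real.log_exp,
    Real.log_prod fun i _ => (S.integral_exp_term_pos i x _).ne']
  set T : ℕ → ℝ := fun i => Real.log (∫ y, Real.exp (u * kernelWeight α h v n i *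
    multiD α K ((h i)⁻¹ • (x - y))) * f y) with hTdef
  set mI : ℕ → ℝ := fun i => ∫ y, multiD α K ((h i)⁻¹ • (x - y)) * f y with hmI
  have hterm : ∀ i ∈ Finset.Icc 1 n, |T i - u * kernelWeight α h v n i * mI i -
      h i ^ d * (f x * kerPhi (multiD α K) (u * kernelWeight α h v n i))| ≤
      kernelWeight α h v n i ^ 2 * h i ^ d * (u ^ 2 * (D * h i ^ d + D' * e i)) := by
    intro i hi
    obtain ⟨hi1, hin⟩ := Finset.mem_Icc.1 hi
    have hwp := S.array.kernelWeight_pos hi1 hn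
    have := abs_log_mgf_term_le S.kernel S.density S.uniformContinuous.continuous.measurable hfC
      (S.array.h_pos i hi1) (w := u * kernelWeight α h v n i) (W := |u| * W) (by
        rw [abs_mul, abs_of_pos hwp]
        exact mul_le_mul_of_nonneg_left (hw i hi1 hin) (abs_nonneg u)) x (hex i x)
    refine this.trans (le_of_eq ?_)
    rw [hD, hD']; ring
  -- The linear terms add up to the mean estimator; with the deterministic centering only the bias
  -- remains.
  have hmean : ∑ i ∈ Finset.Icc 1 n, u * kernelWeight α h v n i * mI i =
      u * (speed α h v n * (v n * meanEstimator α K f h n x)) := by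
    rw [meanEstimator, Finset.mul_sum, Finset.mul_sum, Finset.mul_sum, Finset.mul_sum]
    refine Finset.sum_congr rfl fun i hi => ?_
    have hhi := S.array.h_pos i (Finset.mem_Icc.1 hi).1
    rw [hmI, speed, kernelWeight]
    field_simp
  have hsum : |∑ i ∈ Finset.Icc 1 n, T i - u * (speed α h v n * (v n * meanEstimator α K f h n x)) -
      f x * ∑ i ∈ Finset.Icc 1 n, h i ^ d * kerPhi (multiD α K) (u * kernelWeight α h v n i)| ≤
      speed α h v n * (ε / 3) := by
    rw [← hmean, Finset.mul_sum, ← Finset.sum_sub_distrib, ← Finset.sum_sub_distrib]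
    refine (Finset.abs_sum_le_sum_abs _ _).trans ?_
    refine (Finset.sum_le_sum fun i hi => ?_).trans (b := ∑ i ∈ Finset.Icc 1 n,
      kernelWeight α h v n i ^ 2 * h i ^ d * (u ^ 2 * (D * h i ^ d + D' * e i))) ?_
    · refine le_trans (le_of_eq ?_) (hterm i hi)
      congr 1; ring
    · rw [div_lt_iff₀ hsp] at hT
      linarith
  have hb := hbias x
  rw [Real.dist_eq] at hcum
  set Sn := ∑ i ∈ Finset.Icc 1 n, h i ^ d * kerPhi (multiD α K) (u * kernelWeight α h v n i)
  have hb2 : |u * (speed α h v n * (v n * (meanEstimator α K f h n x - multiD α f x)))| ≤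
      speed α h v n * (ε / 3) := by
    rw [abs_mul, abs_mul, abs_of_pos hsp]
    have : |u| * (ε / (3 * (|u| + 1))) ≤ ε / 3 := by
      rw [mul_div_assoc', div_le_div_iff₀ (by positivity) (by norm_num)]
      nlinarith [abs_nonneg u]
    calc _ ≤ |u| * (speed α h v n * (ε / (3 * (|u| + 1)))) := by gcongr
      _ = speed α h v n * (|u| * (ε / (3 * (|u| + 1)))) := by ring
      _ ≤ _ := by gcongr
  have hc2 : |f x * (Sn - speed α h v n * Λ u)| ≤ speed α h v n * (ε / 3) := by
    have e1 : Sn - speed α h v n * Λ u = speed α h v n * (Sn / speed α h v n - Λ u) := by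
      field_simp
    rw [e1, abs_mul, abs_mul, abs_of_pos hsp]
    have : C * (ε / (3 * (C + 1))) ≤ ε / 3 := by
      rw [mul_div_assoc', div_le_div_iff₀ (by positivity) (by norm_num)]
      nlinarith
    calc _ ≤ C * (speed α h v n * (ε / (3 * (C + 1)))) := by gcongr; exact hfabs x
      _ = speed α h v n * (C * (ε / (3 * (C + 1)))) := by ring
      _ ≤ _ := by gcongr
  have hfin : -(u * (speed α h v n * v n * multiD α f x)) + ∑ i ∈ Finset.Icc 1 n, T i -
      speed α h v n * (f x * Λ u) =
      (∑ i ∈ Finset.Icc 1 n, T i - u * (speed α h v n * (v n * meanEstimator α K f h n x)) -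
        f x * Sn) + u * (speed α h v n * (v n * (meanEstimator α K f h n x - multiD α f x))) +
        f x * (Sn - speed α h v n * Λ u) := by ring
  rw [hfin]
  refine (abs_add_three _ _ _).trans ?_
  linarith

end IsEstimationSetting

end

/-! ## A lower bound of Gärtner–Ellis type -/

/-- The exponential integral at `u` is split according to whether `Z n` is near `t`, above `t + η`
or below `t - η`. The outer parts are bounded by the integrals at `u ± r`, and differentiability of
`L` at `u` makes them exponentially smaller than the whole. Thus at least half of the mass sits near
`t`, inside the event. No convexity is used. -/
theorem exp_neg_le_measureReal_of_log_mgf {Ω : Type*} [MeasurableSpace Ω] {P : Measure Ω}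
    [IsProbabilityMeasure P] {s : ℕ → ℝ} (hs : Tendsto s atTop atTop) {Z : ℕ → Ω → ℝ}
    (hZ : ∀ n, Measurable (Z n))
    (hint : ∀ᶠ n in atTop, ∀ w, Integrable (fun ω => Real.exp (w * (s n * Z n ω))) P)
    (hpos : ∀ᶠ n in atTop, ∀ w, 0 < ∫ ω, Real.exp (w * (s n * Z n ω)) ∂P) {L : ℝ → ℝ}
    (hL : ∀ w ε : ℝ, 0 < ε → ∀ᶠ n in atTop,
      |Real.log (∫ ω, Real.exp (w * (s n * Z n ω)) ∂P) - s n * L w| ≤ s n * ε)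
    {u t δ : ℝ} (hd : HasDerivAt L t u) (ht : δ < t) {ε : ℝ} (hε : 0 < ε) :
    ∀ᶠ n in atTop, Real.exp (-(s n * (u * t - L u + ε))) ≤ P.real {ω | δ ≤ Z n ω} := by
  -- The window around `t` of radius `η` lies in `{δ ≤ Z n}`, and on it the exponent deviates from
  -- `u * t` by at most `ε/2`.
  set η := min (t - δ) (ε / (2 * (|u| + 1))) with hη
  have hη0 : 0 < η := lt_min (by linarith) (by positivity)
  have hηδ : η ≤ t - δ := min_le_left _ _
  have hηu : |u| * η ≤ ε / 2 := by
    have h1 : η ≤ ε / (2 * (|u| + 1)) := min_le_right _ _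
    rw [le_div_iff₀ (by positivity)] at h1
    nlinarith [abs_nonneg u]
  obtain ⟨r, hr0, hr⟩ : ∃ r > 0, L (u + r) ≤ L u + r * t + r * (η / 2) ∧
      L (u - r) ≤ L u - r * t + r * (η / 2) := by
    have h1 := hd.isLittleO.def (show 0 < η / 2 by positivity)
    obtain ⟨ρ, hρ, hball⟩ := Metric.eventually_nhds_iff.1 h1
    refine ⟨ρ / 2, by positivity, ?_, ?_⟩
    · have := hball (y := u + ρ / 2) (by rw [Real.dist_eq, add_sub_cancel_left, abs_of_pos (by positivity)]; linarith)
      rw [add_sub_cancel_left, Real.norm_eq_abs, Real.norm_eq_abs, abs_of_pos (show 0 < ρ / 2 by positivity)] at this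
      have := (abs_le.1 this).2
      simp only [smul_eq_mul] at this
      linarith
    · have := hball (y := u - ρ / 2) (by rw [Real.dist_eq, sub_sub_cancel_left, abs_neg, abs_of_pos (by positivity)]; linarith)
      rw [sub_sub_cancel_left, Real.norm_eq_abs, Real.norm_eq_abs, abs_neg, abs_of_pos (show 0 < ρ / 2 by positivity)] at this
      have := (abs_le.1 this).2
      simp only [smul_eq_mul] at this
      linarith
  -- Tolerance for the log-integrals. Each outer part gains `r * η / 2`: two tolerances use half of
  -- it, and `log 4` uses the rest once `s n` is large.
  set κ := min (r * η / 8) (ε / 8) with hκ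
  have hκ0 : 0 < κ := lt_min (by positivity) (by positivity)
  have hκ1 : κ ≤ r * η / 8 := min_le_left _ _
  have hκ2 : κ ≤ ε / 8 := min_le_right _ _
  have hs1 : ∀ᶠ n in atTop, Real.log 4 ≤ s n * (r * η / 4) :=
    (hs.atTop_mul_const (show 0 < r * η / 4 by positivity)).eventually_ge_atTop _
  have hs2 : ∀ᶠ n in atTop, Real.log 2 ≤ s n * (ε / 8) :=
    (hs.atTop_mul_const (show 0 < ε / 8 by positivity)).eventually_ge_atTop _
  filter_upwards [hint, hpos, hL u κ hκ0, hL (u + r) κ hκ0, hL (u - r) κ hκ0, hs1, hs2,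
    hs.eventually_gt_atTop 0] with n hint hpos h1 h2 h3 hs1 hs2 hsn
  have m1 : Real.exp (s n * (L u - κ)) ≤ ∫ ω, Real.exp (u * (s n * Z n ω)) ∂P := by
    rw [← Real.le_log_iff_exp_le (hpos u)]
    have := (abs_le.1 h1).1; linarith
  have m2 : ∫ ω, Real.exp ((u + r) * (s n * Z n ω)) ∂P ≤ Real.exp (s n * (L (u + r) + κ)) := by
    rw [← Real.log_le_iff_le_exp (hpos _)]
    have := (abs_le.1 h2).2; linarith
  have m3 : ∫ ω, Real.exp ((u - r) * (s n * Z n ω)) ∂P ≤ Real.exp (s n * (L (u - r) + κ)) := by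
    rw [← Real.log_le_iff_le_exp (hpos _)]
    have := (abs_le.1 h3).2; linarith
  set A : Set Ω := {ω | δ ≤ Z n ω} with hA
  have hAm : MeasurableSet A := measurableSet_le measurable_const (hZ n)
  have hpt : ∀ ω, Real.exp (u * (s n * Z n ω)) ≤
      A.indicator (fun _ => Real.exp (s n * (u * t + |u| * η))) ω +
      Real.exp (-(r * (s n * (t + η)))) * Real.exp ((u + r) * (s n * Z n ω)) +
      Real.exp (r * (s n * (t - η))) * Real.exp ((u - r) * (s n * Z n ω)) := by
    intro ω
    have i1 : 0 ≤ A.indicator (fun _ => Real.exp (s n * (u * t + |u| * η))) ω :=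
      Set.indicator_nonneg (fun _ _ => (Real.exp_pos _).le) ω
    rw [← Real.exp_add, ← Real.exp_add]
    have e2 := (Real.exp_pos (-(r * (s n * (t + η))) + (u + r) * (s n * Z n ω))).le
    have e3 := (Real.exp_pos (r * (s n * (t - η)) + (u - r) * (s n * Z n ω))).le
    rcases le_or_gt (t + η) (Z n ω) with hz | hz
    · have : Real.exp (u * (s n * Z n ω)) ≤
          Real.exp (-(r * (s n * (t + η))) + (u + r) * (s n * Z n ω)) := by
        apply Real.exp_le_exp.2
        have : r * (s n * (t + η)) ≤ r * (s n * Z n ω) := by gcongr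
        linarith
      linarith
    rcases le_or_gt (Z n ω) (t - η) with hz2 | hz2
    · have : Real.exp (u * (s n * Z n ω)) ≤
          Real.exp (r * (s n * (t - η)) + (u - r) * (s n * Z n ω)) := by
        apply Real.exp_le_exp.2
        have : r * (s n * Z n ω) ≤ r * (s n * (t - η)) := by gcongr
        linarith
      linarith
    · rw [Set.indicator_of_mem (show ω ∈ A by
        change δ ≤ Z n ω; linarith)]
      have : Real.exp (u * (s n * Z n ω)) ≤ Real.exp (s n * (u * t + |u| * η)) := by
        apply Real.exp_le_exp.2
        have h5 : u * (Z n ω - t) ≤ |u| * η := by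
          refine (le_abs_self _).trans ?_
          rw [abs_mul]
          exact mul_le_mul_of_nonneg_left (abs_le.2 ⟨by linarith, by linarith⟩) (abs_nonneg u)
        have h6 : u * Z n ω ≤ u * t + |u| * η := by linarith
        calc u * (s n * Z n ω) = s n * (u * Z n ω) := by ring
          _ ≤ _ := by gcongr
      linarith
  have hI : Integrable (A.indicator fun _ => Real.exp (s n * (u * t + |u| * η))) P :=
    (integrable_const _).indicator hAm
  have hle := integral_mono (hint u) ((hI.add ((hint (u + r)).const_mul _)).add
    ((hint (u - r)).const_mul _)) hpt
  have hle2 : ∫ ω, Real.exp (u * (s n * Z n ω)) ∂P ≤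
      P.real A * Real.exp (s n * (u * t + |u| * η)) +
      Real.exp (-(r * (s n * (t + η)))) * ∫ ω, Real.exp ((u + r) * (s n * Z n ω)) ∂P +
      Real.exp (r * (s n * (t - η))) * ∫ ω, Real.exp ((u - r) * (s n * Z n ω)) ∂P := by
    refine hle.trans (le_of_eq ?_)
    rw [integral_add' (hI.add ((hint (u + r)).const_mul _)) ((hint (u - r)).const_mul _),
      integral_add' hI ((hint (u + r)).const_mul _), integral_const_mul, integral_const_mul,
      integral_indicator_const _ hAm, smul_eq_mul]
  -- Each outer part is at most a quarter of the lower bound `m1`, which leaves half of it for the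
  -- window.
  have b2 : Real.exp (-(r * (s n * (t + η)))) * ∫ ω, Real.exp ((u + r) * (s n * Z n ω)) ∂P ≤
      Real.exp (s n * (L u - κ)) / 4 := by
    refine (mul_le_mul_of_nonneg_left m2 (Real.exp_pos _).le).trans ?_
    rw [← Real.exp_add, le_div_iff₀ (by norm_num)]
    rw [show (4 : ℝ) = Real.exp (Real.log 4) by rw [Real.exp_log]; norm_num, ← Real.exp_add]
    apply Real.exp_le_exp.2
    have : s n * (L (u + r) + κ) ≤ s n * (L u + r * t + r * (η / 2) + κ) := by
      gcongr; exact hr.1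
    have : s n * κ ≤ s n * (r * η / 8) := by gcongr
    linarith
  have b3 : Real.exp (r * (s n * (t - η))) * ∫ ω, Real.exp ((u - r) * (s n * Z n ω)) ∂P ≤
      Real.exp (s n * (L u - κ)) / 4 := by
    refine (mul_le_mul_of_nonneg_left m3 (Real.exp_pos _).le).trans ?_
    rw [← Real.exp_add, le_div_iff₀ (by norm_num)]
    rw [show (4 : ℝ) = Real.exp (Real.log 4) by rw [Real.exp_log]; norm_num, ← Real.exp_add]
    apply Real.exp_le_exp.2
    have : s n * (L (u - r) + κ) ≤ s n * (L u - r * t + r * (η / 2) + κ) := by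
      gcongr; exact hr.2
    have : s n * κ ≤ s n * (r * η / 8) := by gcongr
    linarith
  have hfin : Real.exp (s n * (L u - κ)) / 2 ≤ P.real A * Real.exp (s n * (u * t + |u| * η)) := by
    linarith
  have : Real.exp (s n * (L u - κ)) / 2 * Real.exp (-(s n * (u * t + |u| * η))) ≤ P.real A := by
    rw [Real.exp_neg, ← div_eq_mul_inv, div_le_iff₀ (Real.exp_pos _)]
    exact hfin
  refine le_trans ?_ this
  rw [div_mul_eq_mul_div, le_div_iff₀ (by norm_num), ← Real.exp_add]
  rw [show (2 : ℝ) = Real.exp (Real.log 2) by rw [Real.exp_log]; norm_num, ← Real.exp_add]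
  apply Real.exp_le_exp.2
  have h7 : s n * κ ≤ s n * (ε / 8) := by gcongr
  have h8 : s n * (|u| * η) ≤ s n * (ε / 2) := by gcongr
  nlinarith

/-! ## Subexponential sequences -/

/-- `E` is eventually nonnegative and `E n ≤ e^{c s n}` eventually, for every `c > 0`. -/
def IsSubexp (s E : ℕ → ℝ) : Prop :=
  (∀ᶠ n in atTop, 0 ≤ E n) ∧ ∀ c : ℝ, 0 < c → ∀ᶠ n in atTop, E n ≤ Real.exp (c * s n)

namespace IsSubexp

variable {s E F : ℕ → ℝ}

theorem const (hs : Tendsto s atTop atTop) {C : ℝ} (hC : 0 ≤ C) : IsSubexp s fun _ => C :=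
  ⟨Eventually.of_forall fun _ => hC, fun c hc => by
    filter_upwards [(hs.const_mul_atTop hc).eventually_ge_atTop C] with n hn
    linarith [Real.add_one_le_exp (c * s n)]⟩

theorem of_log (hs : ∀ᶠ n in atTop, 0 < s n) (hE : ∀ᶠ n in atTop, 0 < E n)
    (h : Tendsto (fun n => Real.log (E n) / s n) atTop (𝓝 0)) : IsSubexp s E :=
  ⟨hE.mono fun _ h => h.le, fun c hc => by
    filter_upwards [hs, hE, h.eventually (gt_mem_nhds hc)] with n hs hE h
    rw [div_lt_iff₀ hs] at h
    rw [← Real.log_le_iff_le_exp hE]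
    exact h.le⟩

theorem mul (hE : IsSubexp s E) (hF : IsSubexp s F) : IsSubexp s fun n => E n * F n :=
  ⟨by filter_upwards [hE.1, hF.1] with n h1 h2 using mul_nonneg h1 h2, fun c hc => by
    filter_upwards [hF.1, hE.2 (c / 2) (by positivity), hF.2 (c / 2) (by positivity)] with n h0 h1 h2
    calc E n * F n ≤ Real.exp (c / 2 * s n) * Real.exp (c / 2 * s n) :=
          mul_le_mul h1 h2 h0 (Real.exp_pos _).le
      _ = Real.exp (c * s n) := by rw [← Real.exp_add]; congr 1; ring⟩

theorem add (hs : Tendsto s atTop atTop) (hE : IsSubexp s E) (hF : IsSubexp s F) :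
    IsSubexp s fun n => E n + F n :=
  ⟨by filter_upwards [hE.1, hF.1] with n h1 h2 using add_nonneg h1 h2, fun c hc => by
    filter_upwards [hE.2 (c / 2) (by positivity), hF.2 (c / 2) (by positivity),
      (const hs (C := 2) (by norm_num)).2 (c / 2) (by positivity)] with n h1 h2 h3
    calc E n + F n ≤ 2 * Real.exp (c / 2 * s n) := by linarith
      _ ≤ Real.exp (c / 2 * s n) * Real.exp (c / 2 * s n) := by gcongr
      _ = Real.exp (c * s n) := by rw [← Real.exp_add]; congr 1; ring⟩

theorem rpow (hE : IsSubexp s E) {p : ℝ} (hp : 0 < p) : IsSubexp s fun n => E n ^ p :=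
  ⟨by filter_upwards [hE.1] with n h1 using Real.rpow_nonneg h1 p, fun c hc => by
    filter_upwards [hE.1, hE.2 (c / p) (by positivity)] with n h0 h1
    calc E n ^ p ≤ Real.exp (c / p * s n) ^ p := Real.rpow_le_rpow h0 h1 hp.le
      _ = Real.exp (c * s n) := by rw [← Real.exp_mul]; congr 1; field_simp⟩

theorem pow (hs : Tendsto s atTop atTop) (hE : IsSubexp s E) (p : ℕ) : IsSubexp s fun n => E n ^ p := by
  induction p with
  | zero => simpa using const hs zero_le_one
  | succ p ih => simpa only [pow_succ] using ih.mul hE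

/-- A subexponential sequence times an exponentially small one tends to zero. -/
theorem eventually_mul_exp_neg_le (hs : Tendsto s atTop atTop) (hE : IsSubexp s E) {b ε : ℝ}
    (hb : 0 < b) (hε : 0 < ε) : ∀ᶠ n in atTop, E n * Real.exp (-(b * s n)) ≤ ε := by
  have h := hE.mul (const hs (inv_nonneg.2 hε.le))
  filter_upwards [h.2 b hb] with n hn
  rw [Real.exp_neg, ← div_eq_mul_inv, div_le_iff₀ (Real.exp_pos _)]
  rw [← div_eq_mul_inv, div_le_iff₀ hε] at hn
  linarith

end IsSubexp

/-! ## Coverings -/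

/-- One point of `U` is chosen in every cube of side `s` that meets `U`. The centres must lie in
`U`, because the Chernoff bound involves the supremum of `f` over `U` only. -/
theorem exists_finset_cover {d : ℕ} (U : Set (Rd d)) {w s : ℝ} (hw : 0 ≤ w) (hs : 0 < s) :
    ∃ T : Finset (Rd d), ↑T ⊆ U ∧ (T.card : ℝ) ≤ (2 * w / s + 5) ^ d ∧
      ∀ x ∈ U, ‖x‖ ≤ w → ∃ c ∈ T, ‖x - c‖ ≤ d * s := by
  classical
  set m : ℤ := ⌈w / s⌉ + 1 with hm
  set cells : Finset (Fin d → ℤ) := Fintype.piFinset fun _ => Finset.Icc (-m) m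
  let cell : Rd d → Fin d → ℤ := fun x j => ⌊x j / s⌋
  let pick : (Fin d → ℤ) → Rd d := fun z =>
    if hz : ∃ x ∈ U, cell x = z then hz.choose else 0
  have hpick : ∀ z, (∃ x ∈ U, cell x = z) → pick z ∈ U ∧ cell (pick z) = z := fun z hz => by
    simp only [pick, dif_pos hz]
    exact hz.choose_spec
  refine ⟨(cells.filter fun z => ∃ x ∈ U, cell x = z).image pick, ?_, ?_, fun x hx hxw => ?_⟩
  · intro y hy
    obtain ⟨z, hz, rfl⟩ := Finset.mem_image.1 (Finset.mem_coe.1 hy)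
    exact (hpick z (Finset.mem_filter.1 hz).2).1
  · have h1 : ((cells.filter fun z => ∃ x ∈ U, cell x = z).image pick).card ≤ cells.card :=
      Finset.card_image_le.trans (Finset.card_filter_le _ _)
    have hm0 : 0 ≤ w / s := by positivity
    have hm1 : (m : ℝ) ≤ w / s + 2 := by
      rw [hm]; push_cast
      linarith [(Int.ceil_lt_add_one (w / s)).le]
    have hmn : 0 ≤ m := by
      have : 0 ≤ ⌈w / s⌉ := Int.ceil_nonneg hm0
      omega
    have h2 : cells.card = (2 * m + 1).toNat ^ d := by
      simp only [cells, Fintype.card_piFinset, Int.card_Icc, Finset.prod_const, Finset.card_univ,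
        Fintype.card_fin]
      congr 2; ring
    calc (((cells.filter fun z => ∃ x ∈ U, cell x = z).image pick).card : ℝ) ≤ cells.card := by
          exact_mod_cast h1
      _ = ((2 * m + 1).toNat : ℝ) ^ d := by rw [h2]; push_cast; rfl
      _ ≤ _ := by
          gcongr
          have : (((2 * m + 1).toNat : ℤ) : ℝ) = 2 * m + 1 := by
            rw [Int.toNat_of_nonneg (by omega)]; push_cast; rfl
          rw [← Int.cast_natCast, this]
          have : 2 * w / s = 2 * (w / s) := by ring
          rw [this]; linarith
  · have hmem : cell x ∈ cells := by
      refine Fintype.mem_piFinset.2 fun j => Finset.mem_Icc.2 ?_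
      have hj : |x j| ≤ w := by
        have := PiLp.norm_apply_le x j
        rw [Real.norm_eq_abs] at this
        exact this.trans hxw
      obtain ⟨h1, h2⟩ := abs_le.1 hj
      constructor
      · rw [Int.le_floor, le_div_iff₀ hs, hm]
        push_cast
        have := Int.le_ceil (w / s)
        rw [div_le_iff₀ hs] at this
        nlinarith
      · have h3 : x j / s ≤ w / s := by gcongr
        have h4 : ⌊x j / s⌋ ≤ ⌈w / s⌉ := by
          have h5 : (⌊x j / s⌋ : ℝ) ≤ ⌈w / s⌉ := (Int.floor_le _).trans (h3.trans (Int.le_ceil _))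
          exact_mod_cast h5
        change ⌊x j / s⌋ ≤ m
        omega
    have hex : ∃ y ∈ U, cell y = cell x := ⟨x, hx, rfl⟩
    refine ⟨pick (cell x), Finset.mem_image.2 ⟨cell x, Finset.mem_filter.2 ⟨hmem, hex⟩, rfl⟩, ?_⟩
    have hc := (hpick _ hex).2
    set y := pick (cell x)
    have hcoord : ∀ j, |x j - y j| ≤ s := by
      intro j
      have h1 : ⌊y j / s⌋ = ⌊x j / s⌋ := congrFun hc j
      have h2 := Int.abs_sub_lt_one_of_floor_eq_floor h1.symm
      rw [← sub_div, abs_div, abs_of_pos hs, div_lt_one hs] at h2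
      exact h2.le
    calc ‖x - y‖ ≤ ∑ j, ‖(x - y) j‖ := by
          rw [EuclideanSpace.norm_eq]
          have h1 : ∑ j, ‖(x - y) j‖ ^ 2 ≤ (∑ j, ‖(x - y) j‖) ^ 2 :=
            Finset.sum_sq_le_sq_sum_of_nonneg fun j _ => norm_nonneg _
          calc _ ≤ √((∑ j, ‖(x - y) j‖) ^ 2) := Real.sqrt_le_sqrt h1
            _ = _ := Real.sqrt_sq (Finset.sum_nonneg fun _ _ => norm_nonneg _)
      _ ≤ ∑ _j : Fin d, s := Finset.sum_le_sum fun j _ => by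
          rw [PiLp.sub_apply, Real.norm_eq_abs]; exact hcoord j
      _ = d * s := by simp

/-! ## The upper bound -/

theorem abs_average_le {n : ℕ} {F : ℕ → ℝ} {M : ℝ} (hM : 0 ≤ M)
    (hF : ∀ i ∈ Finset.Icc 1 n, |F i| ≤ M) : |(1 / (n : ℝ)) * ∑ i ∈ Finset.Icc 1 n, F i| ≤ M := by
  rcases Nat.eq_zero_or_pos n with rfl | hn
  · simpa using hM
  have hn0 : (0 : ℝ) < n := by exact_mod_cast hn
  rw [abs_mul, abs_of_pos (by positivity), one_div, inv_mul_le_iff₀ hn0]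
  refine (Finset.abs_sum_le_sum_abs _ _).trans ((Finset.sum_le_sum hF).trans ?_)
  simp

section

variable {d : ℕ}

/-- Markov's inequality for `‖X i‖ ^ ξ`, written with the density. -/
theorem measureReal_norm_gt_le {Ω : Type*} [MeasurableSpace Ω] {P : Measure Ω}
    [IsProbabilityMeasure P] {X : ℕ → Ω → Rd d} {f : Rd d → ℝ} (hf : IsBoundedDensity f)
    (hfm : Measurable f) (hX : IsIIDSample P X f) {ξ : ℝ} (hξ : 0 < ξ)
    (hmoment : Integrable (fun x : Rd d => ‖x‖ ^ ξ * f x)) {i : ℕ} (hi : 1 ≤ i) {R : ℝ} (hR : 0 < R) :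
    P.real {ω | R < ‖X i ω‖} ≤ R ^ (-ξ) * ∫ x, ‖x‖ ^ ξ * f x := by
  have hs : MeasurableSet {y : Rd d | R < ‖y‖} := measurableSet_lt measurable_const measurable_norm
  have hXm := hX.measurable i hi
  have e : P.real {ω | R < ‖X i ω‖} = ∫ ω, {y : Rd d | R < ‖y‖}.indicator (fun _ => (1 : ℝ)) (X i ω) ∂P := by
    have h1 : (fun ω => {y : Rd d | R < ‖y‖}.indicator (fun _ => (1 : ℝ)) (X i ω)) =
        (X i ⁻¹' {y : Rd d | R < ‖y‖}).indicator fun _ => (1 : ℝ) := by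
      funext ω; simp [Set.indicator]
    rw [h1, integral_indicator_const _ (hXm hs)]
    simp only [smul_eq_mul, mul_one]
    rfl
  rw [e, integral_comp_sample hf hfm hX hi (measurable_const.indicator hs), ← integral_const_mul]
  refine integral_mono (integrable_mul_of_bounded hf.integrable (measurable_const.indicator hs)
    (M := 1) fun y => ?_) (hmoment.const_mul _) fun y => ?_
  · by_cases hy : y ∈ {y : Rd d | R < ‖y‖} <;> simp [Set.indicator, hy]
  · have hfy := hf.nonneg y
    simp only
    by_cases hy : y ∈ {y : Rd d | R < ‖y‖}
    · rw [Set.indicator_of_mem hy, ← mul_assoc]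
      refine mul_le_mul_of_nonneg_right ?_ hfy
      rw [Real.rpow_neg hR.le, inv_mul_eq_div, one_le_div (by positivity)]
      exact Real.rpow_le_rpow hR.le (le_of_lt hy) hξ.le
    · rw [Set.indicator_of_notMem hy, zero_mul]
      positivity

namespace IsEstimationSetting

variable {Ω : Type*} [MeasurableSpace Ω] {P : Measure Ω} {X : ℕ → Ω → Rd d} {α : Fin d → ℕ}
  {K f : Rd d → ℝ} {h v : ℕ → ℝ} {B : ℝ} {Λ : ℝ → ℝ}

/-- Chernoff's bound, uniformly over the points of `U`. -/
theorem eventually_measureReal_le [IsProbabilityMeasure P]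
    (S : IsEstimationSetting P X α K f h v B Λ) (hΛ : ∀ u, 0 ≤ Λ u) {U : Set (Rd d)} {F : ℝ}
    (hF : ∀ x ∈ U, f x ≤ F) {u ς δ J : ℝ} (hu : 0 ≤ u) (hJ : J < u * δ - F * Λ (ς * u)) :
    ∀ᶠ n in atTop, ∀ x ∈ U,
      P.real {ω | δ ≤ ς * deviation X α K f h v n x ω} ≤ Real.exp (-(speed α h v n * J)) := by
  have hε : 0 < u * δ - F * Λ (ς * u) - J := by linarith
  filter_upwards [S.tendstoUniformly_log_mgf (ς * u) hε, eventually_ge_atTop 1] with n hn hn1 x hx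
  have hsp := S.array.speed_pos hn1
  have hint := S.integrable_exp_deviation hn1 x (ς * u)
  have e : ∀ ω, ς * u * (speed α h v n * deviation X α K f h v n x ω) =
      u * speed α h v n * (ς * deviation X α K f h v n x ω) := fun ω => by ring
  have hpos := S.integral_exp_deviation_pos hn1 x (ς * u)
  have h1 := hn x
  simp only [e] at hint hpos h1
  have h2 := measure_ge_le_exp_mul_mgf (μ := P) (X := fun ω => ς * deviation X α K f h v n x ω) δ
    (t := u * speed α h v n) (by positivity) hint
  refine h2.trans ?_
  rw [mgf]
  have h3 : ∫ ω, Real.exp (u * speed α h v n * (ς * deviation X α K f h v n x ω)) ∂P ≤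
      Real.exp (speed α h v n * (F * Λ (ς * u)) + speed α h v n * (u * δ - F * Λ (ς * u) - J)) := by
    rw [← Real.log_le_iff_le_exp hpos]
    have := (abs_le.1 h1).2
    have h4 : speed α h v n * (f x * Λ (ς * u)) ≤ speed α h v n * (F * Λ (ς * u)) := by
      have := hΛ (ς * u)
      have := hF x hx
      gcongr
    linarith
  refine (mul_le_mul_of_nonneg_left h3 (Real.exp_pos _).le).trans ?_
  rw [← Real.exp_add]
  apply Real.exp_le_exp.2
  apply le_of_eq; ring

/-- `H` dominates all inverse bandwidths. Its additional power absorbs the scaling `(h i)⁻¹ ^ r` of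
the Hölder bound, as `r ≤ 1 ≤ H`. -/
theorem abs_recEstimator_sub_le {CH r H : ℝ} (hr : 0 < r) (hr1 : r ≤ 1)
    (hol : ∀ a b, |multiD α K a - multiD α K b| ≤ CH * ‖a - b‖ ^ r) (hCH : 0 ≤ CH) {n : ℕ}
    (hpos : ∀ n, 1 ≤ n → 0 < h n) (hH1 : 1 ≤ H)
    (hH : ∀ i, 1 ≤ i → i ≤ n → (h i)⁻¹ ≤ H) (Y : ℕ → Rd d) (x y : Rd d) :
    |recEstimator α K h Y n x - recEstimator α K h Y n y| ≤
      H ^ (d + multiLen α + 1) * (CH * ‖x - y‖ ^ r) := by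
  rw [recEstimator, recEstimator, ← mul_sub, ← Finset.sum_sub_distrib]
  refine abs_average_le (by positivity) fun i hi => ?_
  obtain ⟨hi1, hin⟩ := Finset.mem_Icc.1 hi
  have hhi := hpos i hi1
  have h1 : 1 / h i ^ (d + multiLen α) ≤ H ^ (d + multiLen α) := by
    rw [one_div, ← inv_pow]; exact pow_le_pow_left₀ (by positivity) (hH i hi1 hin) _
  have h2 : |multiD α K ((h i)⁻¹ • (x - Y i)) - multiD α K ((h i)⁻¹ • (y - Y i))| ≤
      H * (CH * ‖x - y‖ ^ r) := by
    refine (hol _ _).trans ?_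
    rw [← smul_sub, sub_sub_sub_cancel_right, norm_smul, Real.norm_eq_abs, abs_of_pos (by positivity),
      Real.mul_rpow (by positivity) (norm_nonneg _)]
    have h3 : (h i)⁻¹ ^ r ≤ H := by
      calc (h i)⁻¹ ^ r ≤ H ^ r := Real.rpow_le_rpow (by positivity) (hH i hi1 hin) hr.le
        _ ≤ H ^ (1 : ℝ) := Real.rpow_le_rpow_of_exponent_le hH1 hr1
        _ = H := Real.rpow_one H
    calc CH * ((h i)⁻¹ ^ r * ‖x - y‖ ^ r) ≤ CH * (H * ‖x - y‖ ^ r) := by gcongr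
      _ = _ := by ring
  rw [← mul_sub, abs_mul, abs_of_pos (by positivity), pow_succ, mul_assoc]
  exact mul_le_mul h1 h2 (abs_nonneg _) (by positivity)

/-- Together with the uniform smallness of the bias, this controls the increments of `v_n ∂^α f`
without any quantitative modulus of continuity for `∂^α f`. -/
theorem abs_meanEstimator_sub_le (S : IsEstimationSetting P X α K f h v B Λ)
    {CH r H : ℝ} (hr : 0 < r) (hr1 : r ≤ 1)
    (hol : ∀ a b, |multiD α K a - multiD α K b| ≤ CH * ‖a - b‖ ^ r) (hCH : 0 ≤ CH) {n : ℕ}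
    (hH1 : 1 ≤ H) (hH : ∀ i, 1 ≤ i → i ≤ n → (h i)⁻¹ ≤ H) (x y : Rd d) :
    |meanEstimator α K f h n x - meanEstimator α K f h n y| ≤
      H ^ (d + multiLen α + 1) * (CH * ‖x - y‖ ^ r) := by
  have hint : ∀ i x, Integrable fun z => multiD α K ((h i)⁻¹ • (x - z)) * f z := fun i x =>
    integrable_mul_of_bounded S.density.integrable (S.measurable_kernel_term i x)
      fun z => S.kernel.bound _
  rw [meanEstimator, meanEstimator, ← mul_sub, ← Finset.sum_sub_distrib]
  refine abs_average_le (by positivity) fun i hi => ?_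
  obtain ⟨hi1, hin⟩ := Finset.mem_Icc.1 hi
  have hhi := S.array.h_pos i hi1
  have h1 : 1 / h i ^ (d + multiLen α) ≤ H ^ (d + multiLen α) := by
    rw [one_div, ← inv_pow]; exact pow_le_pow_left₀ (by positivity) (hH i hi1 hin) _
  have h2 : ∀ z, |multiD α K ((h i)⁻¹ • (x - z)) - multiD α K ((h i)⁻¹ • (y - z))| ≤
      H * (CH * ‖x - y‖ ^ r) := fun z => by
    refine (hol _ _).trans ?_
    rw [← smul_sub, sub_sub_sub_cancel_right, norm_smul, Real.norm_eq_abs, abs_of_pos (by positivity),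
      Real.mul_rpow (by positivity) (norm_nonneg _)]
    have h3 : (h i)⁻¹ ^ r ≤ H := by
      calc (h i)⁻¹ ^ r ≤ H ^ r := Real.rpow_le_rpow (by positivity) (hH i hi1 hin) hr.le
        _ ≤ H ^ (1 : ℝ) := Real.rpow_le_rpow_of_exponent_le hH1 hr1
        _ = H := Real.rpow_one H
    calc CH * ((h i)⁻¹ ^ r * ‖x - y‖ ^ r) ≤ CH * (H * ‖x - y‖ ^ r) := by gcongr
      _ = _ := by ring
  have h4 : |(∫ z, multiD α K ((h i)⁻¹ • (x - z)) * f z) -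
      ∫ z, multiD α K ((h i)⁻¹ • (y - z)) * f z| ≤ H * (CH * ‖x - y‖ ^ r) := by
    rw [← integral_sub (hint i x) (hint i y)]
    refine abs_integral_le_integral_abs.trans ?_
    calc _ ≤ ∫ z, H * (CH * ‖x - y‖ ^ r) * f z := by
          refine integral_mono ((hint i x).sub (hint i y)).abs (S.density.integrable.const_mul _)
            fun z => ?_
          simp only
          rw [← sub_mul, abs_mul, abs_of_nonneg (S.density.nonneg z)]
          exact mul_le_mul_of_nonneg_right (h2 z) (S.density.nonneg z)
      _ = _ := by rw [integral_const_mul, S.density.integral_eq_one, mul_one]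
  rw [← mul_sub, abs_mul, abs_of_pos (by positivity), pow_succ, mul_assoc]
  exact mul_le_mul h1 h4 (abs_nonneg _) (by positivity)

/-- Far from the sample the estimator is small. -/
theorem abs_recEstimator_le_of_far {γ Cγ H Hm R : ℝ} (hγ : 0 < γ)
    (hdec : ∀ z, |‖z‖ ^ γ * multiD α K z| ≤ Cγ) {n : ℕ} (hpos : ∀ n, 1 ≤ n → 0 < h n)
    (hH1 : 1 ≤ H) (hH : ∀ i, 1 ≤ i → i ≤ n → (h i)⁻¹ ≤ H) (hHm : ∀ i, 1 ≤ i → h i ≤ Hm)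
    (hR : 0 < R) (Y : ℕ → Rd d) (x : Rd d) (hx : ∀ i ∈ Finset.Icc 1 n, R ≤ ‖x - Y i‖) :
    |recEstimator α K h Y n x| ≤ H ^ (d + multiLen α + 1) * (Cγ * (Hm / R) ^ γ) := by
  have hCγ : 0 ≤ Cγ := (abs_nonneg _).trans (hdec 0)
  have hHm0 : 0 < Hm := (hpos 1 le_rfl).trans_le (hHm 1 le_rfl)
  refine abs_average_le (by positivity) fun i hi => ?_
  obtain ⟨hi1, hin⟩ := Finset.mem_Icc.1 hi
  have hhi := hpos i hi1
  have h1 : 1 / h i ^ (d + multiLen α) ≤ H ^ (d + multiLen α + 1) := by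
    rw [one_div, ← inv_pow]
    refine (pow_le_pow_left₀ (by positivity) (hH i hi1 hin) _).trans ?_
    exact pow_le_pow_right₀ hH1 (by omega)
  rw [abs_mul, abs_of_pos (by positivity)]
  refine mul_le_mul h1 ?_ (abs_nonneg _) (by positivity)
  set z := (h i)⁻¹ • (x - Y i) with hz
  have hzn : R / Hm ≤ ‖z‖ := by
    rw [hz, norm_smul, Real.norm_eq_abs, abs_of_pos (by positivity), inv_mul_eq_div]
    exact div_le_div₀ (norm_nonneg _) (hx i hi) hhi (hHm i hi1)
  have hz0 : 0 < R / Hm := by positivity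
  have h2 := hdec z
  rw [abs_mul, abs_of_nonneg (by positivity)] at h2
  have h3 : (R / Hm) ^ γ * |multiD α K z| ≤ Cγ :=
    (mul_le_mul_of_nonneg_right (Real.rpow_le_rpow hz0.le hzn hγ.le) (abs_nonneg _)).trans h2
  have h4 : (Hm / R) ^ γ = ((R / Hm) ^ γ)⁻¹ := by
    rw [← Real.inv_rpow hz0.le, inv_div]
  rw [h4, ← div_eq_mul_inv, le_div_iff₀ (by positivity)]
  linarith

/-- Three contributions: observations outside half the ball of radius `w`, points of `U` outside the
ball, and a finite net inside it. If no observation is far out, the decay of `∂^α K` and `∂^α f`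
rules out a large deviation outside the ball. Inside, the net has `w^d` points up to a
subexponential factor. -/
theorem eventually_measureReal_supDeviation_le [IsProbabilityMeasure P]
    (S : IsEstimationSetting P X α K f h v B Λ) (hΛ : ∀ u, 0 ≤ Λ u) {U : Set (Rd d)} {F : ℝ}
    (hF : ∀ x ∈ U, f x ≤ F) {CH r : ℝ} (hr : 0 < r) (hr1 : r ≤ 1)
    (hol : ∀ a b, |multiD α K a - multiD α K b| ≤ CH * ‖a - b‖ ^ r) (hCH : 0 ≤ CH)
    {γ Cγ : ℝ} (hγ : 0 < γ) (hdec : ∀ z, |‖z‖ ^ γ * multiD α K z| ≤ Cγ)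
    {η Cη : ℝ} (hη : 0 < η) (hgdec : ∀ z, |‖z‖ ^ η * multiD α f z| ≤ Cη)
    {ξ : ℝ} (hξ : 0 < ξ) (hmoment : Integrable (fun x : Rd d => ‖x‖ ^ ξ * f x))
    {δ J : ℝ} (hδ : 0 < δ) (hJ : 0 < J) {u₁ u₂ : ℝ} (hu₁ : 0 ≤ u₁) (hu₂ : 0 ≤ u₂)
    (h₁ : J < u₁ * δ - F * Λ u₁) (h₂ : J < u₂ * δ - F * Λ (-u₂)) {J' : ℝ}
    (hJ' : J' < ξ / (ξ + d) * J) :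
    ∀ᶠ n in atTop, P.real {ω | ENNReal.ofReal δ ≤ supDeviation α K f h v U (fun i => X i ω) n} ≤
      Real.exp (-(speed α h v n * J')) := by
  have hA := S.array
  have hs := hA.speed_tendsto
  have hd0 : (0 : ℝ) < d := by exact_mod_cast S.dim_pos
  -- This exponent balances the moment bound `e^{-ξ b s}` against `e^{b d s}` Chernoff bounds `e^{-J
  -- s}`, since `J - b d = ξ b`. The slack `θ` pays for the subexponential factors.
  set b := J / (ξ + d) with hb
  have hb0 : 0 < b := by positivity
  set θ := ξ * b - J' with hθ
  have hθ0 : 0 < θ := by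
    have : ξ / (ξ + d) * J = ξ * b := by rw [hb]; ring
    rw [hθ]; linarith
  -- Room for the oscillation between net points: the level is lowered to `δ - ρ` while both
  -- Chernoff exponents stay above `J`.
  obtain ⟨ρ, hρ0, hρδ, hρ1, hρ2⟩ : ∃ ρ, 0 < ρ ∧ ρ ≤ δ / 2 ∧ J < u₁ * (δ - ρ) - F * Λ u₁ ∧
      J < u₂ * (δ - ρ) - F * Λ (-u₂) := by
    have t1 : Tendsto (fun ρ : ℝ => u₁ * (δ - ρ) - F * Λ u₁) (𝓝[>] 0)
        (𝓝 (u₁ * (δ - 0) - F * Λ u₁)) :=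
      (Continuous.tendsto (by fun_prop) 0).mono_left nhdsWithin_le_nhds
    have t2 : Tendsto (fun ρ : ℝ => u₂ * (δ - ρ) - F * Λ (-u₂)) (𝓝[>] 0)
        (𝓝 (u₂ * (δ - 0) - F * Λ (-u₂))) :=
      (Continuous.tendsto (by fun_prop) 0).mono_left nhdsWithin_le_nhds
    rw [sub_zero] at t1 t2
    have t3 : ∀ᶠ ρ : ℝ in 𝓝[>] 0, ρ ≤ δ / 2 :=
      nhdsWithin_le_nhds (Iic_mem_nhds (by positivity))
    obtain ⟨ρ, ⟨⟨h1, h2⟩, h3⟩, h4⟩ := (((t1.eventually (lt_mem_nhds h₁)).and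
      (t2.eventually (lt_mem_nhds h₂))).and t3 |>.and self_mem_nhdsWithin).exists
    exact ⟨ρ, h4, h3, h1, h2⟩
  obtain ⟨C, A, hC1, hinv⟩ := hA.inv_le_pow
  obtain ⟨Hm, hHm⟩ : ∃ Hm, ∀ i, 1 ≤ i → h i ≤ Hm := by
    obtain ⟨Hm, hHm⟩ := hA.h_tendsto.bddAbove_range
    exact ⟨Hm, fun i _ => hHm ⟨i, rfl⟩⟩
  have hHm0 : 0 < Hm := (hA.h_pos 1 le_rfl).trans_le (hHm 1 le_rfl)
  have hCγ : 0 ≤ Cγ := (abs_nonneg _).trans (hdec 0)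
  have hCη : 0 ≤ Cη := (abs_nonneg _).trans (hgdec 0)
  have hsp : ∀ᶠ n in atTop, 0 < speed α h v n := hs.eventually_gt_atTop 0
  have en : IsSubexp (speed α h v) fun n => (n : ℝ) :=
    IsSubexp.of_log hsp (by
      filter_upwards [eventually_ge_atTop 1] with n hn; exact_mod_cast hn) hA.log_n
  have ev : IsSubexp (speed α h v) v :=
    IsSubexp.of_log hsp (by
      filter_upwards [eventually_ge_atTop 1] with n hn using hA.v_pos n hn) hA.log_v
  set H : ℕ → ℝ := fun n => C * (n : ℝ) ^ A with hHdef
  set Q : ℕ → ℝ := fun n => H n ^ (d + multiLen α + 1) with hQdef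
  have eQ : IsSubexp (speed α h v) Q :=
    IsSubexp.pow hs ((IsSubexp.const hs (by linarith)).mul (IsSubexp.pow hs en A)) _
  -- With mesh `τ = G^{-1/r}` the Hölder oscillation `v Q CH τ^r` is at most `CH / n`. `G` is
  -- subexponential, so the mesh adds only a subexponential factor to the size of the net.
  set G : ℕ → ℝ := fun n => v n * Q n * n with hG
  have eG : IsSubexp (speed α h v) G := (ev.mul eQ).mul en
  set τ : ℕ → ℝ := fun n => (G n ^ (1 / r))⁻¹ with hτ
  set E : ℕ → ℝ := fun n => (2 * d * G n ^ (1 / r) + 5) ^ d with hE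
  have eE : IsSubexp (speed α h v) E :=
    IsSubexp.pow hs (IsSubexp.add hs ((IsSubexp.const hs (by positivity)).mul
      (eG.rpow (by positivity))) (IsSubexp.const hs (by norm_num))) _
  set M := ∫ x, ‖x‖ ^ ξ * f x with hM
  have hM0 : 0 ≤ M := integral_nonneg fun x => mul_nonneg (by positivity) (S.density.nonneg x)
  have eT : IsSubexp (speed α h v) fun n => (n : ℝ) * (2 ^ ξ * M) + 2 * E n :=
    IsSubexp.add hs (en.mul (IsSubexp.const hs (by positivity)))
      ((IsSubexp.const hs (by norm_num)).mul eE)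
  have far1 := IsSubexp.eventually_mul_exp_neg_le hs ((ev.mul eQ).mul
    (IsSubexp.const hs (C := Cγ * (2 * Hm) ^ γ) (by positivity))) (b := γ * b) (ε := δ / 4)
    (by positivity) (by positivity)
  have far2 := IsSubexp.eventually_mul_exp_neg_le hs (ev.mul (IsSubexp.const hs hCη)) (b := η * b)
    (ε := δ / 4) (by positivity) (by positivity)
  have hCHn : ∀ᶠ n : ℕ in atTop, CH / n ≤ ρ / 8 := by
    have : Tendsto (fun n : ℕ => CH / (n : ℝ)) atTop (𝓝 0) :=
      tendsto_const_nhds.div_atTop tendsto_natCast_atTop_atTop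
    filter_upwards [this.eventually (gt_mem_nhds (show 0 < ρ / 8 by positivity))] with n hn using hn.le
  filter_upwards [S.eventually_measureReal_le hΛ hF (ς := 1) hu₁ (by rwa [one_mul]),
    S.eventually_measureReal_le hΛ hF (ς := -1) hu₂ (by rwa [neg_one_mul]),
    S.bias (ρ / 8) (by positivity), eventually_ge_atTop 1, eT.2 θ hθ0, far1, far2, hCHn, hsp]
    with n hch1 hch2 hbias hn hT hfar1 hfar2 hCHn hsp
  have hn0 : (0 : ℝ) < n := by exact_mod_cast hn
  have hn1 : (1 : ℝ) ≤ n := by exact_mod_cast hn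
  have hvn := hA.v_pos n hn
  have hH1 : 1 ≤ H n := one_le_mul_of_one_le_of_one_le hC1 (one_le_pow₀ hn1)
  have hHi : ∀ i, 1 ≤ i → i ≤ n → (h i)⁻¹ ≤ H n := fun i hi hin => by
    refine (hinv i hi).trans ?_
    have : (i : ℝ) ≤ n := by exact_mod_cast hin
    simp only [hHdef]
    gcongr
  have hQ0 : 0 < Q n := pow_pos (by linarith) _
  have hG0 : 0 < G n := by positivity
  have hτ0 : 0 < τ n := by positivity
  set w := Real.exp (b * speed α h v n) with hw
  have hw0 : 0 < w := Real.exp_pos _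
  have hw1 : 1 ≤ w := Real.one_le_exp (by positivity)
  have osc : ∀ x c ω, ‖x - c‖ ≤ τ n →
      |deviation X α K f h v n x ω - deviation X α K f h v n c ω| ≤ ρ / 2 := by
    intro x c ω hxc
    have hpow : v n * (Q n * (CH * ‖x - c‖ ^ r)) ≤ ρ / 8 := by
      have h1 : ‖x - c‖ ^ r ≤ (G n)⁻¹ := by
        calc ‖x - c‖ ^ r ≤ τ n ^ r := Real.rpow_le_rpow (norm_nonneg _) hxc hr.le
          _ = (G n)⁻¹ := by
            rw [hτ]
            simp only
            rw [Real.inv_rpow (by positivity), ← Real.rpow_mul hG0.le, one_div,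
              inv_mul_cancel₀ hr.ne', Real.rpow_one]
      calc v n * (Q n * (CH * ‖x - c‖ ^ r)) ≤ v n * (Q n * (CH * (G n)⁻¹)) := by gcongr
        _ = CH / n := by rw [hG]; field_simp
        _ ≤ _ := hCHn
    have o1 := abs_recEstimator_sub_le hr hr1 hol hCH hA.h_pos hH1 hHi (fun i => X i ω) x c
    have o2 := S.abs_meanEstimator_sub_le hr hr1 hol hCH hH1 hHi x c
    have o1' := (mul_le_mul_of_nonneg_left o1 hvn.le).trans hpow
    have o2' := (mul_le_mul_of_nonneg_left o2 hvn.le).trans hpow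
    rw [← abs_of_pos hvn, ← abs_mul] at o1' o2'
    have b1 := hbias x
    have b2 := hbias c
    have e : deviation X α K f h v n x ω - deviation X α K f h v n c ω =
        v n * (recEstimator α K h (fun i => X i ω) n x - recEstimator α K h (fun i => X i ω) n c) +
        v n * (meanEstimator α K f h n x - multiD α f x) -
        v n * (meanEstimator α K f h n c - multiD α f c) -
        v n * (meanEstimator α K f h n x - meanEstimator α K f h n c) := by
      rw [deviation, deviation]; ring
    rw [e, abs_le]
    have := abs_le.1 o1'
    have := abs_le.1 o2'
    have := abs_le.1 b1
    have := abs_le.1 b2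
    constructor <;> linarith
  have far : ∀ x ω, w < ‖x‖ → (∀ i ∈ Finset.Icc 1 n, ‖X i ω‖ ≤ w / 2) →
      |deviation X α K f h v n x ω| ≤ δ / 2 := by
    intro x ω hx hXi
    have f1 := abs_recEstimator_le_of_far hγ hdec hA.h_pos hH1 hHi hHm (half_pos hw0)
      (fun i => X i ω) x (fun i hi => by
        have := norm_sub_norm_le x (X i ω)
        have := hXi i hi
        linarith)
    have f2 : |multiD α f x| ≤ Cη * Real.exp (-(η * b * speed α h v n)) := by
      have h2 := hgdec x
      rw [abs_mul, abs_of_nonneg (by positivity)] at h2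
      have h3 : w ^ η * |multiD α f x| ≤ Cη :=
        (mul_le_mul_of_nonneg_right (Real.rpow_le_rpow hw0.le hx.le hη.le) (abs_nonneg _)).trans h2
      rw [Real.exp_neg, ← div_eq_mul_inv, le_div_iff₀ (Real.exp_pos _)]
      have : w ^ η = Real.exp (η * b * speed α h v n) := by
        rw [hw, ← Real.exp_mul]; congr 1; ring
      rw [← this]; linarith
    have f3 : (Hm / (w / 2)) ^ γ = (2 * Hm) ^ γ * Real.exp (-(γ * b * speed α h v n)) := by
      rw [show Hm / (w / 2) = (2 * Hm) * w⁻¹ by field_simp, Real.mul_rpow (by positivity) (by positivity),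
        hw, ← Real.exp_neg, ← Real.exp_mul]
      congr 2; ring
    rw [f3] at f1
    have g1 := mul_le_mul_of_nonneg_left f1 hvn.le
    have g2 := mul_le_mul_of_nonneg_left f2 hvn.le
    have g1' : v n * (H n ^ (d + multiLen α + 1) * (Cγ * ((2 * Hm) ^ γ *
        Real.exp (-(γ * b * speed α h v n))))) = v n * Q n * (Cγ * (2 * Hm) ^ γ) *
        Real.exp (-(γ * b * speed α h v n)) := by rw [hQdef]; ring
    rw [g1'] at g1
    rw [← mul_assoc] at g2
    rw [deviation, abs_mul, abs_of_pos hvn]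
    have := mul_le_mul_of_nonneg_left (abs_sub (recEstimator α K h (fun i => X i ω) n x)
      (multiD α f x)) hvn.le
    linarith
  obtain ⟨T, hTU, hTcard, hTcov⟩ := exists_finset_cover U hw0.le (div_pos hτ0 hd0)
  have hincl : {ω | ENNReal.ofReal δ ≤ supDeviation α K f h v U (fun i => X i ω) n} ⊆
      (⋃ i ∈ Finset.Icc 1 n, {ω | w / 2 < ‖X i ω‖}) ∪
      ⋃ c ∈ T, ({ω | δ - ρ ≤ 1 * deviation X α K f h v n c ω} ∪
        {ω | δ - ρ ≤ -1 * deviation X α K f h v n c ω}) := by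
    intro ω hω
    by_contra hcon
    simp only [Set.mem_union, Set.mem_iUnion, not_or, not_exists] at hcon
    obtain ⟨hc1, hc2⟩ := hcon
    have hXi : ∀ i ∈ Finset.Icc 1 n, ‖X i ω‖ ≤ w / 2 := fun i hi => not_lt.1 (hc1 i hi)
    -- The supremum need not be attained. A point exceeding `δ - ρ/2` exists, and the oscillation
    -- bound `ρ/2` leaves more than `δ - ρ` at the neighbouring net point.
    have hlt : ENNReal.ofReal (δ - ρ / 2) < supDeviation α K f h v U (fun i => X i ω) n :=
      lt_of_lt_of_le ((ENNReal.ofReal_lt_ofReal_iff hδ).2 (by linarith)) hω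
    rw [supDeviation] at hlt
    obtain ⟨x, hx⟩ := lt_iSup_iff.1 hlt
    obtain ⟨hxU, hx⟩ := lt_iSup_iff.1 hx
    have hx' := (ENNReal.ofReal_lt_ofReal_iff_of_nonneg (by linarith)).1 hx
    rw [← abs_of_pos hvn, ← abs_mul] at hx'
    have hx'' : δ - ρ / 2 < |deviation X α K f h v n x ω| := hx'
    rcases lt_or_ge w ‖x‖ with hwx | hwx
    · have := far x ω hwx hXi
      linarith
    · obtain ⟨c, hcT, hxc⟩ := hTcov x hxU hwx
      rw [mul_div_cancel₀ _ hd0.ne'] at hxc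
      have ho := osc x c ω hxc
      have hcc := hc2 c hcT
      have hcc1 : ¬ δ - ρ ≤ 1 * deviation X α K f h v n c ω := hcc.1
      have hcc2 : ¬ δ - ρ ≤ -1 * deviation X α K f h v n c ω := hcc.2
      have hcabs : |deviation X α K f h v n c ω| < δ - ρ := by
        rw [abs_lt]; constructor <;> linarith
      have := abs_sub_abs_le_abs_sub (deviation X α K f h v n x ω) (deviation X α K f h v n c ω)
      linarith
  have hfm := S.uniformContinuous.continuous.measurable
  have p1 : P.real (⋃ i ∈ Finset.Icc 1 n, {ω | w / 2 < ‖X i ω‖}) ≤ n * ((w / 2) ^ (-ξ) * M) := by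
    refine (measureReal_biUnion_finset_le _ _).trans ?_
    refine (Finset.sum_le_sum fun i hi => measureReal_norm_gt_le S.density hfm S.sample hξ hmoment
      (Finset.mem_Icc.1 hi).1 (half_pos hw0)).trans ?_
    simp [hM]
  have p2 : P.real (⋃ c ∈ T, ({ω | δ - ρ ≤ 1 * deviation X α K f h v n c ω} ∪
        {ω | δ - ρ ≤ -1 * deviation X α K f h v n c ω})) ≤
      T.card * (2 * Real.exp (-(speed α h v n * J))) := by
    refine (measureReal_biUnion_finset_le _ _).trans ?_
    refine (Finset.sum_le_sum (g := fun _ => 2 * Real.exp (-(speed α h v n * J))) fun c hc => ?_).trans ?_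
    · refine (measureReal_union_le _ _).trans ?_
      have := hch1 c (hTU hc)
      have := hch2 c (hTU hc)
      linarith
    · simp
  have hwξ : (w / 2) ^ (-ξ) = 2 ^ ξ * Real.exp (-(ξ * b * speed α h v n)) := by
    rw [div_eq_mul_inv, Real.mul_rpow hw0.le (by norm_num), Real.inv_rpow (by norm_num),
      Real.rpow_neg (show (0 : ℝ) ≤ 2 by norm_num), inv_inv, hw, ← Real.exp_mul, mul_comm]
    congr 2; ring
  -- As `w ≥ 1`, the factor `w^d` splits off the cardinality; it turns `e^{-J s}` into `e^{-ξ b s}`.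
  have hcard : (T.card : ℝ) * (2 * Real.exp (-(speed α h v n * J))) ≤
      2 * E n * Real.exp (-(ξ * b * speed α h v n)) := by
    have h1 : 2 * w / (τ n / d) + 5 ≤ w * (2 * d * G n ^ (1 / r) + 5) := by
      have e1 : 2 * w / (τ n / d) = w * (2 * d * G n ^ (1 / r)) := by
        rw [hτ]; field_simp
      rw [e1]; nlinarith
    have h2 : (T.card : ℝ) ≤ w ^ d * E n := by
      refine hTcard.trans ?_
      rw [hE]
      simp only
      rw [← mul_pow]
      exact pow_le_pow_left₀ (by positivity) h1 d
    have hE0 : 0 ≤ E n := by positivity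
    have h3 : w ^ d * Real.exp (-(speed α h v n * J)) = Real.exp (-(ξ * b * speed α h v n)) := by
      rw [hw, ← Real.exp_nat_mul, ← Real.exp_add]
      congr 1
      have : J = b * (ξ + d) := by rw [hb]; field_simp
      rw [this]; ring
    calc _ ≤ w ^ d * E n * (2 * Real.exp (-(speed α h v n * J))) := by gcongr
      _ = 2 * E n * (w ^ d * Real.exp (-(speed α h v n * J))) := by ring
      _ = _ := by rw [h3]
  calc _ ≤ P.real ((⋃ i ∈ Finset.Icc 1 n, {ω | w / 2 < ‖X i ω‖}) ∪
      ⋃ c ∈ T, ({ω | δ - ρ ≤ 1 * deviation X α K f h v n c ω} ∪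
        {ω | δ - ρ ≤ -1 * deviation X α K f h v n c ω})) := measureReal_mono hincl
    _ ≤ n * ((w / 2) ^ (-ξ) * M) + T.card * (2 * Real.exp (-(speed α h v n * J))) :=
        (measureReal_union_le _ _).trans (add_le_add p1 p2)
    _ ≤ n * (2 ^ ξ * Real.exp (-(ξ * b * speed α h v n)) * M) +
        2 * E n * Real.exp (-(ξ * b * speed α h v n)) := by
        rw [hwξ]; gcongr
    _ = (n * (2 ^ ξ * M) + 2 * E n) * Real.exp (-(ξ * b * speed α h v n)) := by ring
    _ ≤ Real.exp (θ * speed α h v n) * Real.exp (-(ξ * b * speed α h v n)) := by gcongr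
    _ = Real.exp (-(speed α h v n * J')) := by
        rw [← Real.exp_add]; congr 1; rw [hθ]; ring

end IsEstimationSetting

end

/-! ## The rate as a Legendre transform -/

/-- The Legendre transform `sup_u (u δ - F Λ(u))`. -/
noncomputable def legendre (F : ℝ) (Λ : ℝ → ℝ) (δ : ℝ) : EReal :=
  ⨆ u : ℝ, ((u * δ - F * Λ u : ℝ) : EReal)

theorem le_legendre (F : ℝ) (Λ : ℝ → ℝ) (δ u : ℝ) :
    ((u * δ - F * Λ u : ℝ) : EReal) ≤ legendre F Λ δ :=
  le_iSup (fun u : ℝ => ((u * δ - F * Λ u : ℝ) : EReal)) u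

theorem legendre_neg (F : ℝ) (Λ : ℝ → ℝ) (δ : ℝ) :
    legendre F (fun u => Λ (-u)) δ = legendre F Λ (-δ) := by
  refine le_antisymm (iSup_le fun u => ?_) (iSup_le fun u => ?_)
  · have := le_legendre F Λ (-δ) (-u)
    rwa [neg_mul_neg] at this
  · have := le_legendre F (fun u => Λ (-u)) δ (-u)
    rwa [neg_neg, neg_mul, ← mul_neg] at this

/-- A nonzero linear function is unbounded. The degenerate rate at `‖f‖_{U,∞} = 0` thus obeys the
same formula as the others. -/
theorem legendre_zero_left (Λ : ℝ → ℝ) {δ : ℝ} (hδ : δ ≠ 0) : legendre 0 Λ δ = ⊤ := by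
  rw [EReal.eq_top_iff_forall_lt]
  intro y
  refine lt_of_lt_of_le ?_ (le_legendre 0 Λ δ ((y + 1) / δ))
  rw [div_mul_cancel₀ _ hδ, zero_mul, sub_zero]
  exact EReal.coe_lt_coe_iff.2 (lt_add_one y)

theorem coe_mul_iSup_coe {c : ℝ} (hc : 0 < c) (t : ℝ → ℝ) :
    (c : EReal) * ⨆ u, (t u : EReal) = ⨆ u, ((c * t u : ℝ) : EReal) := by
  have hc' : (0 : EReal) < c := EReal.coe_pos.2 hc
  refine le_antisymm ?_ (iSup_le fun u => ?_)
  · rw [mul_comm, ← EReal.le_div_iff_mul_le hc' (EReal.coe_ne_top c)]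
    refine iSup_le fun u => ?_
    rw [EReal.le_div_iff_mul_le hc' (EReal.coe_ne_top c), mul_comm, ← EReal.coe_mul]
    exact le_iSup (fun u => ((c * t u : ℝ) : EReal)) u
  · rw [EReal.coe_mul]
    exact mul_le_mul_of_nonneg_left (le_iSup (fun u => (t u : EReal)) u) hc'.le

theorem legendre_quadratic {F σ : ℝ} (hF : 0 < F) (hσ : 0 < σ) (δ : ℝ) :
    legendre F (fun u => u ^ 2 * σ / 2) δ = ((δ ^ 2 / (2 * F * σ) : ℝ) : EReal) := by
  refine le_antisymm (iSup_le fun u => EReal.coe_le_coe_iff.2 ?_) ?_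
  · rw [le_div_iff₀ (by positivity)]
    nlinarith [sq_nonneg (u * F * σ - δ)]
  · refine le_trans (le_of_eq ?_) (le_legendre F _ δ (δ / (F * σ)))
    congr 1
    field_simp
    ring

/-- At the last point `u₀` before `u₁` where `F Λ' ≤ δ`, equality holds, so the cost there is below
`R`. Just to its right the slope exceeds `δ` strictly, and by continuity the cost is still below
`R`. The conclusion holds near `F` because the supremum of `f` over `U` need not be attained. -/
theorem exists_slope_of_lt_legendre {F : ℝ} {Λ Λ' : ℝ → ℝ} (hF : 0 < F)
    (hd : ∀ u, HasDerivAt Λ (Λ' u) u) (hc : Continuous Λ') (h0 : Λ' 0 = 0)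
    (hu : ∀ M, ∃ u, 0 < u ∧ M < Λ' u) {δ : ℝ} (hδ : 0 < δ) {R : ℝ}
    (hR : legendre F Λ δ < R) :
    ∃ u, ∀ᶠ y in 𝓝 F, δ < y * Λ' u ∧ y * (u * Λ' u - Λ u) < R := by
  have hΛ : Continuous Λ := continuous_iff_continuousAt.2 fun u => (hd u).continuousAt
  obtain ⟨u₁, hu₁, hM⟩ := hu (δ / F)
  rw [div_lt_iff₀ hF] at hM
  have hSc : IsCompact (Set.Icc 0 u₁ ∩ {u | Λ' u * F ≤ δ}) :=
    isCompact_Icc.inter_right (isClosed_le (hc.mul_const F) continuous_const)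
  have hSne : (Set.Icc 0 u₁ ∩ {u | Λ' u * F ≤ δ}).Nonempty :=
    ⟨0, ⟨le_rfl, hu₁.le⟩, by simp [h0, hδ.le]⟩
  obtain ⟨u₀, ⟨⟨h00, h01⟩, hle⟩, hmax⟩ := hSc.exists_isGreatest hSne
  have hlt : u₀ < u₁ := lt_of_le_of_ne h01 fun e => by
    rw [e] at hle; exact absurd hle (not_le.2 hM)
  have hgt : ∀ u ∈ Set.Ioo u₀ u₁, δ < Λ' u * F := fun u hu => by
    by_contra! hn
    exact absurd (hmax ⟨⟨h00.trans hu.1.le, hu.2.le⟩, hn⟩) (not_le.2 hu.1)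
  have hIoo : Set.Ioo u₀ u₁ ∈ 𝓝[>] u₀ := Ioo_mem_nhdsGT hlt
  have heq : Λ' u₀ * F = δ := by
    have hT : Tendsto (fun u => Λ' u * F) (𝓝[>] u₀) (𝓝 (Λ' u₀ * F)) :=
      ((hc.mul_const F).tendsto u₀).mono_left nhdsWithin_le_nhds
    refine le_antisymm hle (ge_of_tendsto hT ?_)
    filter_upwards [hIoo] with u hu using (hgt u hu).le
  have hcont : Continuous fun u => F * (u * Λ' u - Λ u) := by fun_prop
  have hlt0 : F * (u₀ * Λ' u₀ - Λ u₀) < R := by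
    have := (le_legendre F Λ δ u₀).trans_lt hR
    rw [EReal.coe_lt_coe_iff] at this
    calc F * (u₀ * Λ' u₀ - Λ u₀) = u₀ * δ - F * Λ u₀ := by rw [← heq]; ring
      _ < R := this
  have hev : ∀ᶠ u in 𝓝[>] u₀, F * (u * Λ' u - Λ u) < R :=
    ((hcont.tendsto u₀).mono_left nhdsWithin_le_nhds).eventually (gt_mem_nhds hlt0)
  obtain ⟨u, hu1, hu2⟩ := (hev.and hIoo).exists
  refine ⟨u, ?_⟩
  have e1 : ∀ᶠ y in 𝓝 F, δ < y * Λ' u :=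
    (continuous_id.mul continuous_const).continuousAt.eventually
      (lt_mem_nhds (by simpa [mul_comm] using hgt u hu2))
  have e2 : ∀ᶠ y in 𝓝 F, y * (u * Λ' u - Λ u) < R :=
    (continuous_id.mul continuous_const).continuousAt.eventually (gt_mem_nhds hu1)
  exact e1.and e2

/-! ## Large deviations of the uniform error -/

namespace IsEstimationSetting

variable {d : ℕ} {Ω : Type*} [MeasurableSpace Ω] {P : Measure Ω} {X : ℕ → Ω → Rd d}
  {α : Fin d → ℕ} {K f : Rd d → ℝ} {h v : ℕ → ℝ} {B : ℝ} {Λ Λ' : ℝ → ℝ}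

/-- The supremum dominates the deviation at a single point; the sign `s` selects overestimation or
underestimation. -/
theorem eventually_exp_neg_le_measureReal [IsProbabilityMeasure P]
    (S : IsEstimationSetting P X α K f h v B Λ) {U : Set (Rd d)} {x : Rd d} (hx : x ∈ U) {s : ℝ}
    (hs : |s| = 1) {δ u t : ℝ} (hd : HasDerivAt (fun w => f x * Λ (w * s)) t u) (ht : δ < t)
    {ε : ℝ} (hε : 0 < ε) : ∀ᶠ n in atTop,
      Real.exp (-(speed α h v n * (u * t - f x * Λ (u * s) + ε))) ≤
        P.real {ω | ENNReal.ofReal δ ≤ supDeviation α K f h v U (fun i => X i ω) n} := by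
  have hrw : ∀ (w : ℝ) n ω, w * (speed α h v n * (s * deviation X α K f h v n x ω)) =
      w * s * (speed α h v n * deviation X α K f h v n x ω) := fun w n ω => by ring
  have key := exp_neg_le_measureReal_of_log_mgf (P := P) S.array.speed_tendsto
    (Z := fun n ω => s * deviation X α K f h v n x ω)
    (fun n => (S.measurable_deviation n x).const_mul s)
    (by
      filter_upwards [eventually_ge_atTop 1] with n hn w
      simp only [hrw]
      exact S.integrable_exp_deviation hn x _)
    (by
      filter_upwards [eventually_ge_atTop 1] with n hn w
      simp only [hrw]
      exact S.integral_exp_deviation_pos hn x _)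
    (L := fun w => f x * Λ (w * s))
    (fun w ε hε => by
      filter_upwards [S.tendstoUniformly_log_mgf (w * s) hε] with n hn
      simp only [hrw]
      exact hn x)
    hd ht hε
  filter_upwards [key, eventually_ge_atTop 1] with n hn h1
  refine hn.trans (measureReal_mono fun ω hω => ?_)
  have hω' : δ ≤ s * deviation X α K f h v n x ω := hω
  refine le_trans (ENNReal.ofReal_le_ofReal ?_) (le_iSup₂ (f := fun x (_ : x ∈ U) =>
    ENNReal.ofReal (v n * |recEstimator α K h (fun i => X i ω) n x - multiD α f x|)) x hx)
  calc δ ≤ |s * deviation X α K f h v n x ω| := hω'.trans (le_abs_self _)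
    _ = _ := by rw [abs_mul, hs, one_mul, deviation, abs_mul, abs_of_pos (S.array.v_pos n h1)]

theorem eventually_exp_neg_le_measureReal_of_legendre_lt [IsProbabilityMeasure P]
    (S : IsEstimationSetting P X α K f h v B Λ) (H : IsRateCumulant Λ Λ') {U : Set (Rd d)}
    (hF : 0 < supNormOn f U) {δ : ℝ} (hδ : 0 < δ) {R : ℝ}
    (hR : min (legendre (supNormOn f U) Λ δ) (legendre (supNormOn f U) Λ (-δ)) < R) :
    ∀ᶠ n in atTop, Real.exp (-(speed α h v n * R)) ≤
      P.real {ω | ENNReal.ofReal δ ≤ supDeviation α K f h v U (fun i => X i ω) n} := by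
  set F := supNormOn f U with hFdef
  have hne : Nonempty U := by
    by_contra hn
    rw [not_nonempty_iff] at hn
    rw [hFdef, supNormOn, Real.iSup_of_isEmpty] at hF
    exact lt_irrefl _ hF
  obtain ⟨C, hC⟩ := S.density.bounded
  have hbdd : BddAbove (Set.range fun x : U => |f x|) := ⟨C, by
    rintro _ ⟨x, rfl⟩
    simp only [abs_of_nonneg (S.density.nonneg _), hC]⟩
  have hnear : ∀ p : ℝ → Prop, (∀ᶠ y in 𝓝 F, p y) → ∃ x ∈ U, p (f x) := by
    intro p hp
    obtain ⟨ρ, hρ, hball⟩ := Metric.eventually_nhds_iff.1 hp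
    obtain ⟨x, hx⟩ := exists_lt_of_lt_ciSup (show F - ρ < ⨆ x : U, |f x| from by
      rw [hFdef, supNormOn]; linarith)
    have hx2 : |f x| ≤ F := le_ciSup hbdd x
    rw [abs_of_nonneg (S.density.nonneg _)] at hx hx2
    refine ⟨x, x.2, hball ?_⟩
    rw [Real.dist_eq, abs_lt]
    constructor <;> linarith
  have main : ∀ s : ℝ, |s| = 1 → ∀ Λs Λs' : ℝ → ℝ, (∀ u, Λs u = Λ (u * s)) →
      (∀ u, HasDerivAt Λs (Λs' u) u) → Continuous Λs' → Λs' 0 = 0 →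
      (∀ M, ∃ u, 0 < u ∧ M < Λs' u) → legendre F Λs δ < R →
      ∀ᶠ n in atTop, Real.exp (-(speed α h v n * R)) ≤
        P.real {ω | ENNReal.ofReal δ ≤ supDeviation α K f h v U (fun i => X i ω) n} := by
    intro s hs Λs Λs' hΛs hd hc h0 hu hlt
    obtain ⟨u, hu⟩ := exists_slope_of_lt_legendre hF hd hc h0 hu hδ hlt
    obtain ⟨x, hxU, h1, h2⟩ := hnear _ hu
    have hd' : HasDerivAt (fun w => f x * Λ (w * s)) (f x * Λs' u) u := by
      simp only [← hΛs]
      exact (hd u).const_mul (f x)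
    have := S.eventually_exp_neg_le_measureReal hxU hs hd' h1 (sub_pos.2 h2)
    filter_upwards [this] with n hn
    refine le_of_eq_of_le ?_ hn
    rw [← hΛs]
    congr 3
    ring
  have hplus : legendre F Λ δ < R → ∀ᶠ n in atTop, Real.exp (-(speed α h v n * R)) ≤
      P.real {ω | ENNReal.ofReal δ ≤ supDeviation α K f h v U (fun i => X i ω) n} :=
    main 1 (by simp) Λ Λ' (by simp) H.deriv H.continuous H.deriv_zero H.unbounded
  rcases min_lt_iff.1 hR with hR | hR
  · exact hplus hR
  · rcases H.left with hl | hl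
    -- When `Λ (-u) ≤ Λ u` for `u ≥ 0`, the transform at `δ` is at most the one at `-δ`, so the
    -- overestimation bound covers this case as well.
    · refine hplus (lt_of_le_of_lt (iSup_le fun u => ?_) hR)
      rcases le_total 0 u with hu | hu
      · refine le_trans (EReal.coe_le_coe_iff.2 ?_) (le_legendre F Λ (-δ) (-u))
        have := mul_le_mul_of_nonneg_left (hl u hu) hF.le
        linarith
      · refine le_trans (EReal.coe_le_coe_iff.2 ?_) (le_legendre F Λ (-δ) 0)
        rw [H.zero]
        have := mul_nonneg hF.le (H.nonneg u)
        have := mul_nonpos_of_nonpos_of_nonneg hu hδ.le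
        linarith
    · refine main (-1) (by simp) (fun u => Λ (-u)) (fun u => -Λ' (-u)) (fun u => by simp)
        (fun u => ?_) (H.continuous.comp continuous_neg).neg (by simp [H.deriv_zero])
        (fun M => ?_) (by rwa [legendre_neg])
      · have := (H.deriv (-u)).comp u (hasDerivAt_neg u)
        simpa [Function.comp_def] using this
      · obtain ⟨u, hu, hM⟩ := hl M
        exact ⟨u, hu, by linarith⟩

theorem neg_le_normLogProb [IsProbabilityMeasure P] (S : IsEstimationSetting P X α K f h v B Λ)
    {U : Set (Rd d)} {δ R : ℝ} {n : ℕ} (hn : 1 ≤ n)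
    (hR : Real.exp (-(speed α h v n * R)) ≤
      P.real {ω | ENNReal.ofReal δ ≤ supDeviation α K f h v U (fun i => X i ω) n}) :
    ((-R : ℝ) : EReal) ≤ normLogProb P X α K f h v U δ n := by
  have hs := S.array.speed_pos hn
  have hc : v n ^ 2 / bandSum α h n = (speed α h v n)⁻¹ := by rw [speed, inv_div]
  have h1 : ENNReal.ofReal (Real.exp (-(speed α h v n * R))) ≤
      P {ω | ENNReal.ofReal δ ≤ supDeviation α K f h v U (fun i => X i ω) n} := by
    rw [← ofReal_measureReal]; exact ENNReal.ofReal_le_ofReal hR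
  have h2 := ENNReal.log_monotone h1
  rw [ENNReal.log_ofReal_of_pos (Real.exp_pos _), Real.log_exp] at h2
  rw [normLogProb, hc]
  refine le_trans (le_of_eq ?_) (mul_le_mul_of_nonneg_left h2
    (EReal.coe_nonneg.2 (inv_pos.2 hs).le))
  rw [← EReal.coe_mul]
  congr 1
  field_simp

theorem normLogProb_le_neg [IsProbabilityMeasure P] (S : IsEstimationSetting P X α K f h v B Λ)
    {U : Set (Rd d)} {δ R : ℝ} {n : ℕ} (hn : 1 ≤ n)
    (hR : P.real {ω | ENNReal.ofReal δ ≤ supDeviation α K f h v U (fun i => X i ω) n} ≤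
      Real.exp (-(speed α h v n * R))) :
    normLogProb P X α K f h v U δ n ≤ ((-R : ℝ) : EReal) := by
  have hs := S.array.speed_pos hn
  have hc : v n ^ 2 / bandSum α h n = (speed α h v n)⁻¹ := by rw [speed, inv_div]
  have h1 : P {ω | ENNReal.ofReal δ ≤ supDeviation α K f h v U (fun i => X i ω) n} ≤
      ENNReal.ofReal (Real.exp (-(speed α h v n * R))) := by
    rw [← ofReal_measureReal]; exact ENNReal.ofReal_le_ofReal hR
  have h2 := ENNReal.log_monotone h1
  rw [ENNReal.log_ofReal_of_pos (Real.exp_pos _), Real.log_exp] at h2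
  rw [normLogProb, hc]
  refine le_trans (mul_le_mul_of_nonneg_left h2 (EReal.coe_nonneg.2 (inv_pos.2 hs).le))
    (le_of_eq ?_)
  rw [← EReal.coe_mul]
  congr 1
  field_simp

theorem neg_min_legendre_le_liminf [IsProbabilityMeasure P]
    (S : IsEstimationSetting P X α K f h v B Λ) (H : IsRateCumulant Λ Λ') (U : Set (Rd d))
    {δ : ℝ} (hδ : 0 < δ) :
    -(min (legendre (supNormOn f U) Λ δ) (legendre (supNormOn f U) Λ (-δ))) ≤
      liminf (normLogProb P X α K f h v U δ) atTop := by
  have hF0 : 0 ≤ supNormOn f U := Real.iSup_nonneg fun _ => abs_nonneg _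
  rcases hF0.eq_or_lt with hF | hF
  · rw [← hF, legendre_zero_left Λ hδ.ne', legendre_zero_left Λ (neg_ne_zero.2 hδ.ne'), min_self,
      EReal.neg_top]
    exact bot_le
  · refine le_of_forall_lt_imp_le_of_dense fun c hc => ?_
    obtain ⟨r, hcr, hr⟩ := EReal.lt_iff_exists_real_btwn.1 hc
    have hr' := EReal.lt_neg_of_lt_neg hr
    refine hcr.le.trans (le_liminf_of_le (by isBoundedDefault) ?_)
    filter_upwards [S.eventually_exp_neg_le_measureReal_of_legendre_lt H hF hδ (R := -r)
      (by rwa [EReal.coe_neg]), eventually_ge_atTop 1] with n hn h1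
    simpa using S.neg_le_normLogProb h1 hn

theorem limsup_le_neg_min_legendre [IsProbabilityMeasure P]
    (S : IsEstimationSetting P X α K f h v B Λ) (H : IsRateCumulant Λ Λ') (U : Set (Rd d))
    {CH r : ℝ} (hr : 0 < r) (hr1 : r ≤ 1)
    (hol : ∀ a b, |multiD α K a - multiD α K b| ≤ CH * ‖a - b‖ ^ r) (hCH : 0 ≤ CH)
    {γ Cγ : ℝ} (hγ : 0 < γ) (hdec : ∀ z, |‖z‖ ^ γ * multiD α K z| ≤ Cγ)
    {η Cη : ℝ} (hη : 0 < η) (hgdec : ∀ z, |‖z‖ ^ η * multiD α f z| ≤ Cη)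
    {ξ : ℝ} (hξ : 0 < ξ) (hmoment : Integrable (fun x : Rd d => ‖x‖ ^ ξ * f x))
    {δ : ℝ} (hδ : 0 < δ) :
    limsup (normLogProb P X α K f h v U δ) atTop ≤ -(((ξ / (ξ + d) : ℝ) : EReal) *
      min (legendre (supNormOn f U) Λ δ) (legendre (supNormOn f U) Λ (-δ))) := by
  have hF0 : 0 ≤ supNormOn f U := Real.iSup_nonneg fun _ => abs_nonneg _
  set F := supNormOn f U with hFdef
  obtain ⟨C, hC⟩ := S.density.bounded
  have hbdd : BddAbove (Set.range fun x : U => |f x|) := ⟨C, by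
    rintro _ ⟨x, rfl⟩
    simp only [abs_of_nonneg (S.density.nonneg _), hC]⟩
  have hF : ∀ x ∈ U, f x ≤ F := fun x hx => (le_abs_self _).trans (le_ciSup hbdd ⟨x, hx⟩)
  have hκ : 0 < ξ / (ξ + d) := by positivity
  refine le_of_forall_gt_imp_ge_of_dense fun c hc => ?_
  obtain ⟨y, hy, hyc⟩ := EReal.lt_iff_exists_real_btwn.1 hc
  refine le_trans (limsup_le_of_le (by isBoundedDefault) ?_) hyc.le
  have hy' := EReal.neg_lt_of_neg_lt hy
  rw [← EReal.coe_neg] at hy'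
  obtain ⟨J', rfl⟩ : ∃ J', y = -J' := ⟨-y, (neg_neg y).symm⟩
  rw [neg_neg] at hy'
  suffices hev : ∀ᶠ n in atTop,
      P.real {ω | ENNReal.ofReal δ ≤ supDeviation α K f h v U (fun i => X i ω) n} ≤
        Real.exp (-(speed α h v n * J')) by
    filter_upwards [hev, eventually_ge_atTop 1] with n hn h1 using S.normLogProb_le_neg h1 hn
  rcases le_or_gt J' 0 with hJ' | hJ'
  -- A nonpositive rate asks only for a bound by a number at least `1`.
  · filter_upwards [eventually_ge_atTop 1] with n hn
    refine measureReal_le_one.trans (Real.one_le_exp ?_)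
    have := mul_nonneg (S.array.speed_pos hn).le (neg_nonneg.2 hJ')
    linarith
  have hlt : ((J' / (ξ / (ξ + d)) : ℝ) : EReal) <
      min (legendre F Λ δ) (legendre F Λ (-δ)) := by
    by_contra! hn
    refine absurd hy' (not_lt.2 ((mul_le_mul_of_nonneg_left hn (EReal.coe_nonneg.2 hκ.le)).trans
      (le_of_eq ?_)))
    rw [← EReal.coe_mul, mul_div_cancel₀ _ hκ.ne']
  obtain ⟨J, hJ1, hJ2⟩ := EReal.lt_iff_exists_real_btwn.1 hlt
  rw [EReal.coe_lt_coe_iff] at hJ1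
  have hJ0 : 0 < J := (div_pos hJ' hκ).trans hJ1
  rw [div_lt_iff₀ hκ, mul_comm] at hJ1
  obtain ⟨h1, h2⟩ := lt_min_iff.1 hJ2
  obtain ⟨u₁, hu₁⟩ := lt_iSup_iff.1 h1
  obtain ⟨u₂, hu₂⟩ := lt_iSup_iff.1 h2
  rw [EReal.coe_lt_coe_iff] at hu₁ hu₂
  -- Since `F Λ ≥ 0` and `J > 0`, the near-maximizers satisfy `u₁ > 0` and `u₂ < 0`, the signs
  -- needed for Chernoff's bound in the two directions.
  have p1 := mul_nonneg hF0 (H.nonneg u₁)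
  have p2 := mul_nonneg hF0 (H.nonneg u₂)
  refine S.eventually_measureReal_supDeviation_le H.nonneg hF hr hr1 hol hCH hγ hdec hη hgdec hξ
    hmoment hδ hJ0 (u₁ := u₁) (u₂ := -u₂) ?_ ?_ hu₁ (by rw [neg_neg]; linarith) hJ1
  · exact (pos_of_mul_pos_left (show 0 < u₁ * δ by linarith) hδ.le).le
  · exact (pos_of_mul_pos_left (show 0 < -u₂ * δ by linarith) hδ.le).le

end IsEstimationSetting

/-! ## The two cases -/

theorem exists_bound_of_eventually_cocompact {d : ℕ} {φ : Rd d → ℝ} (hφ : Continuous φ) {C : ℝ}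
    (h : ∀ᶠ x in cocompact (Rd d), |φ x| ≤ C) : ∃ C', ∀ x, |φ x| ≤ C' := by
  obtain ⟨t, ht, hts⟩ := mem_cocompact.1 h
  obtain ⟨C₁, hC₁⟩ := ht.exists_bound_of_continuousOn hφ.continuousOn
  refine ⟨max C C₁, fun x => ?_⟩
  by_cases hx : x ∈ t
  · exact (hC₁ x hx).trans (le_max_right _ _)
  · exact (hts hx : |φ x| ≤ C).trans (le_max_left _ _)

theorem exists_bound_of_decay {d : ℕ} {φ : Rd d → ℝ} (hφ : Continuous φ) {η C : ℝ} (hη : 0 < η)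
    (h : ∀ z, |‖z‖ ^ η * φ z| ≤ C) : ∃ C', ∀ x, |φ x| ≤ C' := by
  refine exists_bound_of_eventually_cocompact (C := C) hφ ?_
  filter_upwards [(tendsto_norm_cocompact_atTop (E := Rd d)).eventually_ge_atTop 1] with x hx
  have h1 := h x
  rw [abs_mul, abs_of_nonneg (by positivity)] at h1
  exact (le_mul_of_one_le_left (abs_nonneg _) (Real.one_le_rpow hx hη.le)).trans h1

theorem HolderWith.abs_sub_le {d : ℕ} {k : Rd d → ℝ} {C r : ℝ≥0} (hk : HolderWith C r k)
    (x y : Rd d) : |k x - k y| ≤ C * ‖x - y‖ ^ (r : ℝ) := by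
  have := hk.dist_le x y
  rwa [Real.dist_eq, dist_eq_norm] at this

section

variable {d : ℕ} {Ω : Type*} [MeasurableSpace Ω] {P : Measure Ω} {X : ℕ → Ω → Rd d}
  {f K : Rd d → ℝ} {α : Fin d → ℕ} {h v : ℕ → ℝ} {a : ℝ}

theorem BiasCondition.exists_bound (hbias : BiasCondition α K f h v) (htail : TailCondition α K f) :
    Continuous (multiD α f) ∧ ∃ C, ∀ x, |multiD α f x| ≤ C := by
  obtain ⟨q, hq, -, -, -, hg, -⟩ := hbias
  obtain ⟨η, hη, C, hC⟩ := htail.density_decay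
  have hc := (hg.differentiable (by omega)).continuous
  exact ⟨hc, exists_bound_of_decay hc hη hC⟩

/-- Moving the derivatives onto `f` turns each mean into a `K`-smoothing of `∂^α f`, whose error is
`O(h_i^q)` uniformly in `x`. The average of `h_i^q`, multiplied by `v_n`, vanishes by hypothesis. -/
theorem BiasCondition.eventually_abs_le (hbias : BiasCondition α K f h v) (hK : IsKernel K)
    (hf : Integrable f) (dK : IsBddIterDiff (multiList α) K) (df : IsBddIterDiff (multiList α) f)
    (hg : ∃ C, ∀ x, |multiD α f x| ≤ C) (hpos : ∀ n, 1 ≤ n → 0 < h n)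
    (hv : ∀ n, 1 ≤ n → 0 < v n) {ε : ℝ} (hε : 0 < ε) : ∀ᶠ n in atTop, ∀ x,
      |v n * (meanEstimator α K f h n x - multiD α f x)| ≤ ε := by
  obtain ⟨q, hq, hmom, hKq, hlim, hgd, M, hM⟩ := hbias
  obtain ⟨C, hC0, hC⟩ := abs_integral_kernel_sub_le (by omega) hK.integrable hK.integral_eq_one hgd
    hM hg hmom hKq
  have hlim' := hlim.const_mul C
  rw [mul_zero] at hlim'
  filter_upwards [hlim'.eventually (gt_mem_nhds hε), eventually_ge_atTop 1] with n hn h1 x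
  have hn0 : (0 : ℝ) < n := by exact_mod_cast h1
  have e1 : meanEstimator α K f h n x - multiD α f x = (1 / (n : ℝ)) * ∑ i ∈ Finset.Icc 1 n,
      ((∫ z, K z * multiD α f (x - h i • z)) - multiD α f x) := by
    rw [meanEstimator, Finset.sum_sub_distrib, Finset.sum_const, Nat.card_Icc, mul_sub]
    congr 1
    · congr 1
      refine Finset.sum_congr rfl fun i hi => ?_
      have hi' := hpos i (Finset.mem_Icc.1 hi).1
      rw [integral_multiD_kernel_eq hK.integrable hf dK df hi' x]
      field_simp
    · simp only [nsmul_eq_mul, Nat.add_sub_cancel]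
      field_simp
  rw [e1, abs_mul, abs_mul, abs_of_pos (hv n h1), abs_of_pos (one_div_pos.2 hn0)]
  refine le_trans ?_ hn.le
  calc v n * (1 / n * |∑ i ∈ Finset.Icc 1 n,
        ((∫ z, K z * multiD α f (x - h i • z)) - multiD α f x)|)
      ≤ v n * (1 / n * ∑ i ∈ Finset.Icc 1 n, C * h i ^ q) := by
        have := hv n h1
        gcongr
        refine (Finset.abs_sum_le_sum_abs _ _).trans (Finset.sum_le_sum fun i hi => ?_)
        exact hC _ (hpos i (Finset.mem_Icc.1 hi).1) x
    _ = C * (v n / n * ∑ i ∈ Finset.Icc 1 n, h i ^ q) := by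
        rw [← Finset.mul_sum]; ring

theorem isEstimationSetting_of_cumulant (hd : 1 ≤ d) (hf : IsBoundedDensity f)
    (hX : IsIIDSample P X f) (hK : IsKernel K) (hbias : BiasCondition α K f h v)
    (hfuc : UniformContinuous f) (hA : IsAdmissibleArray α h v) (htail : TailCondition α K f)
    (hKd : TimesDifferentiable (multiLen α) K)
    (hKb : ∀ j < multiLen α, ∃ C, ∀ x, ‖iteratedFDeriv ℝ j K x‖ ≤ C)
    (hfd : TimesDifferentiable (multiLen α) f)
    (hfb : ∀ j < multiLen α, ∃ C, ∀ x, ‖iteratedFDeriv ℝ j f x‖ ≤ C) {B : ℝ} {Λ : ℝ → ℝ}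
    (hk : IsBddIntegrable (multiD α K) B)
    (hΛ : ∀ u, Tendsto (fun n =>
      (∑ i ∈ Finset.Icc 1 n, h i ^ d * kerPhi (multiD α K) (u * kernelWeight α h v n i)) /
        speed α h v n) atTop (𝓝 (Λ u))) :
    IsEstimationSetting P X α K f h v B Λ where
  dim_pos := hd
  density := hf
  uniformContinuous := hfuc
  sample := hX
  array := hA
  kernel := hk
  bias ε hε := by
    obtain ⟨hgc, hgb⟩ := hbias.exists_bound htail
    refine hbias.eventually_abs_le hK hf.integrable ?_ ?_ hgb hA.h_pos hA.v_pos hε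
    · refine TimesDifferentiable.isBddIterDiff (by rwa [length_multiList])
        (by rwa [length_multiList]) ?_ ?_ <;> rw [← multiD_eq_iterPartial]
      exacts [⟨B, hk.bound⟩, hk.measurable]
    · refine TimesDifferentiable.isBddIterDiff (by rwa [length_multiList])
        (by rwa [length_multiList]) ?_ ?_ <;> rw [← multiD_eq_iterPartial]
      exacts [hgb, hgc.measurable]
  cumulant := hΛ

/-- The factor `‖f‖_{U,∞} (1 - ad)` enters the supremum and clears the denominators. The shift of
the argument then cancels the linear part of `ψ` by `psiFun_eq`. -/
theorem gRate_eq_legendre_jump {B : ℝ} (H : IsBddIntegrable K B) (ha : 0 ≤ a * d) (ha1 : a * d < 1)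
    (hK : ∫ z, K z = 1) (hα : multiLen α = 0) (hv : IsUnitSeq v) (U : Set (Rd d)) {δ : ℝ}
    (hδ : δ ≠ 0) :
    gRate α a K f v U δ = legendre (supNormOn f U) (jumpCumulant (a * d) K) δ := by
  have hF0 : 0 ≤ supNormOn f U := Real.iSup_nonneg fun _ => abs_nonneg _
  rw [gRate]
  split_ifs with hF h2
  · rw [hF, legendre_zero_left _ hδ]
  · have hF' : 0 < supNormOn f U := lt_of_le_of_ne hF0 (Ne.symm hF)
    have h1 : 0 < 1 - a * d := by linarith
    rw [rateI, coe_mul_iSup_coe (by positivity), legendre]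
    congr 1
    funext u
    rw [← psiFun_eq H ha ha1 hK]
    congr 1
    field_simp
    ring
  · exact absurd ⟨hα, hv⟩ h2

theorem gRate_eq_legendre_quadratic (hnot : ¬(multiLen α = 0 ∧ IsUnitSeq v)) {σ : ℝ} (hσ0 : 0 < σ)
    (hσ : σ = (∫ z, multiD α K z ^ 2) / (1 - a ^ 2 * ((d + 2 * multiLen α : ℕ) : ℝ) ^ 2))
    (U : Set (Rd d)) {δ : ℝ} (hδ : δ ≠ 0) :
    gRate α a K f v U δ = legendre (supNormOn f U) (fun u => u ^ 2 * σ / 2) δ := by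
  have hF0 : 0 ≤ supNormOn f U := Real.iSup_nonneg fun _ => abs_nonneg _
  rw [gRate, if_neg hnot]
  split_ifs with hF
  · rw [hF, legendre_zero_left _ hδ]
  · have hF' : 0 < supNormOn f U := lt_of_le_of_ne hF0 (Ne.symm hF)
    rw [legendre_quadratic hF' hσ0, hσ]
    rw [hσ] at hσ0
    congr 1
    push_cast
    push_cast at hσ0
    have hne : 1 - a ^ 2 * ((d : ℝ) + 2 * multiLen α) ^ 2 ≠ 0 := fun e => by
      rw [e, div_zero] at hσ0; exact lt_irrefl _ hσ0
    have hne' : ∫ z, multiD α K z ^ 2 ≠ 0 := fun e => by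
      rw [e, zero_div] at hσ0; exact lt_irrefl _ hσ0
    field_simp

theorem IsSmoothKernel.exists_bound (hK : IsSmoothKernel α K) :
    ∀ j < multiLen α, ∃ C, ∀ x, ‖iteratedFDeriv ℝ j K x‖ ≤ C := by
  intro j hj
  obtain ⟨C, hC⟩ := exists_bound_of_eventually_cocompact (C := 1)
    (hK.differentiable j hj).continuous.norm (by
      filter_upwards [(hK.tendsto_zero j hj).eventually (gt_mem_nhds one_pos)] with x hx
      rw [abs_norm]; exact hx.le)
  exact ⟨C, fun x => (le_abs_self _).trans (hC x)⟩

/-- In both cases the assumptions give an estimation setting whose limiting cumulant generating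
function has the rate `g_U` as Legendre transform. -/
theorem exists_isEstimationSetting (hd : 1 ≤ d) (hf : IsBoundedDensity f)
    (hX : IsIIDSample P X f) (hv : ∀ n, 1 ≤ n → 0 < v n) (hK : IsKernel K)
    (hbias : BiasCondition α K f h v) (hfuc : UniformContinuous f) (hKreg : KernelRegularity α K)
    (hlog : ScaleLogCondition α h v) (htail : TailCondition α K f)
    (hcase : (multiLen α = 0 ∧ IsUnitSeq v ∧ IsPowerBandwidth d a h) ∨
      (((1 ≤ multiLen α ∧ IsUnitSeq v) ∨ IsModerateScale α h v) ∧
        IsRegVarBandwidth α a h ∧ IsSmoothKernel α K ∧ IsSmoothDensity α f)) :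
    ∃ (B : ℝ) (Λ Λ' : ℝ → ℝ), IsEstimationSetting P X α K f h v B Λ ∧ IsRateCumulant Λ Λ' ∧
      ∀ (U : Set (Rd d)) (δ : ℝ), δ ≠ 0 →
        gRate α a K f v U δ = legendre (supNormOn f U) Λ δ := by
  obtain ⟨CH, r, hr, -, hol⟩ := hKreg.holder
  have hkm : Measurable (multiD α K) := (hol.continuous hr).measurable
  have hd0 : (0 : ℝ) < d := by exact_mod_cast hd
  rcases hcase with ⟨hα, hvu, hh⟩ | ⟨hscale, hh, hKs, hfs⟩
  · have hα' := multiD_of_multiLen_eq_zero hα K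
    obtain ⟨C, hC⟩ := hK.bounded
    have H : IsBddIntegrable K C :=
      ⟨hα' ▸ hkm, hK.integrable, (abs_nonneg _).trans (hC 0), hC⟩
    have had : a * d < 1 := (lt_div_iff₀ hd0).1 hh.2.1
    have had0 : 0 ≤ a * d := mul_nonneg hh.1.le hd0.le
    have hA := hh.isRegVarSeq.isAdmissibleArray hv hh.1 (by simpa [hα] using had) hd (Or.inl hvu) hlog
    refine ⟨C, _, _, isEstimationSetting_of_cumulant hd hf hX hK hbias hfuc hA htail
      (fun j hj => by omega) (fun j hj => by omega) (fun j hj => by omega) (fun j hj => by omega)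
      (by rwa [hα']) (fun u => ?_), isRateCumulant_jump H had0 had hK.integral_eq_one,
      fun U δ hδ => gRate_eq_legendre_jump H had0 had hK.integral_eq_one hα hvu U hδ⟩
    rw [hα']
    exact hh.isRegVarSeq.tendsto_sum_kerPhi_jump H hvu hα hh.1 had hA u
  · obtain ⟨C, hC⟩ := hKs.bounded
    have H : IsBddIntegrable (multiD α K) C :=
      ⟨hkm, hKs.integrable, (abs_nonneg _).trans (hC 0), hC⟩
    have hp0 : (0 : ℝ) < (d : ℝ) + 2 * multiLen α := by positivity
    have hap : a * (d + 2 * multiLen α : ℕ) < 1 := by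
      push_cast
      exact (lt_div_iff₀ hp0).1 hh.2.1
    have hap0 : 0 ≤ a * (d + 2 * multiLen α : ℕ) := mul_nonneg hh.1.le (Nat.cast_nonneg _)
    have hA := hh.isRegVarSeq.isAdmissibleArray hv hh.1 hap hd (hscale.imp_left And.right) hlog
    -- A scale tending to infinity is not constantly `1`, so `gRate` takes its quadratic branch
    -- throughout case (B).
    have hnot : ¬(multiLen α = 0 ∧ IsUnitSeq v) := by
      rintro ⟨h0, hvu⟩
      rcases hscale with ⟨h1, -⟩ | ⟨hvt, -⟩
      · omega
      · obtain ⟨n, h2, h1⟩ := ((hvt.eventually_gt_atTop 1).and (eventually_ge_atTop 1)).exists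
        exact absurd (hvu n h1) h2.ne'
    have hσ : 0 < (∫ z, multiD α K z ^ 2) /
        (1 - a ^ 2 * ((d + 2 * multiLen α : ℕ) : ℝ) ^ 2) := by
      refine div_pos (lt_of_le_of_ne (integral_nonneg fun z => sq_nonneg _)
        (Ne.symm hKs.integral_sq_ne_zero)) ?_
      rw [← mul_pow, sub_pos]
      exact pow_lt_one₀ hap0 hap two_ne_zero
    exact ⟨C, _, _, isEstimationSetting_of_cumulant hd hf hX hK hbias hfuc hA htail
      hKs.differentiable hKs.exists_bound hfs.differentiable hfs.bounded H
      (fun u => hh.isRegVarSeq.tendsto_sum_kerPhi_quadratic H hh.1 hap hd hscale hA u),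
      isRateCumulant_quadratic hσ, fun U δ hδ => gRate_eq_legendre_quadratic hnot hσ rfl U hδ⟩

end

theorem theorem5 {d : ℕ} (hd : 1 ≤ d) {Ω : Type*} [MeasurableSpace Ω] (P : Measure Ω)
    [IsProbabilityMeasure P] (X : ℕ → Ω → Rd d) (f K : Rd d → ℝ) (α : Fin d → ℕ)
    (h v : ℕ → ℝ) (a ξ : ℝ)
    (hf : IsBoundedDensity f) (hX : IsIIDSample P X f)
    (hv : ∀ n, 1 ≤ n → 0 < v n)
    (hK : IsKernel K)
    (hbias : BiasCondition α K f h v)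
    (hξ : 0 < ξ) (hmoment : Integrable (fun x : Rd d => ‖x‖ ^ ξ * f x))
    (hfuc : UniformContinuous f)
    (hKreg : KernelRegularity α K)
    (hlog : ScaleLogCondition α h v)
    (htail : TailCondition α K f)
    (hcase : (multiLen α = 0 ∧ IsUnitSeq v ∧ IsPowerBandwidth d a h) ∨
      (((1 ≤ multiLen α ∧ IsUnitSeq v) ∨ IsModerateScale α h v) ∧
        IsRegVarBandwidth α a h ∧ IsSmoothKernel α K ∧ IsSmoothDensity α f))
    (U : Set (Rd d)) (δ : ℝ) (hδ : 0 < δ) :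
    -(gTilde α a K f v U δ) ≤ liminf (normLogProb P X α K f h v U δ) atTop ∧
    liminf (normLogProb P X α K f h v U δ) atTop
      ≤ limsup (normLogProb P X α K f h v U δ) atTop ∧
    limsup (normLogProb P X α K f h v U δ) atTop
      ≤ -(((ξ / (ξ + d) : ℝ) : EReal) * gTilde α a K f v U δ) := by
  obtain ⟨B, Λ, Λ', S, H, hg⟩ :=
    exists_isEstimationSetting hd hf hX hv hK hbias hfuc hKreg hlog htail hcase
  obtain ⟨CH, r, hr, hr1, hol⟩ := hKreg.holder
  obtain ⟨γ, hγ, Cγ, hdec⟩ := hKreg.decay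
  obtain ⟨η, hη, Cη, hgdec⟩ := htail.density_decay
  rw [gTilde, hg U δ hδ.ne', hg U (-δ) (neg_ne_zero.2 hδ.ne')]
  exact ⟨S.neg_min_legendre_le_liminf H U hδ, liminf_le_limsup,
    S.limsup_le_neg_min_legendre H U (NNReal.coe_pos.2 hr) (NNReal.coe_le_one.2 hr1)
      hol.abs_sub_le CH.coe_nonneg hγ hdec hη hgdec hξ hmoment hδ⟩
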